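/- Let $(M,J)$ be a compact connected complex manifold of complex dimension $m\ge 2$. Let $\mathrm{Aut}_r(M,J)$ be its reduced automorphism group, i.e. the subgroup of the group of biholomorphisms of $M$ generated by the time-one flows of the real holomorphic vector fields that vanish somewhere on $M$. Let $G\subset \mathrm{Aut}_r(M,J)$ be a compact subgroup, with Lie algebra $\mathfrak g$ regarded as a space of vector fields on $M$. Let $\Omega\in H^2(M,\mathbb R)$ be a de Rham class and let $\mathcal K^G_\Omega$ be the set of $G$-invariant Kähler forms $\omega$ in $\Omega$ (so that $(M,J)$ is Kähler and $\Omega$ is a Kähler class as soon as $\mathcal K^G_\Omega\ne\emptyset$). For $\omega\in\mathcal K^G_\Omega$ let $v_\omega=\omega^m/m!$ be the volume form of the metric $g=\omega(\cdot,J\cdot)$. For $X\in\mathfrak g$ and $b\in\mathbb R$, the Killing potential of $X$ with respect to $\omega$ with integral $b$ is the smooth function $h_{X,\omega,b}:M\to\mathbb R$ with $$\iota_X\omega=-dh_{X,\omega,b},\qquad \int_M h_{X,\omega,b}\,v_\omega=b .$$ Let $K\in\mathfrak g$ and let $a>0$ be a real number such that, for every $\omega\in\mathcal K^G_\Omega$,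 $K$ has a Killing potential $f_{K,\omega,a}$ with integral $a$ and $f_{K,\omega,a}>0$ on $M$. Then there is an $\mathbb R$-bilinear form $\mathcal B=\mathcal B^G_{\Omega,K,a}$ on $\mathfrak g$ such that, for every $\omega\in\mathcal K^G_\Omega$ and all $H_1,H_2\in\mathfrak g$ with Killing potentials $h_{H_1,\omega,0}$, $h_{H_2,\omega,0}$ with respect to $\omega$ with integral $0$, $$\mathcal B(H_1,H_2)=\int_M h_{H_1,\omega,0}\,h_{H_2,\omega,0}\,\frac{v_\omega}{f_{K,\omega,a}^{2m+1}} .$$ In particular, the right-hand side does not depend on the choice of $\omega\in\mathcal K^G_\Omega$. -/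

import Mathlib

open scoped Manifold ContDiff
open MeasureTheory

set_option maxSynthPendingDepth 3

noncomputable section

namespace KahlerGeometry

/-- The model space `ℂ^m`. -/
abbrev CSpace (m : ℕ) : Type := EuclideanSpace ℂ (Fin m)

/-! ### Tensors on a complex manifold

`M` is a complex manifold modelled on `ℂ^m`. Its real tangent space at `x` is
`TangentSpace 𝓘(ℝ, CSpace m) x`, a copy of `ℂ^m` through the preferred holomorphic chart at `x`. -/

section Forms

variable (m : ℕ) (M : Type*) [TopologicalSpace M] [ChartedSpace (CSpace m) M]

/-- (Not necessarily smooth) real vector fields on `M`. -/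
abbrev VField : Type _ := (x : M) → TangentSpace 𝓘(ℝ, CSpace m) x

/-- (Not necessarily smooth) real differential forms of degree `k` on `M`. -/
abbrev DForm (k : ℕ) : Type _ := (x : M) → TangentSpace 𝓘(ℝ, CSpace m) x [⋀^Fin k]→L[ℝ] ℝ

variable {m M}

/-- The complex structure `J`. As transition maps are holomorphic, multiplication by `i` on the
tangent spaces does not depend on the chart. -/
def J {x : M} (v : TangentSpace 𝓘(ℝ, CSpace m) x) : TangentSpace 𝓘(ℝ, CSpace m) x :=
  (Complex.I • (show CSpace m from v) : CSpace m)

/-- The differential at `y` of the inverse of the preferred chart at `x₀`. -/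
def chartInvDeriv (x₀ : M) (y : CSpace m) :
    CSpace m →L[ℝ] TangentSpace 𝓘(ℝ, CSpace m) ((extChartAt 𝓘(ℝ, CSpace m) x₀).symm y) :=
  mfderiv 𝓘(ℝ, CSpace m) 𝓘(ℝ, CSpace m) (extChartAt 𝓘(ℝ, CSpace m) x₀).symm y

/-- The expression of a form in the preferred chart at `x₀`, i.e. its pull-back under the inverse
of the chart; only its values on the target of the chart matter. -/
def DForm.inChart {k : ℕ} (α : DForm m M k) (x₀ : M) : CSpace m → CSpace m [⋀^Fin k]→L[ℝ] ℝ :=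
  fun y => (α ((extChartAt 𝓘(ℝ, CSpace m) x₀).symm y)).compContinuousLinearMap (chartInvDeriv x₀ y)

/-- Smooth forms. -/
def DForm.IsSmooth {k : ℕ} (α : DForm m M k) : Prop :=
  ∀ x₀ : M, ContDiffOn ℝ ∞ (α.inChart x₀) (extChartAt 𝓘(ℝ, CSpace m) x₀).target

/-- `dα = β`, where `d` is the exterior derivative. -/
def HasExtDeriv {k : ℕ} (α : DForm m M k) (β : DForm m M (k + 1)) : Prop :=
  ∀ x₀ : M, ∀ y ∈ (extChartAt 𝓘(ℝ, CSpace m) x₀).target,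
    extDeriv (α.inChart x₀) y = β.inChart x₀ y

theorem inChart_zero {k : ℕ} (x₀ : M) : (0 : DForm m M k).inChart x₀ = 0 := by
  ext y v; rfl

theorem inChart_add {k : ℕ} (α β : DForm m M k) (x₀ : M) :
    (α + β).inChart x₀ = α.inChart x₀ + β.inChart x₀ := by
  ext y v; rfl

theorem inChart_smul {k : ℕ} (c : ℝ) (α : DForm m M k) (x₀ : M) :
    (c • α).inChart x₀ = c • α.inChart x₀ := by
  ext y v; rfl

theorem DForm.IsSmooth.differentiableAt {k : ℕ} {α : DForm m M k} (h : α.IsSmooth) (x₀ : M)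
    {y : CSpace m} (hy : y ∈ (extChartAt 𝓘(ℝ, CSpace m) x₀).target) :
    DifferentiableAt ℝ (α.inChart x₀) y :=
  ((h x₀).differentiableOn (by simp)).differentiableAt
    ((isOpen_extChartAt_target x₀).mem_nhds hy)

theorem DForm.isSmooth_zero {k : ℕ} : (0 : DForm m M k).IsSmooth := fun x₀ => by
  rw [inChart_zero]; exact contDiffOn_const

theorem DForm.IsSmooth.add {k : ℕ} {α β : DForm m M k} (hα : α.IsSmooth) (hβ : β.IsSmooth) :
    (α + β).IsSmooth := fun x₀ => by
  rw [inChart_add]; exact (hα x₀).add (hβ x₀)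

theorem DForm.IsSmooth.smul {k : ℕ} {α : DForm m M k} (c : ℝ) (hα : α.IsSmooth) :
    (c • α).IsSmooth := fun x₀ => by
  rw [inChart_smul]; exact (hα x₀).const_smul c

theorem hasExtDeriv_zero {k : ℕ} : HasExtDeriv (0 : DForm m M k) 0 := fun x₀ y _ => by
  rw [inChart_zero, inChart_zero]
  simpa using extDeriv_smul (x := y) (0 : ℝ) (0 : CSpace m → CSpace m [⋀^Fin k]→L[ℝ] ℝ)

theorem HasExtDeriv.add {k : ℕ} {α α' : DForm m M k} {β β' : DForm m M (k + 1)}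
    (hα : α.IsSmooth) (hα' : α'.IsSmooth) (h : HasExtDeriv α β) (h' : HasExtDeriv α' β') :
    HasExtDeriv (α + α') (β + β') := fun x₀ y hy => by
  rw [inChart_add, inChart_add, Pi.add_apply, ← h x₀ y hy, ← h' x₀ y hy]
  exact extDeriv_add (hα.differentiableAt x₀ hy) (hα'.differentiableAt x₀ hy)

theorem HasExtDeriv.smul {k : ℕ} {α : DForm m M k} {β : DForm m M (k + 1)} (c : ℝ)
    (h : HasExtDeriv α β) : HasExtDeriv (c • α) (c • β) := fun x₀ y hy => by
  rw [inChart_smul, inChart_smul, Pi.smul_apply, ← h x₀ y hy]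
  exact extDeriv_smul _ _

variable (m M)

/-- Smooth closed forms of degree `k`. -/
def closedForms (k : ℕ) : Submodule ℝ (DForm m M k) where
  carrier := {β | β.IsSmooth ∧ HasExtDeriv β 0}
  zero_mem' := ⟨DForm.isSmooth_zero, hasExtDeriv_zero⟩
  add_mem' := fun {_ _} ha hb =>
    ⟨ha.1.add hb.1, by simpa using HasExtDeriv.add ha.1 hb.1 ha.2 hb.2⟩
  smul_mem' := fun c _ ha => ⟨ha.1.smul c, by simpa using HasExtDeriv.smul c ha.2⟩

/-- Exterior derivatives of smooth forms of degree `k`. -/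
def exactForms (k : ℕ) : Submodule ℝ (DForm m M (k + 1)) where
  carrier := {β | β.IsSmooth ∧ ∃ α : DForm m M k, α.IsSmooth ∧ HasExtDeriv α β}
  zero_mem' := ⟨DForm.isSmooth_zero, 0, DForm.isSmooth_zero, hasExtDeriv_zero⟩
  add_mem' := by
    rintro a b ⟨ha, α, hα, h⟩ ⟨hb, β, hβ, h'⟩
    exact ⟨ha.add hb, α + β, hα.add hβ, HasExtDeriv.add hα hβ h h'⟩
  smul_mem' := by
    rintro c a ⟨ha, α, hα, h⟩
    exact ⟨ha.smul c, c • α, hα.smul c, HasExtDeriv.smul c h⟩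

/-- The de Rham cohomology space `H²(M, ℝ)`. -/
abbrev DeRhamH2 : Type _ :=
  closedForms m M 2 ⧸ (exactForms m M 1).comap (closedForms m M 2).subtype

end Forms

/-! ### Holomorphic automorphisms -/

section Automorphisms

variable (m : ℕ) (M : Type*) [TopologicalSpace M] [ChartedSpace (CSpace m) M]

/-- The group `Aut(M, J)` of biholomorphic maps of `M`. -/
def Aut : Subgroup (M ≃ₜ M) where
  carrier := {Φ | ContMDiff 𝓘(ℂ, CSpace m) 𝓘(ℂ, CSpace m) ω Φ ∧
    ContMDiff 𝓘(ℂ, CSpace m) 𝓘(ℂ, CSpace m) ω Φ.symm}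
  one_mem' := ⟨contMDiff_id, contMDiff_id⟩
  mul_mem' := fun {_ _} ha hb => ⟨ha.1.comp hb.1, hb.2.comp ha.2⟩
  inv_mem' := fun {_} ha => ⟨ha.2, ha.1⟩

variable {m M}

/-- `θ` is the flow of the vector field `X`. -/
def IsFlow (X : VField m M) (θ : ℝ → Aut m M) : Prop :=
  (∀ x : M, (θ 0 : M ≃ₜ M) x = x) ∧ ∀ x : M, IsMIntegralCurve (fun t => (θ t : M ≃ₜ M) x) X

/-- `X` is a (real) holomorphic vector field: a holomorphic section of the tangent bundle. -/
def IsHolomorphicField [IsManifold 𝓘(ℂ, CSpace m) ω M] (X : VField m M) : Prop :=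
  ContMDiff 𝓘(ℂ, CSpace m) 𝓘(ℂ, CSpace m).tangent ω
    (fun x => (⟨x, X x⟩ : TangentBundle 𝓘(ℂ, CSpace m) M))

variable (m M) in
/-- The reduced automorphism group `Aut_r(M, J)`: the connected group generated by the
exponentials (time-one flows) of the holomorphic vector fields which have a zero. -/
def reducedAut [IsManifold 𝓘(ℂ, CSpace m) ω M] : Subgroup (Aut m M) :=
  Subgroup.closure {Φ | ∃ X : VField m M, IsHolomorphicField X ∧ (∃ x, X x = 0) ∧
    ∃ θ : ℝ → Aut m M, IsFlow X θ ∧ θ 1 = Φ}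

/-- `G` is compact in the compact-open topology. -/
def IsCompactGroup (G : Subgroup (Aut m M)) : Prop :=
  IsCompact ((fun Φ : Aut m M => ((Φ : M ≃ₜ M) : C(M, M))) '' (G : Set (Aut m M)))

/-- The Lie algebra `𝔤` of `G`, as a space of vector fields on `M`: those which generate a
one-parameter subgroup of `G`. For compact `G` these already form a linear subspace; the span only
supplies the structure of a vector space. -/
def lieAlg [IsManifold 𝓘(ℂ, CSpace m) ω M] (G : Subgroup (Aut m M)) : Submodule ℝ (VField m M) :=
  Submodule.span ℝ {X | IsHolomorphicField X ∧ ∃ θ : ℝ → Aut m M, IsFlow X θ ∧ ∀ t, θ t ∈ G}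

end Automorphisms

/-! ### Kähler metrics -/

section Kahler

variable {m : ℕ} {M : Type*} [TopologicalSpace M] [ChartedSpace (CSpace m) M]

/-- The bilinear form `g = η(·, J·)` of a real 2-form `η`. -/
def metricOf (η : DForm m M 2) (x : M) (v w : TangentSpace 𝓘(ℝ, CSpace m) x) : ℝ :=
  η x ![v, J w]

/-- `η` is a Kähler form: smooth, closed, `J`-invariant, and positive, i.e. `g = η(·, J·)` is
positive definite. -/
structure IsKahler (η : DForm m M 2) : Prop where
  closed : η ∈ closedForms m M 2
  invariant : ∀ (x : M) (v w : TangentSpace 𝓘(ℝ, CSpace m) x), η x ![J v, J w] = η x ![v, w]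
  pos : ∀ (x : M) (v : TangentSpace 𝓘(ℝ, CSpace m) x), v ≠ 0 → 0 < metricOf η x v v

/-- `Φ^* η = η` for all `Φ ∈ G`. -/
def IsInvariantForm (G : Subgroup (Aut m M)) (η : DForm m M 2) : Prop :=
  ∀ Φ ∈ G, ∀ (x : M) (v w : TangentSpace 𝓘(ℝ, CSpace m) x),
    η ((Φ : M ≃ₜ M) x)
      ![mfderiv 𝓘(ℝ, CSpace m) 𝓘(ℝ, CSpace m) (Φ : M ≃ₜ M) x v,
        mfderiv 𝓘(ℝ, CSpace m) 𝓘(ℝ, CSpace m) (Φ : M ≃ₜ M) x w] = η x ![v, w]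

/-- The space `𝒦_Ω^G` of `G`-invariant Kähler forms in the class `Ω`. -/
def kahlerSpace (G : Subgroup (Aut m M)) (Ω : DeRhamH2 m M) : Set (DForm m M 2) :=
  {η | ∃ h : IsKahler η, Submodule.Quotient.mk ⟨η, h.closed⟩ = Ω ∧ IsInvariantForm G η}

/-- The standard real basis `e₁, …, e_m, i e₁, …, i e_m` of `ℂ^m`. -/
def realBasisVec : Fin m ⊕ Fin m → CSpace m :=
  Sum.elim (fun j => EuclideanSpace.single j 1) (fun j => EuclideanSpace.single j Complex.I)

/-- The Riemannian volume density `√det(g_ab)` of `g = η(·, J·)` in the real coordinates of the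
preferred chart at `x₀`. -/
def volDensity (η : DForm m M 2) (x₀ : M) (y : CSpace m) : ℝ :=
  Real.sqrt (Matrix.det (Matrix.of fun a b : Fin m ⊕ Fin m =>
    metricOf η ((extChartAt 𝓘(ℝ, CSpace m) x₀).symm y)
      (chartInvDeriv x₀ y (realBasisVec a)) (chartInvDeriv x₀ y (realBasisVec b))))

/-- The volume measure `v_η` (of `η^m / m!`, i.e. of the Riemannian metric `g = η(·, J·)`) on the
domain of the preferred chart at `x₀`, extended by zero to `M`. -/
def chartVolume [MeasurableSpace M] (η : DForm m M 2) (x₀ : M) : Measure M :=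
  ((volume.restrict (extChartAt 𝓘(ℝ, CSpace m) x₀).target).withDensity
    (fun y => ENNReal.ofReal (volDensity η x₀ y))).map (extChartAt 𝓘(ℝ, CSpace m) x₀).symm

/-- The volume measure `v_η`. By the change of variables formula the measures `chartVolume η x₀`
agree on the overlaps of the chart domains; their supremum is the measure on `M` which restricts
to each of them. -/
def kahlerVolume [MeasurableSpace M] (η : DForm m M 2) : Measure M :=
  ⨆ x₀ : M, chartVolume η x₀

/-- `f` is the Killing potential `f_{X,η,a}` of `X` with respect to `η` with integral `a`:
`f` is smooth, `ι_X η = -df` and `∫ f v_η = a`. -/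
structure IsKillingPotential [MeasurableSpace M] (η : DForm m M 2) (X : VField m M) (a : ℝ)
    (f : M → ℝ) : Prop where
  smooth : ContMDiff 𝓘(ℝ, CSpace m) 𝓘(ℝ, ℝ) ∞ f
  contract : ∀ (x : M) (v : TangentSpace 𝓘(ℝ, CSpace m) x),
    η x ![X x, v] = -(mfderiv 𝓘(ℝ, CSpace m) 𝓘(ℝ, ℝ) f x v : ℝ)
  integral_eq : ∫ x, f x ∂(kahlerVolume η) = a

end Kahler

end KahlerGeometry

end

open KahlerGeometry

/-! Let `η₀`, `η₁` be two forms of the class, `η₁ - η₀ = dα`, and `η_t = η₀ + t dα`, which is again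
Kähler. If `h` is a tuple of potentials of fields `X i ∈ 𝔤` for `η₀`, and `u` a tuple of potentials
of the same fields for `η₁ - η₀`, then `h_t = h + t u` is a tuple of potentials for `η_t`. With `Z`
the field such that `ι_Z η_t = α`, closedness gives `L_Z η_t = dα`, so `v_t` varies by the
divergence of `Z`. Since `dh_t(Z) = α(X)`, integrating by parts gives, for smooth `F`, `d/dt ∫
F(h_t) v_t = ∫ dF(h_t)(u - α(X)) v_t` (`integral_segment`, `dAt_sharpField`).

Every pull-back of `α` by an element of `G` is also a primitive of `η₁ - η₀`, so `α(X)` may be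
replaced by its mean `D X` over `G` (`hasDerivAt_integral_segment`). The averaged 1-form is
`G`-invariant, so Cartan's formula makes `D X` a potential of `X` for `η₁ - η₀`
(`hasFDerivAt_avgEval`). Hence `u - D X` is a constant vector `r`. Taking for `F` a coordinate,
equality of the integrals at both ends forces `r = 0`; then for every `F` the derivative vanishes
and `∫ F(h_t) v_t` has the same value at `η₀` and at `η₁` (`integral_comp_eq_of_integral_eq`). The
theorem is the case of the potentials of `H₁`, `H₂`, `K` with `F(x, y, z) = x y / z^(2m+1)`; no
property of the exponent enters.

The averaged 1-form is never shown to be smooth. Differentiability suffices, and it follows from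
joint continuity of the action of `G` together with Cauchy's estimates for the holomorphic maps in
`G`.

The bilinear form is the weighted product for one fixed `η₀`, on the subspace of `𝔤` where
potentials exist, extended to `𝔤` by a linear projection. -/

set_option linter.unusedSectionVars false

noncomputable section

namespace KahlerGeometry

/-! ### Charts: transition maps, forms and vector fields in coordinates. -/

section

variable {m : ℕ} {M : Type*} [TopologicalSpace M] [ChartedSpace (CSpace m) M]

theorem isManifold_real [IsManifold 𝓘(ℂ, CSpace m) ω M] : IsManifold 𝓘(ℝ, CSpace m) ω M := by
  refine isManifold_of_contDiffOn _ _ _ fun e e' he he' => ?_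
  have h := (contDiffGroupoid ω 𝓘(ℂ, CSpace m)).compatible he he'
  exact (contDiffGroupoid ω 𝓘(ℂ, CSpace m)|>.compatible he he').1.restrict_scalars ℝ

abbrev chart (m : ℕ) {M : Type*} [TopologicalSpace M] [ChartedSpace (CSpace m) M] (c : M) :
    PartialEquiv M (CSpace m) := extChartAt 𝓘(ℝ, CSpace m) c

variable [IsManifold 𝓘(ℝ, CSpace m) ∞ M]

theorem mdifferentiableAt_chart_symm  (c : M) {y : CSpace m} (hy : y ∈ (chart m c).target) :
   MDifferentiableAt 𝓘(ℝ, CSpace m) 𝓘(ℝ, CSpace m) (chart m c).symm y :=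
    ((contMDiffOn_extChartAt_symm (I := 𝓘(ℝ, CSpace m)) (n := ∞) c).contMDiffAt
      ((isOpen_extChartAt_target c).mem_nhds hy)).mdifferentiableAt (by simp)

theorem mdifferentiableAt_chart  (c : M) {x : M} (hx : x ∈ (chart m c).source) :
   MDifferentiableAt 𝓘(ℝ, CSpace m) 𝓘(ℝ, CSpace m) (chart m c) x :=
    (contMDiffAt_extChartAt' (I := 𝓘(ℝ, CSpace m)) (n := ∞) (by simpa using hx)).mdifferentiableAt
      (by simp)

/-- The tangent space at a point is read in the chart preferred at that point, so the differential
of an inverse chart is the derivative of a transition map. -/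
theorem chartInvDeriv_eq (c : M) {y : CSpace m} (hy : y ∈ (chart m c).target) :
    chartInvDeriv c y = fderiv ℝ (fun z => chart m ((chart m c).symm y) ((chart m c).symm z)) y :=
      by
  refine (mdifferentiableAt_chart_symm c hy).mfderiv.trans ?_
  rw [ModelWithCorners.range_eq_univ, fderivWithin_univ]
  rfl

theorem mfderiv_chart_chartInvDeriv (c : M) {y : CSpace m} (hy : y ∈ (chart m c).target)
    (v : CSpace m):  (mfderiv 𝓘(ℝ, CSpace m) 𝓘(ℝ, CSpace m) (chart m c) ((chart m c).symm y))
    (chartInvDeriv c y v) = v := by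
  have := mfderiv_extChartAt_comp_mfderivWithin_extChartAt_symm (I := 𝓘(ℝ, CSpace m)) hy
  rw [ModelWithCorners.range_eq_univ, mfderivWithin_univ] at this
  exact congr($this v)

theorem chartInvDeriv_mfderiv_chart (c : M) {y : CSpace m} (hy : y ∈ (chart m c).target)
    (v : TangentSpace 𝓘(ℝ, CSpace m) ((chart m c).symm y)):  chartInvDeriv c y
    (mfderiv 𝓘(ℝ, CSpace m) 𝓘(ℝ, CSpace m) (chart m c) ((chart m c).symm y) v)  = v := by
  have := mfderivWithin_extChartAt_symm_comp_mfderiv_extChartAt (I := 𝓘(ℝ, CSpace m)) hy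
  rw [ModelWithCorners.range_eq_univ, mfderivWithin_univ] at this
  exact congr($this v)

theorem fderiv_comp_chart_symm {F : Type*} [NormedAddCommGroup F] [NormedSpace ℝ F] {f : M → F}
    (c : M) {y : CSpace m} (hy : y ∈ (chart m c).target) (hf : MDifferentiableAt 𝓘(ℝ, CSpace m)
    𝓘(ℝ, F) f ((chart m c).symm y)) (v : CSpace m) :
   fderiv ℝ (fun z => f ((chart m c).symm z)) y v = mfderiv 𝓘(ℝ, CSpace m) 𝓘(ℝ, F) f
     ((chart m c).symm y) (chartInvDeriv c y v) := by
  rw [← mfderiv_eq_fderiv]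
  exact congr($(mfderiv_comp y hf (mdifferentiableAt_chart_symm c hy)) v)

/-- The differential of a function with values in a vector space. -/
def dAt {F : Type*} [NormedAddCommGroup F] [NormedSpace ℝ F] (f : M → F) (x : M)
    (v : TangentSpace 𝓘(ℝ, CSpace m) x) : F :=
  mfderiv 𝓘(ℝ, CSpace m) 𝓘(ℝ, F) f x v

theorem fderiv_comp_chart_symm' {F : Type*} [NormedAddCommGroup F] [NormedSpace ℝ F] {f : M → F}
    (c : M) {y : CSpace m} (hy : y ∈ (chart m c).target) (hf : ContMDiff 𝓘(ℝ, CSpace m) 𝓘(ℝ, F) ∞ f)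
    (v : CSpace m) :
    fderiv ℝ (fun z => f ((chart m c).symm z)) y v = dAt f ((chart m c).symm y)
      (chartInvDeriv c y v) :=
  fderiv_comp_chart_symm c hy ((hf _).mdifferentiableAt (by simp)) v

theorem dAt_eq_fderiv {F : Type*} [NormedAddCommGroup F] [NormedSpace ℝ F] {f : M → F}
    (hf : ContMDiff 𝓘(ℝ, CSpace m) 𝓘(ℝ, F) ∞ f) (x : M) (v : TangentSpace 𝓘(ℝ, CSpace m) x) :
    dAt f x v = fderiv ℝ (fun y => f ((chart m x).symm y)) (chart m x x) v := by
  have h := ((hf x).mdifferentiableAt (by simp)).mfderiv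
  rw [ModelWithCorners.range_eq_univ, fderivWithin_univ] at h
  exact congr($h v)

/-- The transition map between two preferred charts. -/
def trans (m : ℕ) {M : Type*} [TopologicalSpace M] [ChartedSpace (CSpace m) M] (c c' : M)
    (y : CSpace m) : CSpace m := chart m c' ((chart m c).symm y)

theorem chartInvDeriv_trans  (c c' : M) {y : CSpace m} (hy : y ∈ (chart m c).target)
    (hy' : (chart m c).symm y ∈ (chart m c').source) (v : CSpace m) :
    (chartInvDeriv c y v : CSpace m) = (chartInvDeriv c' (trans m c c' y)
      (fderiv ℝ (trans m c c') y v) : CSpace m) := by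
  have h1 : fderiv ℝ (trans m c c') y v = mfderiv 𝓘(ℝ, CSpace m) 𝓘(ℝ, CSpace m) (chart m c')
    ((chart m c).symm y) (chartInvDeriv c y v) :=
    fderiv_comp_chart_symm c hy (mdifferentiableAt_chart c' hy') v
  have h2 : trans m c c' y ∈ (chart m c').target := (chart m c').map_source hy'
  have h3 : (chart m c').symm (trans m c c' y) = (chart m c).symm y := (chart m c').left_inv hy'
  rw [h1]
  have := chartInvDeriv_mfderiv_chart c' h2
  rw [h3] at this
  exact (this _).symm

theorem inChart_trans {k : ℕ} (α : DForm m M k) (c c' : M) {y : CSpace m}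
    (hy : y ∈ (chart m c).target) (hy' : (chart m c).symm y ∈ (chart m c').source) :
    α.inChart c y = (α.inChart c' (trans m c c' y)).compContinuousLinearMap
      (fderiv ℝ (trans m c c') y) := by
  have h3 : (chart m c').symm (trans m c c' y) = (chart m c).symm y := (chart m c').left_inv hy'
  ext v
  -- The two base points are equal but not definitionally, and the tangent space depends on the
  -- point; generalizing the point removes the mismatch.
  have key : ∀ x' (h : x' = (chart m c).symm y) (w w' : Fin k → CSpace m), w = w' → α
    ((chart m c).symm y) w = α x' w' := by
    rintro _ rfl w w' rfl; rfl
  exact key _ h3 _ _ (funext fun i => chartInvDeriv_trans c c' hy hy' (v i))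

/-- In the chart preferred at `x` the transition map is the identity near the centre. Pointwise
constructions can thus be compared with chart expressions. -/
theorem inChart_self {k : ℕ} (α : DForm m M k) (x : M)  (v : Fin k → TangentSpace 𝓘(ℝ, CSpace m) x)
    :
    α x v = α.inChart x (chart m x x) v := by
  have hy := mem_extChartAt_target (I := 𝓘(ℝ, CSpace m)) x
  have h3 : (chart m x).symm (chart m x x) = x := extChartAt_to_inv x
  have key : ∀ x' (h : x' = x) (w w' : Fin k → CSpace m), w = w' → α x w = α x' w' := by
    rintro _ rfl w w' rfl; rfl
  refine key _ h3 _ _ (funext fun i => ?_)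
  change _ = (chartInvDeriv x (chart m x x) (v i) : CSpace m)
  rw [chartInvDeriv_eq x hy, h3]
  have : (fun z => chart m x ((chart m x).symm z)) =ᶠ[nhds (chart m x x)] id := by
    filter_upwards [(isOpen_extChartAt_target x).mem_nhds hy] with z hz
    exact (chart m x).right_inv hz
  rw [this.fderiv_eq, fderiv_id]; rfl

variable {m : ℕ} {M : Type*} [TopologicalSpace M] [ChartedSpace (CSpace m) M]

theorem trans_contDiffOn_complex [IsManifold 𝓘(ℂ, CSpace m) ω M] (c c' : M) :
    ContDiffOn ℂ ω (trans m c c') ((chart m c).target ∩ (chart m c).symm ⁻¹' (chart m c').source) :=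
      by
  have := contDiffOn_ext_coord_change (I := 𝓘(ℂ, CSpace m)) (n := ω) c' c
  refine this.congr_mono (fun y hy => rfl) ?_
  intro y hy
  simpa [mfld_simps] using hy

theorem trans_contDiffOn [IsManifold 𝓘(ℝ, CSpace m) ∞ M] (c c' : M) :
    ContDiffOn ℝ ∞ (trans m c c') ((chart m c).target ∩ (chart m c).symm ⁻¹' (chart m c').source) :=
      by
  have := contDiffOn_ext_coord_change (I := 𝓘(ℝ, CSpace m)) (n := ∞) c' c
  refine this.congr_mono (fun y hy => rfl) ?_
  intro y hy
  simpa [mfld_simps] using hy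

theorem isOpen_trans_source (c c' : M) :
   IsOpen ((chart m c).target ∩ (chart m c).symm ⁻¹' (chart m c').source) :=
  (continuousOn_extChartAt_symm c).isOpen_inter_preimage (isOpen_extChartAt_target c)
    (isOpen_extChartAt_source c')

theorem fderiv_trans_smul [IsManifold 𝓘(ℂ, CSpace m) ω M] (c c' : M) {y : CSpace m}
    (hy : y ∈ (chart m c).target) (hy' : (chart m c).symm y ∈ (chart m c').source) (z : ℂ)
    (v : CSpace m) :
    fderiv ℝ (trans m c c') y (z • v) = z • fderiv ℝ (trans m c c') y v := by
  have h : DifferentiableAt ℂ (trans m c c') y :=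
    ((trans_contDiffOn_complex c c').differentiableOn (by simp)).differentiableAt
      ((isOpen_trans_source c c').mem_nhds ⟨hy, hy'⟩)
  rw [h.fderiv_restrictScalars ℝ]
  simp

/-- The map is the derivative of a holomorphic transition map, hence complex linear. -/
theorem chartInvDeriv_J [IsManifold 𝓘(ℂ, CSpace m) ω M] [IsManifold 𝓘(ℝ, CSpace m) ∞ M] (c : M)
    {y : CSpace m} (hy : y ∈ (chart m c).target) (v : CSpace m) :
    chartInvDeriv c y (Complex.I • v) = J (chartInvDeriv c y v) := by
  rw [chartInvDeriv_eq c hy]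
  exact fderiv_trans_smul c _ hy (mem_extChartAt_source _) _ _

variable [IsManifold 𝓘(ℂ, CSpace m) ω M]
theorem Aut.contMDiff (Φ : Aut m M) : ContMDiff 𝓘(ℝ, CSpace m) 𝓘(ℝ, CSpace m) ∞ (Φ : M ≃ₜ M) := by
  intro x
  have := (Φ.2.1 x)
  rw [contMDiffAt_iff] at this ⊢
  refine ⟨this.1, ?_⟩
  have h2 := (this.2.restrict_scalars ℝ).of_le (show (∞ : WithTop ℕ∞) ≤ ω from le_top)
  exact h2

/-- A vector field in a chart. -/
def VField.inChart (X : VField m M) (c : M) (y : CSpace m) : CSpace m :=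
  mfderiv 𝓘(ℝ, CSpace m) 𝓘(ℝ, CSpace m) (chart m c) ((chart m c).symm y) (X ((chart m c).symm y))

theorem VField.chartInvDeriv_inChart [IsManifold 𝓘(ℝ, CSpace m) ∞ M] (X : VField m M) (c : M)
    {y : CSpace m} (hy : y ∈ (chart m c).target) :
   chartInvDeriv c y (X.inChart c y) = X ((chart m c).symm y) :=
  chartInvDeriv_mfderiv_chart c hy _

theorem VField.inChart_add (X Y : VField m M) (c : M)  :
   (X + Y).inChart c = X.inChart c + Y.inChart c := by
  ext1 y
  exact map_add (mfderiv 𝓘(ℝ, CSpace m) 𝓘(ℝ, CSpace m) (chart m c) ((chart m c).symm y))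
    (X ((chart m c).symm y)) (Y ((chart m c).symm y))

theorem VField.inChart_smul (a : ℝ) (X : VField m M) (c : M)  :
   (a • X).inChart c = a • X.inChart c := by
  ext1 y
  exact map_smul (mfderiv 𝓘(ℝ, CSpace m) 𝓘(ℝ, CSpace m) (chart m c) ((chart m c).symm y)) a
    (X ((chart m c).symm y))

theorem VField.inChart_eq [IsManifold 𝓘(ℝ, CSpace m) ∞ M] (X : VField m M) (c : M) {y : CSpace m}
    (hy : y ∈ (chart m c).target) :
   X.inChart c y = fderiv ℝ (chart m c ∘ (chart m ((chart m c).symm y)).symm)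
     (chart m ((chart m c).symm y) ((chart m c).symm y)) (X ((chart m c).symm y)) := by
  have := (mdifferentiableAt_chart c ((chart m c).map_target hy)).mfderiv
  rw [VField.inChart, this, ModelWithCorners.range_eq_univ, fderivWithin_univ]
  rfl

/-- The chart expression is the fibre coordinate of the section in the trivialization of the tangent
bundle centred at `c`; the real and complex derivatives of the holomorphic transition map agree. -/
theorem IsHolomorphicField.contDiffOn_inChart_complex [IsManifold 𝓘(ℝ, CSpace m) ∞ M]
    {X : VField m M} (hX : IsHolomorphicField X) (c : M) :
    ContDiffOn ℂ ω (X.inChart c) (chart m c).target := by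
  have h3 : ContDiffOn ℂ ω (fun z => ((trivializationAt (CSpace m) (TangentSpace 𝓘(ℂ, CSpace m)) c)
    ⟨(chart m c).symm z, X ((chart m c).symm z)⟩).2) (chart m c).target := by
    intro y hy
    have h1 := (hX ((chart m c).symm y))
    have h2 := ((trivializationAt (CSpace m) (TangentSpace 𝓘(ℂ, CSpace m))
      c).contMDiffAt_section_iff (by simpa [mfld_simps] using (chart m c).map_target hy)).1 h1
    have h4 := (contMDiffOn_extChartAt_symm (I := 𝓘(ℂ, CSpace m)) (n := ω) c).contMDiffAt
      ((isOpen_extChartAt_target c).mem_nhds hy)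
    exact (ContMDiffAt.comp y h2 h4).contDiffAt.contDiffWithinAt
  refine h3.congr fun y hy => ?_
  rw [X.inChart_eq c hy, TangentBundle.trivializationAt_apply, ModelWithCorners.range_eq_univ,
    fderivWithin_univ]
  set x := (chart m c).symm y
  have h : DifferentiableAt ℂ (trans m x c) (chart m x x) :=
    ((trans_contDiffOn_complex x c).differentiableOn (by simp)).differentiableAt
      ((isOpen_trans_source x c).mem_nhds ⟨mem_extChartAt_target x, by
      have : (chart m x).symm (chart m x x) = x := extChartAt_to_inv x
      rw [Set.mem_preimage, this]; exact (chart m c).map_target hy⟩)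
  exact congr($(h.fderiv_restrictScalars ℝ) (X x))

theorem IsHolomorphicField.contDiffOn_inChart [IsManifold 𝓘(ℝ, CSpace m) ∞ M] {X : VField m M}
    (hX : IsHolomorphicField X) (c : M) :
    ContDiffOn ℝ ∞ (X.inChart c) (chart m c).target :=
  ((hX.contDiffOn_inChart_complex c).restrict_scalars ℝ).of_le le_top

end

/-! ### The Riemannian volume density in coordinates. -/

section

variable {m : ℕ}

/-- The standard real basis of `ℂ^m`. -/
def realBasis (m : ℕ) : Module.Basis (Fin m ⊕ Fin m) ℝ (CSpace m) :=
  Module.Basis.ofEquivFun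
    { toFun := fun v => Sum.elim (fun j => (v j).re) (fun j => (v j).im)
      map_add' := fun v w => by ext (j | j) <;> simp
      map_smul' := fun r v => by ext (j | j) <;> simp
      invFun := fun f => WithLp.toLp 2 fun j => ⟨f (Sum.inl j), f (Sum.inr j)⟩
      left_inv := fun v => by ext j; simp
      right_inv := fun f => by ext (j | j) <;> simp }

theorem realBasis_apply (a : Fin m ⊕ Fin m) : realBasis m a = realBasisVec a := by
  have : realBasisVec a = (realBasis m).equivFun.symm (Pi.single a 1) := by
    rw [LinearEquiv.eq_symm_apply]
    ext b
    rcases a with a | a <;> rcases b with b | b <;>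
      simp [realBasis, realBasisVec, Pi.single_apply] <;> split_ifs <;> simp
  rw [this]; simp

theorem update_vec_zero {E : Type*} (u v x : E) : Function.update ![u, v] 0 x = ![x, v] := by
  ext i; fin_cases i <;> rfl

theorem update_vec_one {E : Type*} (u v x : E) : Function.update ![u, v] 1 x = ![u, x] := by
  ext i; fin_cases i <;> rfl

/-- The bilinear form of an alternating form of degree two. -/
def form2 {E : Type*} [AddCommGroup E] [Module ℝ E] [TopologicalSpace E] (w : E [⋀^Fin 2]→L[ℝ] ℝ) :
    E →ₗ[ℝ] E →ₗ[ℝ] ℝ :=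
  LinearMap.mk₂ ℝ (fun u v => w ![u, v])
    (fun u u' v =>
      by have := w.map_update_add ![u, v] 0 u u'; rwa [update_vec_zero, update_vec_zero, update_vec_zero] at this)
    (fun c u v =>
      by have := w.map_update_smul ![u, v] 0 c u; rwa [update_vec_zero, update_vec_zero] at this)
    (fun u v v' =>
      by have := w.map_update_add ![u, v] 1 v v'; rwa [update_vec_one, update_vec_one, update_vec_one] at this)
    (fun c u v =>
      by have := w.map_update_smul ![u, v] 1 c v; rwa [update_vec_one, update_vec_one] at this)

theorem form2_apply {E : Type*} [AddCommGroup E] [Module ℝ E] [TopologicalSpace E]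
    (w : E [⋀^Fin 2]→L[ℝ] ℝ) (u v : E) : form2 w u v = w ![u, v] := rfl

def mulI (m : ℕ) : CSpace m →ₗ[ℝ] CSpace m := (LinearMap.lsmul ℂ (CSpace m)
    Complex.I).restrictScalars ℝ

variable {M : Type*} [TopologicalSpace M] [ChartedSpace (CSpace m) M]

/-- The metric in a chart. -/
def gram (w : CSpace m [⋀^Fin 2]→L[ℝ] ℝ) : Matrix (Fin m ⊕ Fin m) (Fin m ⊕ Fin m) ℝ :=
  Matrix.of fun a b => w ![realBasis m a, Complex.I • realBasis m b]

theorem gram_eq (w : CSpace m [⋀^Fin 2]→L[ℝ] ℝ) : gram w = LinearMap.BilinForm.toMatrix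
    (realBasis m) ((form2 w).compl₂ (mulI m)) := by
  ext a b; simp [gram, form2, mulI]

/-- A complex linear `L` commutes with the `i` in `w(·, i·)`, so the Gram matrix becomes `Lᵀ G L`;
the determinant of `L` is the real one. -/
theorem det_gram_comp (w : CSpace m [⋀^Fin 2]→L[ℝ] ℝ) (L : CSpace m →L[ℝ] CSpace m)
    (hL : ∀ v, L (Complex.I • v) = Complex.I • L v) :
    (gram (w.compContinuousLinearMap L)).det = L.det ^ 2 * (gram w).det := by
  have : (form2 (w.compContinuousLinearMap L)).compl₂ (mulI m) = LinearMap.BilinForm.comp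
    ((form2 w).compl₂ (mulI m)) (L : CSpace m →ₗ[ℝ] CSpace m) (L : CSpace m →ₗ[ℝ] CSpace m) := by
    ext u v
    simp only [form2, mulI, LinearMap.compl₂_apply, LinearMap.mk₂_apply,
      LinearMap.BilinForm.comp_apply, LinearMap.coe_restrictScalars, LinearMap.lsmul_apply,
      ContinuousAlternatingMap.compContinuousLinearMap_apply, ContinuousLinearMap.coe_coe]
    congr 1
    ext i
    fin_cases i <;> simp [hL]
  rw [gram_eq, this, LinearMap.BilinForm.toMatrix_comp (b := realBasis m), gram_eq]
  rw [Matrix.det_mul, Matrix.det_mul, Matrix.det_transpose, LinearMap.det_toMatrix]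
  rw [ContinuousLinearMap.det]; ring

variable [IsManifold 𝓘(ℂ, CSpace m) ω M] [IsManifold 𝓘(ℝ, CSpace m) ∞ M]

theorem metricOf_inChart (η : DForm m M 2) (c : M) {y : CSpace m} (hy : y ∈ (chart m c).target)
    (v w : CSpace m) :
    metricOf η ((chart m c).symm y) (chartInvDeriv c y v) (chartInvDeriv c y w) = η.inChart c y
      ![v, Complex.I • w] := by
  rw [metricOf, ← chartInvDeriv_J c hy]
  change _ = η ((chart m c).symm y) _
  congr 1
  ext i
  fin_cases i <;> rfl

theorem volDensity_eq (η : DForm m M 2) (c : M) {y : CSpace m} (hy : y ∈ (chart m c).target) :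
    volDensity η c y = Real.sqrt (gram (η.inChart c y)).det := by
  rw [volDensity]
  congr 2
  ext a b
  simp only [Matrix.of_apply, gram]
  rw [realBasis_apply, realBasis_apply]
  exact metricOf_inChart η c hy _ _

/-- The square root of the squared Jacobian is its absolute value, which is the factor required by
the change of variables formula. -/
theorem volDensity_trans (η : DForm m M 2) (c c' : M) {y : CSpace m} (hy : y ∈ (chart m c).target)
    (hy' : (chart m c).symm y ∈ (chart m c').source) :
    volDensity η c y = |(fderiv ℝ (trans m c c') y).det| * volDensity η c' (trans m c c' y) := by
  have h2 : trans m c c' y ∈ (chart m c').target := (chart m c').map_source hy'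
  rw [volDensity_eq η c hy, volDensity_eq η c' h2, inChart_trans η c c' hy hy', det_gram_comp _ _
    (fun v => fderiv_trans_smul c c' hy hy' _ v), Real.sqrt_mul (sq_nonneg _), Real.sqrt_sq_eq_abs]

theorem continuousOn_gram (η : DForm m M 2) (hη : η.IsSmooth) (c : M) : ContinuousOn
    (fun y => (gram (η.inChart c y)).det) (chart m c).target := by
  have h : ContinuousOn (fun y => gram (η.inChart c y)) (chart m c).target := by
    refine continuousOn_pi.2 fun a => continuousOn_pi.2 fun b => ?_
    have := (hη c).continuousOn
    exact (ContinuousAlternatingMap.apply ℝ (CSpace m) ℝ ![realBasis m a, Complex.I • realBasis m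
      b]).continuous.comp_continuousOn this
  exact (Continuous.matrix_det continuous_id).comp_continuousOn h

theorem continuousOn_volDensity (η : DForm m M 2) (hη : η.IsSmooth) (c : M) : ContinuousOn
    (volDensity η c) (chart m c).target :=
  (Real.continuous_sqrt.comp_continuousOn (continuousOn_gram η hη c)).congr fun _ hy =>
    volDensity_eq η c hy

/-! ### The volume measure: gluing the chart measures. -/

section meas
variable [MeasurableSpace M] [BorelSpace M]

theorem aemeasurable_chart_symm (c : M) : AEMeasurable (chart m c).symm
    (volume.restrict (chart m c).target) :=
  (continuousOn_extChartAt_symm c).aemeasurable (isOpen_extChartAt_target c).measurableSet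

theorem measurableSet_chart_preimage (c : M) {S : Set M} (hS : MeasurableSet S) : MeasurableSet
    ((chart m c).target ∩ (chart m c).symm ⁻¹' S) := by
  have h : Measurable ((chart m c).target.domRestrict (chart m c).symm) :=
    (continuousOn_iff_continuous_domRestrict.1 (continuousOn_extChartAt_symm c)).measurable
  have := (isOpen_extChartAt_target (I := 𝓘(ℝ, CSpace m)) c).measurableSet.subtype_image (h hS)
  convert this using 1
  ext y
  exact ⟨fun h => ⟨⟨y, h.1⟩, h.2, rfl⟩, fun ⟨z, hz, hzy⟩ => hzy ▸ ⟨z.2, hz⟩⟩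

theorem chartVolume_apply (η : DForm m M 2) (c : M) {S : Set M} (hS : MeasurableSet S) :
    chartVolume η c S = ∫⁻ y in (chart m c).target ∩ (chart m c).symm ⁻¹' S, ENNReal.ofReal
      (volDensity η c y) := by
  have hac := withDensity_absolutelyContinuous (volume.restrict (chart m c).target)
    (fun y => ENNReal.ofReal (volDensity η c y))
  have hA := measurableSet_chart_preimage c hS (m := m)
  have hT := (isOpen_extChartAt_target (I := 𝓘(ℝ, CSpace m)) c).measurableSet
  rw [chartVolume, Measure.map_apply_of_aemeasurable ((aemeasurable_chart_symm c).mono_ac hac) hS]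
  have : (volume.restrict (chart m c).target).withDensity (fun y => ENNReal.ofReal
    (volDensity η c y)) ((chart m c).symm ⁻¹' S) = (volume.restrict (chart m c).target).withDensity
    (fun y => ENNReal.ofReal (volDensity η c y)) ((chart m c).target ∩ (chart m c).symm ⁻¹' S) := by
    refine measure_congr (hac ?_)
    filter_upwards [ae_restrict_mem hT] with y hy
    exact propext ⟨fun h => ⟨hy, h⟩, fun h => h.2⟩
  rw [this, withDensity_apply _ hA, Measure.restrict_restrict hA, Set.inter_assoc, Set.inter_comm _
    (chart m c).target, ← Set.inter_assoc, Set.inter_self]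

theorem chartVolume_compat (η : DForm m M 2) (c c' : M) {S : Set M} (hS : MeasurableSet S)
    (h : S ⊆ (chart m c).source) (h' : S ⊆ (chart m c').source) :
    chartVolume η c S = chartVolume η c' S := by
  rw [chartVolume_apply η c hS, chartVolume_apply η c' hS]
  have hA := measurableSet_chart_preimage c hS (m := m)
  have himg : (chart m c').target ∩ (chart m c').symm ⁻¹' S = trans m c c' ''
    ((chart m c).target ∩ (chart m c).symm ⁻¹' S) := by
    ext z
    constructor
    · rintro ⟨hz, hzS⟩
      refine ⟨chart m c ((chart m c').symm z), ⟨(chart m c).map_source (h hzS), ?_⟩, ?_⟩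
      · rw [Set.mem_preimage, (chart m c).left_inv (h hzS)]; exact hzS
      · rw [trans, (chart m c).left_inv (h hzS), (chart m c').right_inv hz]
    · rintro ⟨y, ⟨hy, hyS⟩, rfl⟩
      refine ⟨(chart m c').map_source (h' hyS), ?_⟩
      rw [Set.mem_preimage, trans, (chart m c').left_inv (h' hyS)]; exact hyS
  have hd : ∀ y ∈ (chart m c).target ∩ (chart m c).symm ⁻¹' S, HasFDerivWithinAt (trans m c c')
    (fderiv ℝ (trans m c c') y) ((chart m c).target ∩ (chart m c).symm ⁻¹' S) y := fun y hy =>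
    (((trans_contDiffOn c c').differentiableOn (by simp)).differentiableAt
      ((isOpen_trans_source c c').mem_nhds ⟨hy.1, h' hy.2⟩)).hasFDerivAt.hasFDerivWithinAt
  have hinj : Set.InjOn (trans m c c') ((chart m c).target ∩ (chart m c).symm ⁻¹' S) := by
    intro y hy z hz hyz
    have := (chart m c').injOn (h' hy.2) (h' hz.2) hyz
    exact (chart m c).symm.injOn hy.1 hz.1 this
  rw [himg, lintegral_image_eq_lintegral_abs_det_fderiv_mul volume hA hd hinj]
  refine setLIntegral_congr_fun hA fun y hy => ?_
  rw [volDensity_trans η c c' hy.1 (h' hy.2), ENNReal.ofReal_mul (abs_nonneg _)]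

theorem chartVolume_inter (η : DForm m M 2) (c : M) {S : Set M} (hS : MeasurableSet S) :
    chartVolume η c (S ∩ (chart m c).source) = chartVolume η c S := by
  rw [chartVolume_apply η c hS, chartVolume_apply η c (hS.inter
    (isOpen_extChartAt_source c).measurableSet)]
  congr 2
  ext y
  simp only [Set.mem_inter_iff, Set.mem_preimage]
  exact ⟨fun h => ⟨h.1, h.2.1⟩, fun h => ⟨h.1, h.2, (chart m c).map_target h.1⟩⟩

/-- A supremum of measures is controlled by one measure above all of them. Compactness gives a
countable cover by chart domains; its disjoint pieces `D n`, each with its own chart measure, glue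
to `ν`. Compatibility on overlaps shows that `ν` dominates every chart measure and agrees with the
measure of `c` inside the domain of `c`. -/
theorem kahlerVolume_apply_of_subset [CompactSpace M] (η : DForm m M 2) (c : M) {S : Set M}
    (hS : MeasurableSet S) (hSc : S ⊆ (chart m c).source) :
    kahlerVolume η S = chartVolume η c S := by
  refine le_antisymm ?_ (le_iSup (fun c => chartVolume η c) c S)
  obtain ⟨t, -, ht⟩ := isCompact_univ.elim_nhds_subcover (fun x : M => (chart m x).source) fun x _
    => (isOpen_extChartAt_source x).mem_nhds (mem_extChartAt_source x)
  have hne : (t : Set M).Nonempty := by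
    obtain ⟨i, hi, -⟩ := Set.mem_iUnion₂.1 (ht (Set.mem_univ c))
    exact ⟨i, hi⟩
  obtain ⟨x, hx⟩ := t.countable_toSet.exists_eq_range hne
  have hcov : ⋃ n, (chart m (x n)).source = Set.univ := by
    refine Set.eq_univ_of_forall fun p => ?_
    obtain ⟨i, hi, hp⟩ := Set.mem_iUnion₂.1 (ht (Set.mem_univ p))
    have : i ∈ Set.range x := hx ▸ hi
    obtain ⟨n, rfl⟩ := this
    exact Set.mem_iUnion.2 ⟨n, hp⟩
  set D := disjointed fun n => (chart m (x n)).source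
  have hD : ∀ n, MeasurableSet (D n) := MeasurableSet.disjointed fun n =>
    (isOpen_extChartAt_source (x n)).measurableSet
  have hDs : ∀ n, D n ⊆ (chart m (x n)).source := fun n => disjointed_subset _ n
  have hDd : Pairwise (Function.onFun Disjoint D) := disjoint_disjointed _
  have hDu : ⋃ n, D n = Set.univ := by rw [iUnion_disjointed, hcov]
  have hsum : ∀ (μ : Measure M) {S : Set M}, MeasurableSet S → μ S = ∑' n, μ (S ∩ D n) := by
    intro μ S hS
    rw [← measure_iUnion (fun i j hij => (hDd hij).mono Set.inter_subset_right
      Set.inter_subset_right) (fun n => hS.inter (hD n)), ← Set.inter_iUnion, hDu, Set.inter_univ]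
  set ν := Measure.sum fun n => (chartVolume η (x n)).restrict (D n)
  have hν : ∀ {S : Set M}, MeasurableSet S → ν S = ∑' n, chartVolume η (x n) (S ∩ D n) := by
    intro S hS
    rw [Measure.sum_apply _ hS]
    exact tsum_congr fun n => Measure.restrict_apply hS
  have h1 : ∀ c, chartVolume η c ≤ ν := by
    refine fun c => Measure.le_iff.2 fun S hS => ?_
    rw [hν hS, hsum (chartVolume η c) hS]
    refine ENNReal.tsum_le_tsum fun n => ?_
    rw [← chartVolume_inter η c (hS.inter (hD n)), chartVolume_compat η c (x n)
      ((hS.inter (hD n)).inter (isOpen_extChartAt_source c).measurableSet) Set.inter_subset_right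
      (fun p hp => hDs n hp.1.2)]
    exact measure_mono Set.inter_subset_left
  calc kahlerVolume η S ≤ ν S := (iSup_le h1 : kahlerVolume η ≤ ν) S
    _ = ∑' n, chartVolume η (x n) (S ∩ D n) := hν hS
    _ = ∑' n, chartVolume η c (S ∩ D n) := tsum_congr fun n => chartVolume_compat η _ _
      (hS.inter (hD n)) (fun p hp => hDs n hp.2) (fun p hp => hSc hp.1)
    _ = chartVolume η c S := (hsum _ hS).symm

theorem kahlerVolume_restrict [CompactSpace M] (η : DForm m M 2) (c : M) : (kahlerVolume η).restrict
    (chart m c).source = chartVolume η c := by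
  have hs := (isOpen_extChartAt_source (I := 𝓘(ℝ, CSpace m)) c).measurableSet
  ext S hS
  rw [Measure.restrict_apply hS, kahlerVolume_apply_of_subset η c (hS.inter hs)
    Set.inter_subset_right, chartVolume_inter η c hS]

theorem integral_kahlerVolume_of_source [CompactSpace M] {η : DForm m M 2} (hη : η.IsSmooth) (c : M)
    {g : M → ℝ} (hg : Measurable g) (h0 : ∀ x ∉ (chart m c).source, g x = 0) :
    ∫ x, g x ∂(kahlerVolume η) = ∫ y in (chart m c).target, volDensity η c y * g
      ((chart m c).symm y) := by
  have hac := withDensity_absolutelyContinuous (volume.restrict (chart m c).target)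
    (fun y => ENNReal.ofReal (volDensity η c y))
  have hT := (isOpen_extChartAt_target (I := 𝓘(ℝ, CSpace m)) c).measurableSet
  rw [← setIntegral_eq_integral_of_forall_compl_eq_zero h0, kahlerVolume_restrict, chartVolume,
    integral_map ((aemeasurable_chart_symm c).mono_ac hac) hg.aestronglyMeasurable]
  have hm : AEMeasurable (fun y => ENNReal.ofReal (volDensity η c y))
    (volume.restrict (chart m c).target) :=
    ((continuousOn_volDensity η hη c).aemeasurable hT).ennreal_ofReal
  rw [integral_withDensity_eq_integral_toReal_smul₀ hm (by simp)]
  refine integral_congr_ae (Filter.Eventually.of_forall fun y => ?_)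
  simp only [smul_eq_mul]
  rw [ENNReal.toReal_ofReal (show 0 ≤ volDensity η c y from Real.sqrt_nonneg _)]

end meas

end

/-! ### Variation of the volume density as a divergence. -/

section

open scoped Matrix
variable {m : ℕ}

section algebra
variable {ι : Type*} [Fintype ι] [DecidableEq ι]

/-- The pointwise algebra of `div Z = ½ tr(W⁻¹ dα)` when `ι_Z W = α` and `dW = 0`. The
differentiated relation `hZ` expresses the trace of `dZ` through `da` and `dW`. By closedness `hd`
and antisymmetry of `P`, the `dW` terms collapse to `½ tr(P dW i)`, the logarithmic derivative of
the density. -/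
theorem divergence_identity {W P : Matrix ι ι ℝ} (hWP : W * P = 1) (hP : ∀ j k, P j k = - P k j)
    {Z : ι → ℝ} {dZ da : Matrix ι ι ℝ} {dW : ι → Matrix ι ι ℝ}
    (hZ : ∀ k j, ∑ i, (dZ k i * W i j + Z i * dW k i j) = da k j)
    (hd : ∀ i j k, dW i j k - dW j i k + dW k i j = 0) :
    ∑ i, Z i * ((1 / 2) * (P * dW i).trace) + ∑ k, dZ k k = (1 / 2) *
      (P * Matrix.of fun k j => da k j - da j k).trace := by
  have h1 : ∀ k, dZ k k = ∑ j, da k j * P j k - ∑ j, ∑ i, Z i * (dW k i j * P j k) := by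
    intro k
    have e : dZ k k = (dZ * W * P) k k := by rw [Matrix.mul_assoc, hWP, Matrix.mul_one]
    rw [e, Matrix.mul_apply, ← Finset.sum_sub_distrib]
    refine Finset.sum_congr rfl fun j _ => ?_
    rw [← hZ k j, Finset.sum_add_distrib, Matrix.mul_apply, add_mul, Finset.sum_mul
      (f := fun i => Z i * dW k i j)]
    simp only [mul_assoc]; ring
  have h2 : ∀ i, ∑ k, ∑ j, dW k i j * P j k = (1 / 2) * (P * dW i).trace := by
    intro i
    have s1 : (P * dW i).trace = ∑ j, ∑ k, P j k * dW i k j :=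
      by simp [Matrix.trace, Matrix.mul_apply]
    have s3 : ∑ j, ∑ k, P j k * dW j i k = - ∑ j, ∑ k, P j k * dW k i j := by
      rw [Finset.sum_comm, ← Finset.sum_neg_distrib]
      refine Finset.sum_congr rfl fun k _ => ?_
      rw [← Finset.sum_neg_distrib]
      refine Finset.sum_congr rfl fun j _ => ?_
      rw [hP j k]; ring
    have s0 : ∑ j, ∑ k, P j k * dW i k j - ∑ j, ∑ k, P j k * dW k i j + ∑ j, ∑ k, P j k * dW j i k =
      0 := by
      simp only [← Finset.sum_sub_distrib, ← Finset.sum_add_distrib]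
      refine Finset.sum_eq_zero fun j _ => Finset.sum_eq_zero fun k _ => ?_
      rw [← mul_sub, ← mul_add, hd i k j, mul_zero]
    have s2 : ∑ k, ∑ j, dW k i j * P j k = ∑ j, ∑ k, P j k * dW k i j := by
      rw [Finset.sum_comm]; simp only [mul_comm]
    rw [s2, s1]; linarith
  have h3 : (P * Matrix.of fun k j => da k j - da j k).trace = 2 * ∑ k, ∑ j, da k j * P j k := by
    have s1 : (P * Matrix.of fun k j => da k j - da j k).trace = ∑ j, ∑ k, P j k * (da k j - da j k)
      := by simp [Matrix.trace, Matrix.mul_apply]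
    have s3 : ∑ j, ∑ k, P j k * da j k = - ∑ j, ∑ k, P j k * da k j := by
      rw [Finset.sum_comm, ← Finset.sum_neg_distrib]
      refine Finset.sum_congr rfl fun k _ => ?_
      rw [← Finset.sum_neg_distrib]
      refine Finset.sum_congr rfl fun j _ => ?_
      rw [hP j k]; ring
    simp only [mul_sub, Finset.sum_sub_distrib] at s1
    have s2 : ∑ k, ∑ j, da k j * P j k = ∑ j, ∑ k, P j k * da k j := by
      rw [Finset.sum_comm]; simp only [mul_comm]
    rw [s1, s3, s2]; ring
  have h4 : ∑ k, ∑ j, ∑ i, Z i * (dW k i j * P j k) = ∑ i, Z i * ((1 / 2) * (P * dW i).trace) := by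
    simp only [← h2, Finset.mul_sum]
    rw [Finset.sum_comm' (s := Finset.univ) (t := fun _ => Finset.univ) (t' := Finset.univ)
      (s' := fun _ => Finset.univ) (by simp)]
    have : ∀ j, ∑ k, ∑ i, Z i * (dW k i j * P j k) = ∑ i, ∑ k, Z i * (dW k i j * P j k) := fun j =>
      Finset.sum_comm
    simp only [this]
    rw [Finset.sum_comm]
    refine Finset.sum_congr rfl fun i _ => Finset.sum_comm
  rw [h3, Finset.sum_congr rfl fun k _ => h1 k, Finset.sum_sub_distrib, h4]
  ring

/-- Jacobi's formula: after factoring out `W`, the determinant of `1 + s N` is a polynomial in `s`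
whose derivative at `0` is the trace of `N`. -/
theorem hasDerivAt_det_add_smul {W K : Matrix ι ι ℝ} (hW : IsUnit W.det) :
    HasDerivAt (fun s : ℝ => (W + s • K).det) (W.det * (W⁻¹ * K).trace) 0 := by
  have h : (fun s : ℝ => (W + s • K).det) = fun s => W.det *
    (Matrix.det (1 + (Polynomial.X : Polynomial ℝ) • (W⁻¹ * K).map Polynomial.C)).eval s := by
    ext s
    have : W + s • K = W * (1 + s • (W⁻¹ * K)) := by
      rw [mul_add, mul_one, Matrix.mul_smul, ← Matrix.mul_assoc, Matrix.mul_nonsing_inv _ hW,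
        Matrix.one_mul]
    rw [this, Matrix.det_mul]
    congr 1
    generalize W⁻¹ * K = N
    refine Eq.trans ?_ ((Polynomial.evalRingHom s).map_det _).symm
    congr 1
    ext i j
    simp [Matrix.one_apply, apply_ite]; ring
  rw [h]
  have := (Polynomial.hasDerivAt (Matrix.det (1 + (Polynomial.X : Polynomial ℝ) • (W⁻¹ * K).map
    Polynomial.C)) 0).const_mul W.det
  rwa [Matrix.derivative_det_one_add_X_smul] at this

end algebra

abbrev Alt2 (m : ℕ) := CSpace m [⋀^Fin 2]→L[ℝ] ℝ
abbrev Alt1 (m : ℕ) := CSpace m [⋀^Fin 1]→L[ℝ] ℝ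

def mat2 (w : Alt2 m) : Matrix (Fin m ⊕ Fin m) (Fin m ⊕ Fin m) ℝ := Matrix.of fun a b => w
    ![realBasis m a, realBasis m b]

/-- This splits off the constant matrix of multiplication by `i`; determinants and their derivatives
can then be computed on the antisymmetric matrix of `w`. -/
theorem gram_eq_mul (w : Alt2 m) : gram w = mat2 w * LinearMap.toMatrix (realBasis m) (realBasis m)
    (mulI m) := by
  ext a b
  rw [Matrix.mul_apply]
  have : Complex.I • realBasis m b = ∑ c, (LinearMap.toMatrix (realBasis m) (realBasis m) (mulI m))
    c b • realBasis m c := by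
    simp only [LinearMap.toMatrix_apply]
    exact ((realBasis m).sum_repr (mulI m (realBasis m b))).symm
  change form2 w (realBasis m a) (Complex.I • realBasis m b) = _
  rw [this, map_sum]
  refine Finset.sum_congr rfl fun c _ => ?_
  rw [map_smul, smul_eq_mul, mul_comm]; rfl

theorem contDiff_det {ι : Type*} [Fintype ι] [DecidableEq ι] {F : Type*} [NormedAddCommGroup F]
    [NormedSpace ℝ F] {f : F → Matrix ι ι ℝ} {n : WithTop ℕ∞} {x : F}
    (hf : ∀ i j, ContDiffAt ℝ n (fun x => f x i j) x) : ContDiffAt ℝ n (fun x => (f x).det) x := by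
  simp only [Matrix.det_apply]
  refine ContDiffAt.sum fun σ _ => ?_
  refine ContDiffAt.const_smul _ ?_
  exact contDiffAt_prod fun i _ => hf _ _

theorem contDiff_apply_alt {k : ℕ} {n : WithTop ℕ∞} (v : Fin k → CSpace m) : ContDiff ℝ n
    (fun w : CSpace m [⋀^Fin k]→L[ℝ] ℝ => w v) :=
  (ContinuousAlternatingMap.apply ℝ (CSpace m) ℝ v).contDiff

/-- The Riemannian volume density of a 2-form, whose bilinear form is `w(·, i·)`. -/
def rho (w : Alt2 m) : ℝ := Real.sqrt (gram w).det

theorem contDiffAt_rho {w : Alt2 m} (hw : 0 < (gram w).det) {n : WithTop ℕ∞} : ContDiffAt ℝ n rho w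
    :=
  (contDiff_det (f := gram) fun _ _ => (contDiff_apply_alt _).contDiffAt).sqrt hw.ne'

theorem isUnit_det_mat2 {w : Alt2 m} (hw : 0 < (gram w).det) : IsUnit (mat2 w).det := by
  rw [gram_eq_mul, Matrix.det_mul] at hw
  exact (left_ne_zero_of_mul hw.ne').isUnit

/-- The factor `1/2` comes from the square root; the constant determinant of multiplication by `i`
is absorbed in `rho w`. -/
theorem fderiv_rho {w : Alt2 m} (hw : 0 < (gram w).det) (k : Alt2 m) :
    fderiv ℝ rho w k = rho w * ((1 / 2) * ((mat2 w)⁻¹ * mat2 k).trace) := by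
  have hd : HasFDerivAt rho (fderiv ℝ rho w) w := ((contDiffAt_rho (n := 1) hw).differentiableAt
    (by simp)).hasFDerivAt
  have hl : HasDerivAt (fun s : ℝ => w + s • k) k 0 := by
    simpa using ((hasDerivAt_id (0 : ℝ)).smul_const k).const_add w
  have h1 : HasDerivAt (fun s : ℝ => rho (w + s • k)) (fderiv ℝ rho w k) 0 := by
    have : HasFDerivAt rho (fderiv ℝ rho w) (w + (0 : ℝ) • k) := by simpa using hd
    exact this.comp_hasDerivAt (0 : ℝ) hl
  have h2 : HasDerivAt (fun s : ℝ => rho (w + s • k)) (rho w *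
    ((1 / 2) * ((mat2 w)⁻¹ * mat2 k).trace)) 0 := by
    have e : ∀ s : ℝ, (gram (w + s • k)).det = (mat2 w + s • mat2 k).det *
      (LinearMap.toMatrix (realBasis m) (realBasis m) (mulI m)).det := by
      intro s; rw [gram_eq_mul, Matrix.det_mul]; rfl
    have h3 := (hasDerivAt_det_add_smul (K := mat2 k) (isUnit_det_mat2 hw)).mul_const
      (LinearMap.toMatrix (realBasis m) (realBasis m) (mulI m)).det
    simp only [← e] at h3
    have h4 := h3.sqrt (by simpa using hw.ne')
    refine h4.congr_deriv ?_
    have e0 : (gram w).det = (mat2 w).det * (LinearMap.toMatrix (realBasis m) (realBasis m)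
      (mulI m)).det := by simpa using e 0
    rw [rho]
    simp only [zero_smul, add_zero]
    have hs := Real.sqrt_ne_zero'.2 hw
    field_simp
    rw [Real.sq_sqrt hw.le, e0]; ring
  exact h1.unique h2

/-- The vector dual to a one-form. -/
def sharpCoord (w : Alt2 m) (a : Alt1 m) (k : Fin m ⊕ Fin m) : ℝ := ∑ j, a ![realBasis m j] *
    (mat2 w)⁻¹ j k

def sharp (w : Alt2 m) (a : Alt1 m) : CSpace m := ∑ k, sharpCoord w a k • realBasis m k

/-- By Cramer's rule the inverse matrix is the adjugate over the determinant, so its entries are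
rational in those of the form. -/
theorem contDiffAt_sharpCoord {F : Type*} [NormedAddCommGroup F] [NormedSpace ℝ F] {x : F}
    {w : F → Alt2 m} {a : F → Alt1 m} {n : WithTop ℕ∞} (hw : ContDiffAt ℝ n w x)
    (ha : ContDiffAt ℝ n a x)
    (h0 : 0 < (gram (w x)).det) (k : Fin m ⊕ Fin m) : ContDiffAt ℝ n
      (fun x => sharpCoord (w x) (a x) k) x := by
  refine ContDiffAt.sum fun j _ => ContDiffAt.mul ((contDiff_apply_alt _).contDiffAt.comp x ha) ?_
  simp only [Matrix.inv_def, Matrix.smul_apply, Ring.inverse_eq_inv', smul_eq_mul]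
  have hm : ∀ i j, ContDiffAt ℝ n (fun x => mat2 (w x) i j) x := fun i j =>
    (contDiff_apply_alt _).contDiffAt.comp x hw
  refine ContDiffAt.mul ((contDiff_det hm).inv (isUnit_det_mat2 h0).ne_zero) ?_
  simp only [Matrix.adjugate_apply]
  refine contDiff_det fun i j' => ?_
  simp only [Matrix.updateRow_apply]
  split_ifs
  · exact contDiffAt_const
  · exact hm _ _

theorem sum_sharpCoord_mul {w : Alt2 m} (hw : 0 < (gram w).det) (a : Alt1 m) (j) : ∑ i, sharpCoord w
    a i * w ![realBasis m i, realBasis m j] = a ![realBasis m j] := by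
  have h : sharpCoord w a = Matrix.vecMul (fun j => a ![realBasis m j]) (mat2 w)⁻¹ := by
    ext k; simp [sharpCoord, Matrix.vecMul, dotProduct]
  have : Matrix.vecMul (sharpCoord w a) (mat2 w) = fun j => a ![realBasis m j] := by
    rw [h, Matrix.vecMul_vecMul, Matrix.nonsing_inv_mul _ (isUnit_det_mat2 hw), Matrix.vecMul_one]
  exact congrFun this j

def form1 (a : Alt1 m) : CSpace m →ₗ[ℝ] ℝ where
  toFun v := a ![v]
  map_add' v w := by
    have e : ∀ x, Function.update ![v] 0 x = ![x] := fun x => by ext i; fin_cases i; rfl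
    simpa [e, -ContinuousAlternatingMap.map_update_add] using a.map_update_add ![v] 0 v w
  map_smul' c v := by
    have e : ∀ x, Function.update ![v] 0 x = ![x] := fun x => by ext i; fin_cases i; rfl
    simpa [e, -ContinuousAlternatingMap.map_update_smul] using a.map_update_smul ![v] 0 c v

theorem sharp_spec {w : Alt2 m} (hw : 0 < (gram w).det) (a : Alt1 m) (v : CSpace m) : w
    ![sharp w a, v] = a ![v] := by
  change form2 w (sharp w a) v = form1 a v
  refine LinearMap.congr_fun ((realBasis m).ext fun j => ?_) v
  rw [sharp, map_sum, LinearMap.sum_apply]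
  simp only [map_smul, LinearMap.smul_apply, smul_eq_mul]
  exact sum_sharpCoord_mul hw a j

theorem mat2_antisymm (w : Alt2 m) (j k) : mat2 w j k = - mat2 w k j := by
  have h := w.map_swap ![realBasis m k, realBasis m j] (i := 0) (j := 1) (by simp)
  simp only [mat2, Matrix.of_apply]
  refine Eq.trans ?_ h
  change w _ = w _
  congr 1
  ext i; fin_cases i <;> rfl

theorem inv_mat2_antisymm (w : Alt2 m) (j k) : (mat2 w)⁻¹ j k = - (mat2 w)⁻¹ k j := by
  have h : (mat2 w)ᵀ = - mat2 w := by ext a b; simp [mat2_antisymm w b a]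
  have h2 := Matrix.transpose_nonsing_inv (mat2 w)
  rw [h, ← neg_one_smul ℝ, ] at h2
  have h3 : ((-1 : ℝ) • mat2 w)⁻¹ = - (mat2 w)⁻¹ := by
    by_cases hu : IsUnit (mat2 w).det
    · refine Matrix.inv_eq_left_inv ?_
      rw [neg_one_smul, neg_mul_neg, Matrix.nonsing_inv_mul _ hu]
    -- A singular matrix has inverse `0` by convention, so the identity survives.
    · have : ¬ IsUnit ((-1 : ℝ) • mat2 w).det := by
        rw [Matrix.det_smul]; intro h; exact hu (isUnit_of_mul_isUnit_right h)
      rw [Matrix.nonsing_inv_apply_not_isUnit _ hu, Matrix.nonsing_inv_apply_not_isUnit _ this,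
        neg_zero]
  rw [h3] at h2
  exact congrFun (congrFun h2 k) j

theorem fderiv_alt_apply {k : ℕ} {f : CSpace m → CSpace m [⋀^Fin k]→L[ℝ] ℝ} {y : CSpace m}
    (hf : DifferentiableAt ℝ f y) (v : Fin k → CSpace m) (u : CSpace m) :
    fderiv ℝ (fun z => f z v) y u = fderiv ℝ f y u v := by
  have := ((ContinuousAlternatingMap.apply ℝ (CSpace m) ℝ v).hasFDerivAt.comp y
    hf.hasFDerivAt).fderiv
  exact congr($this u)

theorem extDeriv_one {f : CSpace m → Alt1 m} {y : CSpace m} (hf : DifferentiableAt ℝ f y)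
    (u v : CSpace m) :
    extDeriv f y ![u, v] = fderiv ℝ f y u ![v] - fderiv ℝ f y v ![u] := by
  rw [extDeriv_apply hf, Fin.sum_univ_two, fderiv_alt_apply hf, fderiv_alt_apply hf]
  simp only [Fin.val_zero, pow_zero, one_smul, Fin.val_one, pow_one, neg_smul, ← sub_eq_add_neg]
  congr 2
  ext i; fin_cases i; rfl

theorem extDeriv_two {f : CSpace m → Alt2 m} {y : CSpace m} (hf : DifferentiableAt ℝ f y)
    (u v w : CSpace m) :
    extDeriv f y ![u, v, w] = fderiv ℝ f y u ![v, w] - fderiv ℝ f y v ![u, w] + fderiv ℝ f y w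
      ![u, v] := by
  rw [extDeriv_apply hf, Fin.sum_univ_three, fderiv_alt_apply hf, fderiv_alt_apply hf,
    fderiv_alt_apply hf]
  have e0 : Fin.removeNth 0 ![u, v, w] = ![v, w] := by ext i; fin_cases i <;> rfl
  have e1 : Fin.removeNth 1 ![u, v, w] = ![u, w] := by ext i; fin_cases i <;> rfl
  have e2 : Fin.removeNth 2 ![u, v, w] = ![u, v] := by ext i; fin_cases i <;> rfl
  rw [e0, e1, e2]
  simp [sub_eq_add_neg]

/-- With `ι_Z ω = α` and `dω = 0`, Cartan's formula gives `L_Z ω = dα`. Hence varying `ω` in the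
direction `dα` changes the density by the divergence of the density times `Z`. -/
theorem divergence_density_sharp {ωf : CSpace m → Alt2 m} {α : CSpace m → Alt1 m} {y : CSpace m}
    (hω : ContDiffAt ℝ 1 ωf y) (hα : ContDiffAt ℝ 1 α y)
    (hcl : extDeriv ωf y = 0) (hpos : 0 < (gram (ωf y)).det) :
    ∑ k, fderiv ℝ (fun z => rho (ωf z) * sharpCoord (ωf z) (α z) k) y (realBasis m k) = fderiv ℝ rho
      (ωf y) (extDeriv α y) := by
  have hωd := hω.differentiableAt (by simp)
  have hαd := hα.differentiableAt (by simp)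
  have hρ := (contDiffAt_rho (n := 1) hpos).differentiableAt (by simp)
  have hs := fun k => (contDiffAt_sharpCoord hω hα hpos k).differentiableAt (by simp)
  have hρω : HasFDerivAt (fun z => rho (ωf z)) (fderiv ℝ rho (ωf y) ∘L fderiv ℝ ωf y) y :=
    hρ.hasFDerivAt.comp y hωd.hasFDerivAt
  have h1 : ∀ k, fderiv ℝ (fun z => rho (ωf z) * sharpCoord (ωf z) (α z) k) y (realBasis m k) =
      rho (ωf y) * fderiv ℝ (fun z => sharpCoord (ωf z) (α z) k) y (realBasis m k) + rho (ωf y) *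
        (sharpCoord (ωf y) (α y) k * ((1 / 2) * ((mat2 (ωf y))⁻¹ * mat2
        (fderiv ℝ ωf y (realBasis m k))).trace)) := by
    intro k
    rw [(hρω.fun_mul (hs k).hasFDerivAt).fderiv]
    simp only [_root_.add_apply, _root_.smul_apply, smul_eq_mul, ContinuousLinearMap.comp_apply,
      fderiv_rho hpos]
    ring
  rw [Finset.sum_congr rfl fun k _ => h1 k, Finset.sum_add_distrib, ← Finset.mul_sum, ←
    Finset.mul_sum, ← mul_add, add_comm, fderiv_rho hpos]
  congr 1
  have hda : mat2 (extDeriv α y) = Matrix.of fun k j => fderiv ℝ α y (realBasis m k)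
    ![realBasis m j] - fderiv ℝ α y (realBasis m j) ![realBasis m k] := by
    ext k j; exact extDeriv_one hαd _ _
  rw [hda]
  refine divergence_identity (W := mat2 (ωf y)) (dZ := Matrix.of fun k i => fderiv ℝ
    (fun z => sharpCoord (ωf z) (α z) i) y (realBasis m k))
     (dW := fun i => mat2 (fderiv ℝ ωf y (realBasis m i))) (da := Matrix.of fun k j => fderiv ℝ α y
       (realBasis m k) ![realBasis m j])
     (Matrix.mul_nonsing_inv _ (isUnit_det_mat2 hpos)) (inv_mat2_antisymm _) ?_ ?_
  · intro k j
    -- The relation defining `Z` holds on a whole neighbourhood, because positivity of the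
    -- determinant is an open condition; therefore it may be differentiated.
    have hev : (fun z => ∑ i, sharpCoord (ωf z) (α z) i * ωf z ![realBasis m i, realBasis m j])
      =ᶠ[nhds y] fun z => α z ![realBasis m j] := by
      have hc : ContinuousAt (fun z => (gram (ωf z)).det) y :=
        (contDiff_det (n := 1) (f := fun z => gram (ωf z)) fun _ _ =>
        (contDiff_apply_alt _).contDiffAt.comp y hω).continuousAt
      filter_upwards [hc.eventually (lt_mem_nhds hpos)] with z hz
      exact sum_sharpCoord_mul hz (α z) j
    have h2 := hev.fderiv_eq (𝕜 := ℝ)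
    have hωi : ∀ i, DifferentiableAt ℝ (fun z => ωf z ![realBasis m i, realBasis m j]) y := fun i =>
      ((contDiff_apply_alt (n := 1) ![realBasis m i, realBasis m j]).contDiffAt.comp y
        hω).differentiableAt (by simp)
    have hpr : ∀ i ∈ Finset.univ, DifferentiableAt ℝ (fun z => sharpCoord (ωf z) (α z) i * ωf z
      ![realBasis m i, realBasis m j]) y := fun i _ => (hs i).mul (hωi i)
    rw [fderiv_fun_sum hpr] at h2
    have h3 := congr($h2 (realBasis m k))
    rw [fderiv_alt_apply hαd, _root_.sum_apply] at h3
    simp only [Matrix.of_apply]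
    rw [← h3]
    refine Finset.sum_congr rfl fun i _ => ?_
    rw [((hs i).hasFDerivAt.fun_mul (hωi i).hasFDerivAt).fderiv]
    simp only [_root_.add_apply, _root_.smul_apply, smul_eq_mul, fderiv_alt_apply hωd, mat2,
      Matrix.of_apply]
    ring
  · intro i j k
    have := extDeriv_two hωd (realBasis m i) (realBasis m j) (realBasis m k)
    rw [hcl] at this
    exact this.symm

theorem integrable_of_continuousOn_compact {E : Type*} [NormedAddCommGroup E] [MeasurableSpace E]
    [BorelSpace E] {μ : Measure E} [IsFiniteMeasureOnCompacts μ] {f : E → ℝ} {K : Set E}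
    (hK : IsCompact K) (hf : ContinuousOn f K) (h0 : ∀ x ∉ K, f x = 0) : Integrable f μ :=
  (integrableOn_iff_integrable_of_support_subset fun x hx => by_contra fun h => hx (h0 x h)).1
    (hf.integrableOn_compact hK)

/-- Integration by parts in each real coordinate. Regularity of `Y` on `U` is enough, since all
integrands vanish off the compact support of `ψ`. -/
theorem integral_mul_divergence {U : Set (CSpace m)} (hU : IsOpen U) {ψ : CSpace m → ℝ}
    (hψ : ContDiff ℝ 1 ψ) (hc : HasCompactSupport ψ) (hs : tsupport ψ ⊆ U)
    {Y : (Fin m ⊕ Fin m) → CSpace m → ℝ} (hY : ∀ k, ContDiffOn ℝ 1 (Y k) U) :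
    ∫ y, ψ y * ∑ k, fderiv ℝ (Y k) y (realBasis m k) = - ∫ y, ∑ k, fderiv ℝ ψ y (realBasis m k) * Y
      k y := by
  have h0 : ∀ y ∉ tsupport ψ, ψ y = 0 := fun y hy => image_eq_zero_of_notMem_tsupport hy
  have h0' : ∀ y ∉ tsupport ψ, fderiv ℝ ψ y = 0 := fun y hy => by
    by_contra h
    exact hy (support_fderiv_subset ℝ h)
  have hYc : ∀ k, ContinuousOn (Y k) (tsupport ψ) := fun k => (hY k).continuousOn.mono hs
  have hY' : ∀ k, ContinuousOn (fun y => fderiv ℝ (Y k) y (realBasis m k)) (tsupport ψ) := fun k =>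
    (((hY k).continuousOn_fderiv_of_isOpen hU (by simp)).clm_apply continuousOn_const).mono hs
  have i1 : ∀ k, Integrable fun y => ψ y * fderiv ℝ (Y k) y (realBasis m k) := fun k =>
    integrable_of_continuousOn_compact hc (hψ.continuous.continuousOn.mul (hY' k)) fun y hy =>
      by rw [h0 y hy, zero_mul]
  have i2 : ∀ k, Integrable fun y => fderiv ℝ ψ y (realBasis m k) * Y k y := fun k =>
    integrable_of_continuousOn_compact hc (((hψ.continuous_fderiv (by simp)).clm_apply
      continuous_const).continuousOn.mul (hYc k)) fun y hy => by rw [h0' y hy]; simp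
  have i3 : ∀ k, Integrable fun y => ψ y * Y k y := fun k =>
    integrable_of_continuousOn_compact hc (hψ.continuous.continuousOn.mul (hYc k)) fun y hy =>
      by rw [h0 y hy, zero_mul]
  simp only [Finset.mul_sum]
  rw [integral_finsetSum _ fun k _ => i1 k, integral_finsetSum _ fun k _ => i2 k, ←
    Finset.sum_neg_distrib]
  refine Finset.sum_congr rfl fun k _ => ?_
  exact integral_mul_fderiv_eq_neg_fderiv_mul_of_integrable (i2 k) (i1 k) (i3 k)
    (fun y _ => (hψ.differentiable (by simp)) y) (fun y hy =>
    ((hY k).differentiableOn (by simp)).differentiableAt (hU.mem_nhds (hs hy)))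

theorem integral_mul_fderiv_rho {U : Set (CSpace m)} (hU : IsOpen U) {ψ : CSpace m → ℝ}
    (hψ : ContDiff ℝ 1 ψ) (hc : HasCompactSupport ψ) (hs : tsupport ψ ⊆ U)
    {ωf : CSpace m → Alt2 m} {α : CSpace m → Alt1 m} (hω : ContDiffOn ℝ 1 ωf U)
      (hα : ContDiffOn ℝ 1 α U)
    (hcl : ∀ y ∈ U, extDeriv ωf y = 0) (hpos : ∀ y ∈ U, 0 < (gram (ωf y)).det) :
    ∫ y, ψ y * fderiv ℝ rho (ωf y) (extDeriv α y) = - ∫ y, rho (ωf y) * fderiv ℝ ψ y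
      (sharp (ωf y) (α y)) := by
  have hω' := fun y hy => hω.contDiffAt (hU.mem_nhds hy) (x := y)
  have hα' := fun y hy => hα.contDiffAt (hU.mem_nhds hy) (x := y)
  have h := integral_mul_divergence hU hψ hc hs (Y := fun k z => rho (ωf z) * sharpCoord (ωf z)
    (α z) k) fun k y hy =>
    (((contDiffAt_rho (hpos y hy)).comp y (hω' y hy)).mul (contDiffAt_sharpCoord (hω' y hy)
      (hα' y hy) (hpos y hy) k)).contDiffWithinAt
  refine Eq.trans ?_ (h.trans ?_)
  · refine integral_congr_ae (Filter.Eventually.of_forall fun y => ?_)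
    by_cases hy : y ∈ tsupport ψ
    · have := divergence_density_sharp (hω' y (hs hy)) (hα' y (hs hy)) (hcl y (hs hy))
        (hpos y (hs hy))
      simp only [this]
    · simp only [image_eq_zero_of_notMem_tsupport hy, zero_mul]
  · congr 2
    ext y
    simp only [sharp, map_sum, map_smul, smul_eq_mul, Finset.mul_sum]
    exact Finset.sum_congr rfl fun k _ => by ring

end

/-! ### Kähler forms: convexity, positivity, duality between 1-forms and fields. -/

section

variable {m : ℕ} {M : Type*} [TopologicalSpace M] [ChartedSpace (CSpace m) M]
  [IsManifold 𝓘(ℂ, CSpace m) ω M] [IsManifold 𝓘(ℝ, CSpace m) ∞ M]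

theorem form2_alt {E : Type*} [AddCommGroup E] [Module ℝ E] [TopologicalSpace E]
    (w : E [⋀^Fin 2]→L[ℝ] ℝ) (u v : E) : w ![u, v] = - w ![v, u] := by
  have h := w.map_swap ![v, u] (i := 0) (j := 1) (by simp)
  refine Eq.trans ?_ h
  change w _ = w _
  congr 1
  ext i; fin_cases i <;> rfl

theorem J_J {x : M} (v : TangentSpace 𝓘(ℝ, CSpace m) x) : J (J v) = -v := by
  have : ∀ w : CSpace m, Complex.I • (Complex.I • w) = -w := fun w => by
    rw [smul_smul, Complex.I_mul_I, neg_one_smul]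
  exact this v

/-- The path from `η₀` to `η₁`. -/
def segment (η₀ η₁ : DForm m M 2) (t : ℝ) : DForm m M 2 := η₀ + t • (η₁ - η₀)

theorem segment_eq (η₀ η₁ : DForm m M 2) (t : ℝ) : segment η₀ η₁ t = (1 - t) • η₀ + t • η₁ := by
  rw [segment]; module

theorem segment_apply (η₀ η₁ : DForm m M 2) (t : ℝ) (x : M) (v : Fin 2 → TangentSpace 𝓘(ℝ, CSpace m)
    x) : segment η₀ η₁ t x v = (1 - t) * η₀ x v + t * η₁ x v := by
  rw [segment_eq]; rfl

theorem IsKahler.segment {η₀ η₁ : DForm m M 2} (h₀ : IsKahler η₀) (h₁ : IsKahler η₁) {t : ℝ}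
    (ht : t ∈ Set.Icc (0 : ℝ) 1) : IsKahler (segment η₀ η₁ t) where
  closed := by rw [segment_eq]; exact add_mem (Submodule.smul_mem _ _ h₀.closed) (Submodule.smul_mem _ _ h₁.closed)
  invariant x v w := by rw [segment_apply, segment_apply, h₀.invariant, h₁.invariant]
  pos x v hv := by
    have a := h₀.pos x v hv
    have b := h₁.pos x v hv
    simp only [metricOf, segment_apply] at *
    rcases eq_or_lt_of_le ht.1 with h | h
    · rw [← h]; simpa using a
    · have := mul_pos h b
      have := mul_nonneg (sub_nonneg.2 ht.2) a.le
      linarith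

theorem inChart_segment (η₀ η₁ : DForm m M 2) (t : ℝ) (c : M) (y : CSpace m) :
    (KahlerGeometry.segment η₀ η₁ t).inChart c y = η₀.inChart c y + t • (η₁ - η₀).inChart c y := by
  rw [KahlerGeometry.segment, inChart_add, inChart_smul]; rfl

theorem chartInvDeriv_injective (c : M) {y : CSpace m} (hy : y ∈ (chart m c).target) {v : CSpace m}
    (hv : v ≠ 0) : chartInvDeriv c y v ≠ 0 := by
  intro h
  have := mfderiv_chart_chartInvDeriv c hy v
  rw [h, map_zero] at this
  exact hv this.symm

theorem inChart_apply₂ (η : DForm m M 2) (c : M) (y : CSpace m) (v w : CSpace m) : η.inChart c y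
    ![v, w] = η ((chart m c).symm y) ![chartInvDeriv c y v, chartInvDeriv c y w] := by
  change η ((chart m c).symm y) _ = _
  congr 1
  ext i; fin_cases i <;> rfl

theorem inChart_apply₁ (η : DForm m M 1) (c : M) (y : CSpace m) (v : CSpace m) : η.inChart c y ![v]
    = η ((chart m c).symm y) ![chartInvDeriv c y v] := by
  change η ((chart m c).symm y) _ = _
  congr 1
  ext i; fin_cases i; rfl

/-- `J`-invariance together with antisymmetry makes the matrix of `η(·, i·)` symmetric, and
positivity of the metric makes it positive definite. -/
theorem IsKahler.det_gram_pos {η : DForm m M 2} (h : IsKahler η) (c : M) {y : CSpace m}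
    (hy : y ∈ (chart m c).target) : 0 < (gram (η.inChart c y)).det := by
  have hsymm : ∀ v w : CSpace m, η.inChart c y ![v, Complex.I • w] = η.inChart c y
    ![w, Complex.I • v] := by
    intro v w
    rw [inChart_apply₂, inChart_apply₂, chartInvDeriv_J c hy, chartInvDeriv_J c hy, ← h.invariant,
      J_J]
    have h1 := (form2 (η ((chart m c).symm y)) (J (chartInvDeriv c y v))).map_neg
      (chartInvDeriv c y w)
    simp only [form2_apply] at h1
    rw [h1, form2_alt (η ((chart m c).symm y)) (J (chartInvDeriv c y v)), neg_neg]
  refine Matrix.PosDef.det_pos (Matrix.PosDef.of_dotProduct_mulVec_pos ?_ ?_)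
  · ext a b
    simp only [Matrix.conjTranspose_apply, gram, Matrix.of_apply, star_trivial]
    exact hsymm _ _
  · intro x hx
    set v := ∑ a, x a • realBasis m a with hv
    have hv0 : v ≠ 0 := by
      intro h0
      apply hx
      ext a
      exact (Fintype.linearIndependent_iff.1 (realBasis m).linearIndependent x h0 a)
    have hp := h.pos _ _ (chartInvDeriv_injective c hy hv0)
    rw [metricOf_inChart η c hy] at hp
    have : η.inChart c y ![v, Complex.I • v] = star x ⬝ᵥ Matrix.mulVec (gram (η.inChart c y)) x :=
      by
      have e : η.inChart c y ![v, Complex.I • v] = ((form2 (η.inChart c y)).compl₂ (mulI m)) v v :=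
        rfl
      have e2 := LinearMap.BilinForm.dotProduct_toMatrix_mulVec
        (B := (form2 (η.inChart c y)).compl₂ (mulI m)) (b := realBasis m) x x
      rw [gram_eq, e, star_trivial]
      rw [e2]
      simp [hv, Module.Basis.equivFun_symm_apply]
    rw [← this]; exact hp

theorem inChart_self' {k : ℕ} (α : DForm m M k) (x : M) : (α x : CSpace m [⋀^Fin k]→L[ℝ] ℝ) =
    α.inChart x (chart m x x) := by
  ext v; exact inChart_self α x v

theorem IsKahler.det_gram_pos' {η : DForm m M 2} (h : IsKahler η) (x : M) : 0 <
    (gram (m := m) (η x)).det := by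
  rw [inChart_self' η x]; exact h.det_gram_pos x (mem_extChartAt_target x)

/-- The vector field `Z` with `ι_Z η = α`. -/
def sharpField (η : DForm m M 2) (α : DForm m M 1) : VField m M := fun x => sharp (m := m) (η x)
    (α x)

theorem sharpField_spec {η : DForm m M 2} (h : IsKahler η) (α : DForm m M 1) (x : M)
    (v : TangentSpace 𝓘(ℝ, CSpace m) x) :
   η x ![sharpField η α x, v] = α x ![v] := sharp_spec (h.det_gram_pos' x) (α x) v

/-- Nondegeneracy: the difference `d = u - u'` is tested against `J d`. -/
theorem IsKahler.eq_of_forall {η : DForm m M 2} (h : IsKahler η) {x : M}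
    {u u' : TangentSpace 𝓘(ℝ, CSpace m) x} (he : ∀ v, η x ![u, v] = η x ![u', v]) : u = u' := by
  by_contra hne
  have := h.pos x (u - u') (sub_ne_zero.2 hne)
  rw [metricOf] at this
  have h2 := (form2 (η x)).map_sub u u'
  have h3 := congr($h2 (J (u - u')))
  simp only [form2_apply, LinearMap.sub_apply, he, sub_self] at h3
  rw [h3] at this
  exact lt_irrefl _ this

/-- Both vectors contract with `η` to `α`. Since `sharpField` uses a different chart at each point,
this gives its expression in one fixed chart, from which continuity follows. -/
theorem chartInvDeriv_sharp {η : DForm m M 2} (h : IsKahler η) (α : DForm m M 1) (c : M)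
    {y : CSpace m} (hy : y ∈ (chart m c).target) :
   chartInvDeriv c y (sharp (η.inChart c y) (α.inChart c y)) = sharpField η α ((chart m c).symm y)
     := by
  refine h.eq_of_forall fun v => ?_
  rw [sharpField_spec h]
  obtain ⟨w, rfl⟩ : ∃ w, chartInvDeriv c y w = v := ⟨_, chartInvDeriv_mfderiv_chart c hy v⟩
  rw [← inChart_apply₂, ← inChart_apply₁, sharp_spec (h.det_gram_pos c hy)]

end

/-! ### Cutting off in charts: integrals on `M` as integrals on `ℂ^m`. -/

section

open Filter Topology
variable {m : ℕ} {M : Type*} [TopologicalSpace M] [ChartedSpace (CSpace m) M]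
  [IsManifold 𝓘(ℂ, CSpace m) ω M] [IsManifold 𝓘(ℝ, CSpace m) ∞ M]

theorem contMDiff_line {V : Type*} [NormedAddCommGroup V] [NormedSpace ℝ V] {h₀ u : M → V}
    (hh₀ : ContMDiff 𝓘(ℝ, CSpace m) 𝓘(ℝ, V) ∞ h₀) (hu : ContMDiff 𝓘(ℝ, CSpace m) 𝓘(ℝ, V) ∞ u)
    (t : ℝ) :
    ContMDiff 𝓘(ℝ, CSpace m) 𝓘(ℝ, V) ∞ fun x => h₀ x + t • u x :=
  hh₀.add ((contDiff_id.const_smul t).contMDiff.comp hu)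

theorem contDiffOn_comp_symm {F : Type*} [NormedAddCommGroup F] [NormedSpace ℝ F] {f : M → F}
    (hf : ContMDiff 𝓘(ℝ, CSpace m) 𝓘(ℝ, F) ∞ f) (c : M) :
    ContDiffOn ℝ ∞ (fun y => f ((chart m c).symm y)) (chart m c).target :=
  (hf.comp_contMDiffOn (contMDiffOn_extChartAt_symm (I := 𝓘(ℝ, CSpace m)) (n := ∞) c)).contDiffOn

/-- The expression of a function in a chart, extended by zero. -/
def chartExt (c : M) (ψ : M → ℝ) : CSpace m → ℝ := (chart m c).target.indicator fun y => ψ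
    ((chart m c).symm y)

theorem chartExt_of_mem (c : M) (ψ : M → ℝ) {y : CSpace m} (hy : y ∈ (chart m c).target) : chartExt
    c ψ y = ψ ((chart m c).symm y) :=
  Set.indicator_of_mem hy _

section
variable [CompactSpace M]

theorem isCompact_chart_image {c : M} {S : Set M} (h : IsClosed S) (hs : S ⊆ (chart m c).source) :
    IsCompact (chart m c '' S) :=
  h.isCompact.image_of_continuousOn ((continuousOn_extChartAt c).mono hs)

theorem chartExt_of_notMem {c : M} {ψ : M → ℝ} {y : CSpace m} (hy : y ∉ chart m c '' tsupport ψ) :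
    chartExt c ψ y = 0 := by
  by_cases h : y ∈ (chart m c).target
  · rw [chartExt_of_mem c ψ h]
    by_contra h0
    exact hy ⟨_, subset_tsupport ψ h0, (chart m c).right_inv h⟩
  · exact Set.indicator_of_notMem h _

theorem tsupport_chartExt {c : M} {ψ : M → ℝ} (hs : tsupport ψ ⊆ (chart m c).source) : tsupport
    (chartExt (m := m) c ψ) ⊆ chart m c '' tsupport ψ :=
  closure_minimal (fun _ hy => by_contra fun h => hy (chartExt_of_notMem h))
    (isCompact_chart_image (isClosed_tsupport ψ) hs).isClosed

theorem image_tsupport_subset {c : M} {ψ : M → ℝ} (hs : tsupport ψ ⊆ (chart m c).source) : chart m c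
    '' tsupport ψ ⊆ (chart m c).target := by
  rintro _ ⟨x, hx, rfl⟩
  exact (chart m c).map_source (hs hx)

theorem hasCompactSupport_chartExt {c : M} {ψ : M → ℝ} (hs : tsupport ψ ⊆ (chart m c).source) :
    HasCompactSupport (chartExt (m := m) c ψ) :=
  (isCompact_chart_image (isClosed_tsupport ψ) hs).of_isClosed_subset (isClosed_tsupport _)
    (tsupport_chartExt hs)

/-- The image of the support is compact, hence closed in `ℂ^m`: each point lies in the target of the
chart or has a neighbourhood where the extension is zero. -/
theorem contDiff_chartExt {c : M} {ψ : M → ℝ} (hψ : ContMDiff 𝓘(ℝ, CSpace m) 𝓘(ℝ, ℝ) ∞ ψ)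
    (hs : tsupport ψ ⊆ (chart m c).source) : ContDiff ℝ ∞ (chartExt (m := m) c ψ) := by
  rw [contDiff_iff_contDiffAt]
  intro y
  by_cases hy : y ∈ (chart m c).target
  · have hn := (isOpen_extChartAt_target c).mem_nhds hy
    refine ((contDiffOn_comp_symm hψ c).contDiffAt hn).congr_of_eventuallyEq ?_
    filter_upwards [hn] with z hz
    exact chartExt_of_mem c ψ hz
  · have hK := isCompact_chart_image (isClosed_tsupport ψ) hs
    have hn : (chart m c '' tsupport ψ)ᶜ ∈ 𝓝 y := hK.isClosed.isOpen_compl.mem_nhds fun h => hy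
      (image_tsupport_subset hs h)
    refine (contDiffAt_const (c := (0 : ℝ))).congr_of_eventuallyEq ?_
    filter_upwards [hn] with z hz
    exact chartExt_of_notMem hz

end

theorem continuous_mfderiv_sharpField {η : DForm m M 2} (h : IsKahler η) {α : DForm m M 1}
    (hα : α.IsSmooth) {ψ : M → ℝ} (hψ : ContMDiff 𝓘(ℝ, CSpace m) 𝓘(ℝ, ℝ) ∞ ψ) :
    Continuous fun x => dAt ψ x (sharpField η α x) := by
  rw [continuous_iff_continuousAt]
  intro c
  have h1 : ContinuousOn (fun y => fderiv ℝ (fun z => ψ ((chart m c).symm z)) y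
    (sharp (η.inChart c y) (α.inChart c y))) (chart m c).target := by
    refine ((contDiffOn_comp_symm hψ c).continuousOn_fderiv_of_isOpen (isOpen_extChartAt_target c)
      (by simp)).clm_apply fun y hy => ?_
    have hn := (isOpen_extChartAt_target (I := 𝓘(ℝ, CSpace m)) c).mem_nhds hy
    refine ContinuousAt.continuousWithinAt ?_
    simp only [sharp]
    exact tendsto_finsetSum _ fun k _ => (contDiffAt_sharpCoord ((h.closed.1 c).contDiffAt hn)
      ((hα c).contDiffAt hn) (h.det_gram_pos c hy) k).continuousAt.smul tendsto_const_nhds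
  have h2 := h1.comp (continuousOn_extChartAt c) (fun x hx => (chart m c).map_source hx)
  have h3 := h2.continuousAt ((isOpen_extChartAt_source c).mem_nhds
    (mem_extChartAt_source (I := 𝓘(ℝ, CSpace m)) c))
  refine h3.congr ?_
  filter_upwards [(isOpen_extChartAt_source c).mem_nhds (mem_extChartAt_source (I := 𝓘(ℝ, CSpace m))
    c)] with x hx
  have hy := (chart m c).map_source hx
  have h4 := (fderiv_comp_chart_symm' c hy hψ (sharp (η.inChart c (chart m c x))
    (α.inChart c (chart m c x)))).trans (congrArg _ (chartInvDeriv_sharp h α c hy))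
  have h5 : (chart m c).symm (chart m c x) = x := (chart m c).left_inv hx
  rw [h5] at h4
  exact h4

section measure
variable [CompactSpace M] [T2Space M] [MeasurableSpace M] [BorelSpace M]

theorem isFiniteMeasure_kahlerVolume {η : DForm m M 2} (hη : η.IsSmooth) : IsFiniteMeasure
    (kahlerVolume η) := by
  refine ⟨isCompact_univ.measure_lt_top_of_nhdsWithin fun x _ => ?_⟩
  obtain ⟨r, hr, hK⟩ := Metric.nhds_basis_closedBall.mem_iff.1
    ((isOpen_extChartAt_target (I := 𝓘(ℝ, CSpace m)) x).mem_nhds (mem_extChartAt_target x))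
  have hcK := isCompact_closedBall (chart m x x) r
  set S := (chart m x).source ∩ chart m x ⁻¹' Metric.ball (chart m x x) r
  have hSo : IsOpen S := isOpen_extChartAt_preimage' x Metric.isOpen_ball
  refine ⟨S, mem_nhdsWithin_of_mem_nhds (hSo.mem_nhds ⟨mem_extChartAt_source x, Metric.mem_ball_self
    hr⟩), ?_⟩
  rw [kahlerVolume_apply_of_subset η x hSo.measurableSet Set.inter_subset_left, chartVolume_apply η
    x hSo.measurableSet]
  refine (lintegral_mono_set (t := Metric.closedBall (chart m x x) r) ?_).trans_lt ?_
  · rintro y ⟨hy, hyS⟩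
    have := hyS.2
    rw [Set.mem_preimage, (chart m x).right_inv hy] at this
    exact Metric.ball_subset_closedBall this
  · have := ((continuousOn_volDensity η hη x).mono hK).integrableOn_compact (μ := volume) hcK
    exact this.lintegral_lt_top

/-- Positivity of the total volume is what later forces the constants relating normalized potentials
to vanish. -/
theorem kahlerVolume_univ_ne_zero [Nonempty M] {η : DForm m M 2} (h : IsKahler η) : kahlerVolume η
    Set.univ ≠ 0 := by
  obtain ⟨c⟩ := ‹Nonempty M›
  have hT := (isOpen_extChartAt_target (I := 𝓘(ℝ, CSpace m)) c)
  intro h0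
  have h1 : chartVolume η c Set.univ = 0 := le_antisymm ((le_iSup (fun c => chartVolume η c) c
    Set.univ).trans h0.le) bot_le
  rw [chartVolume_apply η c MeasurableSet.univ, Set.preimage_univ, Set.inter_univ,
    lintegral_eq_zero_iff' ((continuousOn_volDensity η h.closed.1 c).aemeasurable
    hT.measurableSet).ennreal_ofReal] at h1
  have h2 : ∀ᵐ y ∂(volume.restrict (chart m c).target), False := by
    filter_upwards [h1, ae_restrict_mem hT.measurableSet] with y hy hyT
    simp only [Pi.zero_apply, ENNReal.ofReal_eq_zero, volDensity_eq η c hyT] at hy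
    exact absurd (Real.sqrt_pos.2 (h.det_gram_pos c hyT)) (not_lt.2 hy)
  have h3 := ae_iff.1 h2
  simp only [not_false_eq_true, Set.ofPred_true, Measure.restrict_apply_univ] at h3
  exact hT.measure_ne_zero volume ⟨_, mem_extChartAt_target c⟩ h3

theorem integral_kahlerVolume_chartExt {η : DForm m M 2} (hη : η.IsSmooth) (c : M) {g : M → ℝ}
    (hg : Continuous g) (hs : tsupport g ⊆ (chart m c).source) :
    ∫ x, g x ∂(kahlerVolume η) = ∫ y, rho (η.inChart c y) * chartExt c g y := by
  rw [integral_kahlerVolume_of_source hη c hg.measurable fun x hx =>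
    image_eq_zero_of_notMem_tsupport fun h => hx (hs h)]
  have hT := (isOpen_extChartAt_target (I := 𝓘(ℝ, CSpace m)) c)
  rw [← integral_indicator hT.measurableSet]
  refine integral_congr_ae (Eventually.of_forall fun y => ?_)
  by_cases hy : y ∈ (chart m c).target
  · simp only [Set.indicator_of_mem hy, chartExt_of_mem c g hy, volDensity_eq η c hy]; rfl
  · simp only [Set.indicator_of_notMem hy, chartExt]; rw [mul_zero]

/-- The first variation of the volume in the direction `dα`, tested on a function supported in one
chart: integration by parts moves the divergence onto `ψ`. -/
theorem integral_chartExt_mul_fderiv_rho {η : DForm m M 2} (h : IsKahler η) {α : DForm m M 1}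
    (hα : α.IsSmooth) (c : M) {ψ : M → ℝ} (hψ : ContMDiff 𝓘(ℝ, CSpace m) 𝓘(ℝ, ℝ) ∞ ψ)
    (hs : tsupport ψ ⊆ (chart m c).source) :
    ∫ y, chartExt c ψ y * fderiv ℝ rho (η.inChart c y) (extDeriv (α.inChart c) y) = - ∫ x, dAt ψ x
      (sharpField η α x) ∂(kahlerVolume η) := by
  have hT := (isOpen_extChartAt_target (I := 𝓘(ℝ, CSpace m)) c)
  have hts := (tsupport_chartExt hs).trans (image_tsupport_subset hs)
  have h0 : tsupport (fun x => dAt ψ x (sharpField η α x)) ⊆ tsupport ψ := by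
    refine closure_minimal (fun x hx => by_contra fun hn => hx ?_) (isClosed_tsupport ψ)
    have : ψ =ᶠ[𝓝 x] fun _ => 0 := notMem_tsupport_iff_eventuallyEq.1 hn
    have h9 : mfderiv 𝓘(ℝ, CSpace m) 𝓘(ℝ, ℝ) (fun _ : M => (0 : ℝ)) x = 0 := mfderiv_const
    exact (congr($(this.mfderiv_eq) (sharpField η α x))).trans congr($h9 (sharpField η α x))
  rw [integral_kahlerVolume_chartExt h.closed.1 c (continuous_mfderiv_sharpField h hα hψ)
    (h0.trans hs),
    integral_mul_fderiv_rho hT ((contDiff_chartExt hψ hs).of_le (by simp))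
      (hasCompactSupport_chartExt hs) hts ((h.closed.1 c).of_le (by simp)) ((hα c).of_le (by simp))
      ?_ fun y hy => h.det_gram_pos c hy]
  · congr 2
    ext y
    congr 1
    by_cases hy : y ∈ (chart m c).target
    · rw [chartExt_of_mem c _ hy, ← chartInvDeriv_sharp h α c hy, ← fderiv_comp_chart_symm' c hy hψ]
      congr 1
      refine EventuallyEq.fderiv_eq ?_
      filter_upwards [hT.mem_nhds hy] with z hz
      exact chartExt_of_mem c ψ hz
    · have : fderiv ℝ (chartExt (m := m) c ψ) y = 0 := by
        by_contra hne
        exact hy (hts (support_fderiv_subset ℝ hne))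
      rw [this]; exact (Set.indicator_of_notMem hy _).symm
  · intro y hy
    rw [h.closed.2 c y hy, inChart_zero]; rfl

theorem exists_partition (m : ℕ) (M : Type*) [TopologicalSpace M] [ChartedSpace (CSpace m) M]
    [IsManifold 𝓘(ℝ, CSpace m) ∞ M] [CompactSpace M] [T2Space M] :
    ∃ (s : Finset M) (χ : M → M → ℝ), (∀ c, ContMDiff 𝓘(ℝ, CSpace m) 𝓘(ℝ, ℝ) ∞ (χ c)) ∧
      (∀ c, tsupport (χ c) ⊆ (chart m c).source) ∧ ∀ x, ∑ c ∈ s, χ c x = 1 := by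
  obtain ⟨f, hf⟩ := SmoothPartitionOfUnity.exists_isSubordinate 𝓘(ℝ, CSpace m)
    (isClosed_univ (X := M)) (fun c => (chart m c).source) (fun c => isOpen_extChartAt_source c)
    (fun x _ => Set.mem_iUnion.2 ⟨x, mem_extChartAt_source x⟩)
  have hfin := f.locallyFinite.finite_nonempty_of_compact
  refine ⟨hfin.toFinset, fun c => f c, fun c => (f c).contMDiff, hf, fun x => ?_⟩
  rw [← f.sum_eq_one (Set.mem_univ x), finsum_eq_sum_of_support_subset]
  intro c hc
  simp only [Set.Finite.coe_toFinset, Set.mem_ofPred_eq]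
  exact ⟨x, hc⟩

end measure

end

/-! ### Differentiating integrals along the segment of Kähler forms. -/

section

open Filter Topology

section parametric
variable {E : Type*} [NormedAddCommGroup E] [MeasurableSpace E] [BorelSpace E] {μ : Measure E}
  [IsFiniteMeasureOnCompacts μ]

/-- A bound for `g` on the compact set `[a, b] × K`, cut off outside `K`, is the dominating
function. -/
theorem continuousOn_integral_of_compact_support {K : Set E} (hK : IsCompact K) {g : ℝ → E → ℝ}
    {a b : ℝ}
    (hg : ContinuousOn (Function.uncurry g) (Set.Icc a b ×ˢ K)) (h0 : ∀ t, ∀ y ∉ K, g t y = 0) :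
    ContinuousOn (fun t => ∫ y, g t y ∂μ) (Set.Icc a b) := by
  obtain ⟨C, hC⟩ := (isCompact_Icc.prod hK).exists_bound_of_continuousOn hg
  have hs : ∀ t ∈ Set.Icc a b, ContinuousOn (g t) K := fun t ht => hg.comp (f := fun y => (t, y))
    (by fun_prop) fun y hy => ⟨ht, hy⟩
  refine continuousOn_of_dominated (bound := K.indicator fun _ => C) ?_ ?_ ?_ ?_
  · exact fun t ht => (integrable_of_continuousOn_compact hK (hs t ht) (h0 t)).aestronglyMeasurable
  · refine fun t ht => Eventually.of_forall fun y => ?_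
    by_cases hy : y ∈ K
    · rw [Set.indicator_of_mem hy]; exact hC (t, y) ⟨ht, hy⟩
    · rw [Set.indicator_of_notMem hy, h0 t y hy, norm_zero]
  · rw [integrable_indicator_iff hK.measurableSet]
    exact integrableOn_const hK.measure_lt_top.ne
  · refine Eventually.of_forall fun y => ?_
    by_cases hy : y ∈ K
    · exact hg.comp (f := fun t => (t, y)) (by fun_prop) fun t ht => ⟨ht, hy⟩
    · simp only [h0 _ y hy]; exact continuousOn_const

theorem hasDerivAt_integral_of_compact_support {K : Set E} (hK : IsCompact K) {g g' : ℝ → E → ℝ}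
    {a b : ℝ}
    (hg : ContinuousOn (Function.uncurry g) (Set.Icc a b ×ˢ K)) (h0 : ∀ t, ∀ y ∉ K, g t y = 0)
    (hg' : ContinuousOn (Function.uncurry g') (Set.Icc a b ×ˢ K)) (h0' : ∀ t, ∀ y ∉ K, g' t y = 0)
    (hd : ∀ t ∈ Set.Ioo a b, ∀ y ∈ K, HasDerivAt (fun t => g t y) (g' t y) t) {t : ℝ}
      (ht : t ∈ Set.Ioo a b) :
    HasDerivAt (fun t => ∫ y, g t y ∂μ) (∫ y, g' t y ∂μ) t := by
  obtain ⟨C, hC⟩ := (isCompact_Icc.prod hK).exists_bound_of_continuousOn hg'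
  have hs : ∀ t ∈ Set.Icc a b, ContinuousOn (g t) K := fun t ht => hg.comp (f := fun y => (t, y))
    (by fun_prop) fun y hy => ⟨ht, hy⟩
  have hs' : ∀ t ∈ Set.Icc a b, ContinuousOn (g' t) K := fun t ht => hg'.comp (f := fun y => (t, y))
    (by fun_prop) fun y hy => ⟨ht, hy⟩
  have ht' := Set.Ioo_subset_Icc_self ht
  refine (hasDerivAt_integral_of_dominated_loc_of_deriv_le (bound := K.indicator fun _ => C)
    (s := Set.Ioo a b) (isOpen_Ioo.mem_nhds ht) ?_ (integrable_of_continuousOn_compact hK (hs t ht')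
    (h0 t)) (integrable_of_continuousOn_compact hK (hs' t ht') (h0' t)).aestronglyMeasurable ?_ ?_
    ?_).2
  · filter_upwards [isOpen_Ioo.mem_nhds ht] with s hs'
    exact (integrable_of_continuousOn_compact hK (hs s (Set.Ioo_subset_Icc_self hs'))
      (h0 s)).aestronglyMeasurable
  · refine Eventually.of_forall fun y s hs => ?_
    by_cases hy : y ∈ K
    · rw [Set.indicator_of_mem hy]; exact hC (s, y) ⟨Set.Ioo_subset_Icc_self hs, hy⟩
    · rw [Set.indicator_of_notMem hy, h0' s y hy, norm_zero]
  · rw [integrable_indicator_iff hK.measurableSet]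
    exact integrableOn_const hK.measure_lt_top.ne
  · refine Eventually.of_forall fun y s hs => ?_
    by_cases hy : y ∈ K
    · exact hd s hs y hy
    · simp only [h0 _ y hy, h0' _ y hy]; exact hasDerivAt_const _ _

end parametric

variable {m : ℕ} {M : Type*} [TopologicalSpace M] [ChartedSpace (CSpace m) M]
  [IsManifold 𝓘(ℂ, CSpace m) ω M] [IsManifold 𝓘(ℝ, CSpace m) ∞ M]
variable [CompactSpace M] [T2Space M] [MeasurableSpace M] [BorelSpace M]
variable {V : Type*} [NormedAddCommGroup V] [NormedSpace ℝ V]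

section
variable {η₀ η₁ : DForm m M 2} {F : V → ℝ} {h₀ u : M → V}

theorem hasDerivAt_line {W : Type*} [NormedAddCommGroup W] [NormedSpace ℝ W] (a b : W) (t : ℝ) :
    HasDerivAt (fun s : ℝ => a + s • b) b t := by
  simpa using ((hasDerivAt_id t).smul_const b).const_add a

/-- The integrand of `∫ χ F(h₀ + t u) v_t` in a chart. -/
def chartIntegrand (η₀ η₁ : DForm m M 2) (F : V → ℝ) (h₀ u : M → V) (χ : M → ℝ) (c : M) (t : ℝ)
    (y : CSpace m) : ℝ :=
  rho (η₀.inChart c y + t • (η₁ - η₀).inChart c y) * (chartExt c χ y * F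
    (h₀ ((chart m c).symm y) + t • u ((chart m c).symm y)))

/-- The time derivative of `chartIntegrand`. -/
def chartIntegrand' (η₀ η₁ : DForm m M 2) (F : V → ℝ) (h₀ u : M → V) (χ : M → ℝ) (c : M) (t : ℝ)
    (y : CSpace m) : ℝ :=
  chartExt c χ y * F (h₀ ((chart m c).symm y) + t • u ((chart m c).symm y)) * fderiv ℝ rho
    (η₀.inChart c y + t • (η₁ - η₀).inChart c y) ((η₁ - η₀).inChart c y)
    + rho (η₀.inChart c y + t • (η₁ - η₀).inChart c y) * (chartExt c χ y * fderiv ℝ F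
      (h₀ ((chart m c).symm y) + t • u ((chart m c).symm y)) (u ((chart m c).symm y)))

theorem gram_segment_pos {c : M} (k₀ : IsKahler η₀) (k₁ : IsKahler η₁) {t : ℝ}
    (ht : t ∈ Set.Icc (0 : ℝ) 1) {y : CSpace m} (hy : y ∈ (chart m c).target) : 0 <
    (gram (η₀.inChart c y + t • (η₁ - η₀).inChart c y)).det := by
  rw [← inChart_segment]; exact (k₀.segment k₁ ht).det_gram_pos c hy

theorem continuousOn_segment {c : M} (k₀ : IsKahler η₀) (k₁ : IsKahler η₁) : ContinuousOn
    (fun p : ℝ × CSpace m => η₀.inChart c p.2 + p.1 • (η₁ - η₀).inChart c p.2)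
    (Set.Icc 0 1 ×ˢ (chart m c).target) := by
  have h2 : ∀ η : DForm m M 2, η.IsSmooth → ContinuousOn (fun p : ℝ × CSpace m => η.inChart c p.2)
    (Set.Icc 0 1 ×ˢ (chart m c).target) := fun η h =>
    ((h c).continuousOn).comp (by fun_prop) fun p hp => hp.2
  exact (h2 _ k₀.closed.1).add (continuous_fst.continuousOn.smul
    (h2 _ (sub_mem k₁.closed k₀.closed).1))

theorem continuousOn_chartIntegrand {c : M} (k₀ : IsKahler η₀) (k₁ : IsKahler η₁)
    (hF : ContDiff ℝ ∞ F) (hh₀ : ContMDiff 𝓘(ℝ, CSpace m) 𝓘(ℝ, V) ∞ h₀)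
    (hu : ContMDiff 𝓘(ℝ, CSpace m) 𝓘(ℝ, V) ∞ u) {χ : M → ℝ} (hχ : ContMDiff 𝓘(ℝ, CSpace m) 𝓘(ℝ, ℝ) ∞
    χ) (hs : tsupport χ ⊆ (chart m c).source) : ContinuousOn
    (Function.uncurry (chartIntegrand η₀ η₁ F h₀ u χ c)) (Set.Icc 0 1 ×ˢ (chart m c).target) := by
  have h1 := continuousOn_segment (c := c) k₀ k₁
  have h2 : ∀ {f : M → V}, ContMDiff 𝓘(ℝ, CSpace m) 𝓘(ℝ, V) ∞ f → ContinuousOn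
    (fun p : ℝ × CSpace m => f ((chart m c).symm p.2)) (Set.Icc 0 1 ×ˢ (chart m c).target) := fun h
    =>
    ((contDiffOn_comp_symm h c).continuousOn).comp (by fun_prop) fun p hp => hp.2
  have h3 : ContinuousOn (fun p : ℝ × CSpace m => rho (η₀.inChart c p.2 + p.1 • (η₁ - η₀).inChart c
    p.2)) (Set.Icc 0 1 ×ˢ (chart m c).target) := fun p hp =>
    ((contDiffAt_rho (n := 1)
      (gram_segment_pos k₀ k₁ hp.1 hp.2)).continuousAt).comp_continuousWithinAt
      (f := fun p : ℝ × CSpace m => η₀.inChart c p.2 + p.1 • (η₁ - η₀).inChart c p.2) (h1 p hp)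
  have h4 : ContinuousOn (fun p : ℝ × CSpace m => h₀ ((chart m c).symm p.2) + p.1 • u
    ((chart m c).symm p.2)) (Set.Icc 0 1 ×ˢ (chart m c).target) :=
    (h2 hh₀).add (continuous_fst.continuousOn.smul (h2 hu))
  exact h3.mul ((((contDiff_chartExt hχ hs).continuous.comp continuous_snd).continuousOn).mul
    (hF.continuous.comp_continuousOn h4))

theorem continuousOn_chartIntegrand' {c : M} (k₀ : IsKahler η₀) (k₁ : IsKahler η₁)
    (hF : ContDiff ℝ ∞ F) (hh₀ : ContMDiff 𝓘(ℝ, CSpace m) 𝓘(ℝ, V) ∞ h₀)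
    (hu : ContMDiff 𝓘(ℝ, CSpace m) 𝓘(ℝ, V) ∞ u) {χ : M → ℝ} (hχ : ContMDiff 𝓘(ℝ, CSpace m) 𝓘(ℝ, ℝ) ∞
    χ) (hs : tsupport χ ⊆ (chart m c).source) : ContinuousOn
    (Function.uncurry (chartIntegrand' η₀ η₁ F h₀ u χ c)) (Set.Icc 0 1 ×ˢ (chart m c).target) := by
  have h1 := continuousOn_segment (c := c) k₀ k₁
  have h2 : ∀ {f : M → V}, ContMDiff 𝓘(ℝ, CSpace m) 𝓘(ℝ, V) ∞ f → ContinuousOn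
    (fun p : ℝ × CSpace m => f ((chart m c).symm p.2)) (Set.Icc 0 1 ×ˢ (chart m c).target) := fun h
    =>
    ((contDiffOn_comp_symm h c).continuousOn).comp (by fun_prop) fun p hp => hp.2
  have h3 : ContinuousOn (fun p : ℝ × CSpace m => rho (η₀.inChart c p.2 + p.1 • (η₁ - η₀).inChart c
    p.2)) (Set.Icc 0 1 ×ˢ (chart m c).target) := fun p hp =>
    ((contDiffAt_rho (n := 1)
      (gram_segment_pos k₀ k₁ hp.1 hp.2)).continuousAt).comp_continuousWithinAt
      (f := fun p : ℝ × CSpace m => η₀.inChart c p.2 + p.1 • (η₁ - η₀).inChart c p.2) (h1 p hp)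
  have h5 : ContinuousOn (fun p : ℝ × CSpace m => fderiv ℝ rho
    (η₀.inChart c p.2 + p.1 • (η₁ - η₀).inChart c p.2)) (Set.Icc 0 1 ×ˢ (chart m c).target) := fun p
    hp =>
    (((contDiffAt_rho (n := 2) (gram_segment_pos k₀ k₁ hp.1 hp.2)).fderiv_right (m := 1)
      (by norm_num)).continuousAt).comp_continuousWithinAt (f := fun p : ℝ × CSpace m => η₀.inChart
      c p.2 + p.1 • (η₁ - η₀).inChart c p.2) (h1 p hp)
  have h6 : ContinuousOn (fun p : ℝ × CSpace m => (η₁ - η₀).inChart c p.2)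
    (Set.Icc 0 1 ×ˢ (chart m c).target) :=
    (((sub_mem k₁.closed k₀.closed).1 c).continuousOn).comp (by fun_prop) fun p hp => hp.2
  have h4 : ContinuousOn (fun p : ℝ × CSpace m => h₀ ((chart m c).symm p.2) + p.1 • u
    ((chart m c).symm p.2)) (Set.Icc 0 1 ×ˢ (chart m c).target) :=
    (h2 hh₀).add (continuous_fst.continuousOn.smul (h2 hu))
  have h7 := ((contDiff_chartExt hχ hs).continuous.comp continuous_snd).continuousOn
    (s := Set.Icc (0 : ℝ) 1 ×ˢ (chart m c).target)
  exact ((h7.mul (hF.continuous.comp_continuousOn h4)).mul (h5.clm_apply h6)).add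
    (h3.mul (h7.mul (((hF.continuous_fderiv (by simp)).comp_continuousOn h4).clm_apply (h2 hu))))

theorem hasDerivAt_chartIntegrand {c : M} (k₀ : IsKahler η₀) (k₁ : IsKahler η₁)
    (hF : ContDiff ℝ ∞ F) {χ : M → ℝ} {t : ℝ} (ht : t ∈ Set.Ioo (0 : ℝ) 1) {y : CSpace m}
    (hy : y ∈ (chart m c).target) :
    HasDerivAt (fun t => chartIntegrand η₀ η₁ F h₀ u χ c t y) (chartIntegrand' η₀ η₁ F h₀ u χ c t y)
      t := by
  have h1 : HasDerivAt (fun s : ℝ => rho (η₀.inChart c y + s • (η₁ - η₀).inChart c y))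
    (fderiv ℝ rho (η₀.inChart c y + t • (η₁ - η₀).inChart c y) ((η₁ - η₀).inChart c y)) t :=
    HasFDerivAt.comp_hasDerivAt (l := rho) (f := fun s : ℝ => η₀.inChart c y + s • (η₁ - η₀).inChart
      c y) t ((contDiffAt_rho (n := 1) (gram_segment_pos k₀ k₁ (Set.Ioo_subset_Icc_self ht)
      hy)).differentiableAt (by simp)).hasFDerivAt (hasDerivAt_line _ _ t)
  have h2 : HasDerivAt (fun s : ℝ => F (h₀ ((chart m c).symm y) + s • u ((chart m c).symm y))) _ t
    :=
    ((hF.differentiable (by simp)) _).hasFDerivAt.comp_hasDerivAt t (hasDerivAt_line _ _ t)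
  refine (h1.mul (h2.const_mul (chartExt c χ y))).congr_deriv ?_
  rw [chartIntegrand']; ring

theorem tsupport_mul_left_subset {ψ f : M → ℝ} : tsupport (fun x => ψ x * f x) ⊆ tsupport ψ :=
  closure_mono fun x hx h0 => hx (by simp [h0])

theorem chartExt_mul (c : M) (ψ f : M → ℝ) {y : CSpace m} (hy : y ∈ (chart m c).target) : chartExt c
    (fun x => ψ x * f x) y = chartExt c ψ y * f ((chart m c).symm y) := by
  rw [chartExt_of_mem _ _ hy, chartExt_of_mem _ _ hy]

theorem chartExt_mul' (c : M) (ψ f : M → ℝ) (y : CSpace m) : chartExt c (fun x => ψ x * f x) y =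
    chartExt c ψ y * f ((chart m c).symm y) := by
  by_cases hy : y ∈ (chart m c).target
  · exact chartExt_mul c ψ f hy
  · rw [chartExt, chartExt, Set.indicator_of_notMem hy, Set.indicator_of_notMem hy, zero_mul]

theorem integral_mul_kahlerVolume {c : M} (k₀ : IsKahler η₀) (k₁ : IsKahler η₁)
    (hF : ContDiff ℝ ∞ F) (hh₀ : ContMDiff 𝓘(ℝ, CSpace m) 𝓘(ℝ, V) ∞ h₀)
    (hu : ContMDiff 𝓘(ℝ, CSpace m) 𝓘(ℝ, V) ∞ u) {χ : M → ℝ} (hχ : ContMDiff 𝓘(ℝ, CSpace m) 𝓘(ℝ, ℝ) ∞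
    χ) (hs : tsupport χ ⊆ (chart m c).source) {t : ℝ} (ht : t ∈ Set.Icc (0 : ℝ) 1) :
    ∫ x, χ x * F (h₀ x + t • u x) ∂(kahlerVolume (KahlerGeometry.segment η₀ η₁ t)) = ∫ y,
      chartIntegrand η₀ η₁ F h₀ u χ c t y := by
  have hq : ContMDiff 𝓘(ℝ, CSpace m) 𝓘(ℝ, ℝ) ∞ fun x => F (h₀ x + t • u x) := hF.contMDiff.comp
    (contMDiff_line hh₀ hu t)
  have hχq : Continuous fun x => χ x * F (h₀ x + t • u x) := hχ.continuous.mul hq.continuous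
  rw [integral_kahlerVolume_chartExt (k₀.segment k₁ ht).closed.1 c hχq
    (tsupport_mul_left_subset.trans hs)]
  refine integral_congr_ae (Eventually.of_forall fun y => ?_)
  simp only [chartIntegrand, inChart_segment, chartExt_mul']

/-- The variation of the density is integrated by parts against the whole product `χ F(h₀ + t u)`.
The resulting terms in the differential of `χ` remain here; they cancel after summation over a
partition of unity. -/
theorem integral_chartIntegrand' {c : M} (k₀ : IsKahler η₀) (k₁ : IsKahler η₁) {α : DForm m M 1}
    (hα : α.IsSmooth) (hdα : HasExtDeriv α (η₁ - η₀)) (hF : ContDiff ℝ ∞ F)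
    (hh₀ : ContMDiff 𝓘(ℝ, CSpace m) 𝓘(ℝ, V) ∞ h₀) (hu : ContMDiff 𝓘(ℝ, CSpace m) 𝓘(ℝ, V) ∞ u)
    {χ : M → ℝ} (hχ : ContMDiff 𝓘(ℝ, CSpace m) 𝓘(ℝ, ℝ) ∞ χ) (hs : tsupport χ ⊆ (chart m c).source)
    {t : ℝ} (ht : t ∈ Set.Icc (0 : ℝ) 1) :
    ∫ y, chartIntegrand' η₀ η₁ F h₀ u χ c t y = ∫ x, (χ x * fderiv ℝ F (h₀ x + t • u x) (u x) - dAt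
      (fun x => χ x * F (h₀ x + t • u x)) x (sharpField (KahlerGeometry.segment η₀ η₁ t) α x))
      ∂(kahlerVolume (KahlerGeometry.segment η₀ η₁ t)) := by
  have kt := k₀.segment k₁ ht
  have := isFiniteMeasure_kahlerVolume kt.closed.1
  have hq : ContMDiff 𝓘(ℝ, CSpace m) 𝓘(ℝ, ℝ) ∞ fun x => F (h₀ x + t • u x) := hF.contMDiff.comp
    (contMDiff_line hh₀ hu t)
  have hχq : ContMDiff 𝓘(ℝ, CSpace m) 𝓘(ℝ, ℝ) ∞ fun x => χ x * F (h₀ x + t • u x) := hχ.mul hq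
  have hc1 : Continuous fun x => χ x * fderiv ℝ F (h₀ x + t • u x) (u x) :=
    hχ.continuous.mul (((hF.continuous_fderiv (by simp)).comp
      (contMDiff_line hh₀ hu t).continuous).clm_apply hu.continuous)
  have hc2 := continuous_mfderiv_sharpField kt hα hχq
  have hi : ∀ {g : M → ℝ}, Continuous g → Integrable g (kahlerVolume
    (KahlerGeometry.segment η₀ η₁ t)) := fun hg => hg.integrable_of_hasCompactSupport
    (HasCompactSupport.of_compactSpace _)
  rw [integral_sub (hi hc1) (hi hc2), integral_kahlerVolume_chartExt kt.closed.1 c hc1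
    (tsupport_mul_left_subset.trans hs)]
  have h := integral_chartExt_mul_fderiv_rho kt hα c hχq (tsupport_mul_left_subset.trans hs)
  rw [sub_eq_add_neg, ← h]
  have hT := (isOpen_extChartAt_target (I := 𝓘(ℝ, CSpace m)) c)
  have hK := isCompact_chart_image (isClosed_tsupport χ) hs
  have hKT := image_tsupport_subset hs
  have hz : ∀ y ∉ chart m c '' tsupport χ, chartExt c χ y = 0 := fun y hy => chartExt_of_notMem hy
  have hA : ∀ y ∈ chart m c '' tsupport χ, extDeriv (α.inChart c) y = (η₁ - η₀).inChart c y := fun y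
    hy => hdα c y (hKT hy)
  have hsub := continuousOn_segment (c := c) k₀ k₁
  have hcont := continuousOn_chartIntegrand' k₀ k₁ hF hh₀ hu hχ hs
  have e2 : ∀ y, rho ((KahlerGeometry.segment η₀ η₁ t).inChart c y) * chartExt c
    (fun x => χ x * fderiv ℝ F (h₀ x + t • u x) (u x)) y =
      rho (η₀.inChart c y + t • (η₁ - η₀).inChart c y) * (chartExt c χ y * fderiv ℝ F
        (h₀ ((chart m c).symm y) + t • u ((chart m c).symm y)) (u ((chart m c).symm y))) := by
    intro y; rw [inChart_segment, chartExt_mul']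
  have e1 : ∀ y, chartExt c (fun x => χ x * F (h₀ x + t • u x)) y * fderiv ℝ rho
    ((KahlerGeometry.segment η₀ η₁ t).inChart c y) (extDeriv (α.inChart c) y) =
      chartExt c χ y * F (h₀ ((chart m c).symm y) + t • u ((chart m c).symm y)) * fderiv ℝ rho
        (η₀.inChart c y + t • (η₁ - η₀).inChart c y) ((η₁ - η₀).inChart c y) := by
    intro y
    rw [inChart_segment, chartExt_mul']
    by_cases hy : y ∈ chart m c '' tsupport χ
    · rw [hA y hy]
    · rw [hz y hy]; simp
  simp only [e1, e2]
  have hcr : ContinuousOn (fun y => rho (η₀.inChart c y + t • (η₁ - η₀).inChart c y))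
    (chart m c '' tsupport χ) := fun y hy =>
    ((contDiffAt_rho (n := 1) (gram_segment_pos k₀ k₁ ht (hKT
      hy))).continuousAt).comp_continuousWithinAt (f := fun y => η₀.inChart c y + t •
      (η₁ - η₀).inChart c y)
      ((hsub.comp (f := fun y => (t, y)) (by fun_prop) (fun y hy => ⟨ht, hKT hy⟩)) y hy)
  have i2 : Integrable fun y => rho (η₀.inChart c y + t • (η₁ - η₀).inChart c y) *
    (chartExt c χ y * fderiv ℝ F (h₀ ((chart m c).symm y) + t • u ((chart m c).symm y))
    (u ((chart m c).symm y))) := by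
    refine integrable_of_continuousOn_compact hK (hcr.mul ((contDiff_chartExt hχ
      hs).continuous.continuousOn.mul ?_)) fun y hy => by rw [hz y hy]; simp
    exact (((hF.continuous_fderiv (by simp)).comp (contMDiff_line hh₀ hu t).continuous).clm_apply
      hu.continuous).comp_continuousOn ((continuousOn_extChartAt_symm c).mono hKT)
  have i3 : Integrable fun y => chartIntegrand' η₀ η₁ F h₀ u χ c t y :=
    integrable_of_continuousOn_compact hK (hcont.comp (f := fun y => (t, y)) (by fun_prop)
      (fun y hy => ⟨ht, hKT hy⟩)) fun y hy => by rw [chartIntegrand', hz y hy]; simp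
  have i1 : Integrable fun y => chartExt c χ y * F (h₀ ((chart m c).symm y) + t • u
    ((chart m c).symm y)) * fderiv ℝ rho (η₀.inChart c y + t • (η₁ - η₀).inChart c y)
    ((η₁ - η₀).inChart c y) := by
    refine (i3.sub i2).congr (Eventually.of_forall fun y => ?_)
    simp [chartIntegrand']
  rw [← integral_add i2 i1]
  refine integral_congr_ae (Eventually.of_forall fun y => ?_)
  simp only [chartIntegrand']; ring

end

/-- The integrals of `F (h₀ + t u)` against the volume of the segment are continuous. -/
theorem integral_segment (F : V → ℝ) {η₀ η₁ : DForm m M 2} {h₀ u : M → V} (k₀ : IsKahler η₀)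
    (k₁ : IsKahler η₁) (hF : ContDiff ℝ ∞ F) (hh₀ : ContMDiff 𝓘(ℝ, CSpace m) 𝓘(ℝ, V) ∞ h₀)
    (hu : ContMDiff 𝓘(ℝ, CSpace m) 𝓘(ℝ, V) ∞ u) :
    ContinuousOn (fun t => ∫ x, F (h₀ x + t • u x) ∂(kahlerVolume (KahlerGeometry.segment η₀ η₁ t)))
      (Set.Icc 0 1) ∧
    ∀ α : DForm m M 1, α.IsSmooth → HasExtDeriv α (η₁ - η₀) → ∀ t ∈ Set.Ioo (0 : ℝ) 1,
      HasDerivAt (fun t => ∫ x, F (h₀ x + t • u x) ∂(kahlerVolume (KahlerGeometry.segment η₀ η₁ t)))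
        (∫ x, fderiv ℝ F (h₀ x + t • u x) (u x - dAt (fun x => h₀ x + t • u x) x
          (sharpField (KahlerGeometry.segment η₀ η₁ t) α x))
          ∂(kahlerVolume (KahlerGeometry.segment η₀ η₁ t))) t := by
  obtain ⟨s, χ, hχ, hs, h1⟩ := exists_partition m M
  have hq : ∀ t, ContMDiff 𝓘(ℝ, CSpace m) 𝓘(ℝ, ℝ) ∞ fun x => F (h₀ x + t • u x) := fun t =>
    hF.contMDiff.comp (contMDiff_line hh₀ hu t)
  have hi : ∀ {g : M → ℝ} {t}, t ∈ Set.Icc (0 : ℝ) 1 → Continuous g → Integrable g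
    (kahlerVolume (KahlerGeometry.segment η₀ η₁ t)) := fun ht hg =>
    have := isFiniteMeasure_kahlerVolume (k₀.segment k₁ ht).closed.1
    hg.integrable_of_hasCompactSupport (HasCompactSupport.of_compactSpace _)
  have hsum : ∀ t ∈ Set.Icc (0 : ℝ) 1, ∫ x, F (h₀ x + t • u x)
    ∂(kahlerVolume (KahlerGeometry.segment η₀ η₁ t)) = ∑ c ∈ s, ∫ y, chartIntegrand η₀ η₁ F h₀ u
    (χ c) c t y := by
    intro t ht
    have hχq : ∀ c, Continuous fun x => χ c x * F (h₀ x + t • u x) := fun c => (hχ c).continuous.mul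
      (hq t).continuous
    rw [Finset.sum_congr rfl fun c _ => (integral_mul_kahlerVolume k₀ k₁ hF hh₀ hu (hχ c) (hs c)
      ht).symm, ← integral_finsetSum _ fun c _ => hi ht (hχq c)]
    refine integral_congr_ae (Eventually.of_forall fun x => ?_)
    simp only [← Finset.sum_mul, h1, one_mul]
  have hK : ∀ c, IsCompact (chart m c '' tsupport (χ c)) := fun c => isCompact_chart_image
    (isClosed_tsupport _) (hs c)
  have hsub : ∀ c, Set.Icc (0 : ℝ) 1 ×ˢ (chart m c '' tsupport (χ c)) ⊆ Set.Icc 0 1 ×ˢ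
    (chart m c).target := fun c => Set.prod_mono le_rfl (image_tsupport_subset (hs c))
  have z1 : ∀ c t, ∀ y ∉ chart m c '' tsupport (χ c), chartIntegrand η₀ η₁ F h₀ u (χ c) c t y = 0 :=
    fun c t y hy => by rw [chartIntegrand, chartExt_of_notMem hy]; simp
  have z2 : ∀ c t, ∀ y ∉ chart m c '' tsupport (χ c), chartIntegrand' η₀ η₁ F h₀ u (χ c) c t y = 0
    := fun c t y hy => by rw [chartIntegrand', chartExt_of_notMem hy]; simp
  refine ⟨?_, fun α hα hdα t ht => ?_⟩
  · refine ContinuousOn.congr (continuousOn_finsetSum s fun c _ => ?_) hsum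
    exact continuousOn_integral_of_compact_support (hK c) ((continuousOn_chartIntegrand k₀ k₁ hF hh₀
      hu (hχ c) (hs c)).mono (hsub c)) (z1 c)
  · have ht' := Set.Ioo_subset_Icc_self ht
    have kt := k₀.segment k₁ ht'
    have hD : HasDerivAt (fun t => ∑ c ∈ s, ∫ y, chartIntegrand η₀ η₁ F h₀ u (χ c) c t y)
      (∑ c ∈ s, ∫ y, chartIntegrand' η₀ η₁ F h₀ u (χ c) c t y) t :=
      HasDerivAt.fun_sum fun c _ => hasDerivAt_integral_of_compact_support (hK c)
        ((continuousOn_chartIntegrand k₀ k₁ hF hh₀ hu (hχ c) (hs c)).mono (hsub c)) (z1 c)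
        ((continuousOn_chartIntegrand' k₀ k₁ hF hh₀ hu (hχ c) (hs c)).mono (hsub c)) (z2 c)
        (fun t ht y hy => hasDerivAt_chartIntegrand k₀ k₁ hF ht (image_tsupport_subset (hs c) hy))
          ht
    refine (hD.congr_of_eventuallyEq ?_).congr_deriv ?_
    · filter_upwards [isOpen_Ioo.mem_nhds ht] with r hr
      exact hsum r (Set.Ioo_subset_Icc_self hr)
    have hχq : ∀ c, ContMDiff 𝓘(ℝ, CSpace m) 𝓘(ℝ, ℝ) ∞ fun x => χ c x * F (h₀ x + t • u x) := fun c
      => (hχ c).mul (hq t)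
    rw [Finset.sum_congr rfl fun c _ => integral_chartIntegrand' k₀ k₁ hα hdα hF hh₀ hu (hχ c)
      (hs c) ht', ← integral_finsetSum]
    · refine integral_congr_ae (Eventually.of_forall fun x => ?_)
      set z := sharpField (KahlerGeometry.segment η₀ η₁ t) α x
      -- The cutoffs add up to `1`, so their differentials cancel in the sum.
      have e1 : ∑ c ∈ s, dAt (fun x => χ c x * F (h₀ x + t • u x)) x z = dAt
        (fun x => F (h₀ x + t • u x)) x z := by
        have hm : ∀ c ∈ s, DifferentiableAt ℝ (fun y => χ c ((chart m x).symm y) * F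
          (h₀ ((chart m x).symm y) + t • u ((chart m x).symm y))) (chart m x x) := fun c _ =>
          ((contDiffOn_comp_symm (hχq c) x).contDiffAt ((isOpen_extChartAt_target x).mem_nhds
            (mem_extChartAt_target x))).differentiableAt (by simp)
        have h4 := fderiv_fun_sum hm
        simp only [← Finset.sum_mul, h1, one_mul] at h4
        have h5 : ∀ z : CSpace m, ∑ c ∈ s, fderiv ℝ (fun y => χ c ((chart m x).symm y) * F
          (h₀ ((chart m x).symm y) + t • u ((chart m x).symm y))) (chart m x x) z = fderiv ℝ
          (fun y => F (h₀ ((chart m x).symm y) + t • u ((chart m x).symm y))) (chart m x x) z := fun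
          z => by
          rw [h4, _root_.sum_apply]
        exact (Finset.sum_congr rfl fun c _ => dAt_eq_fderiv (hχq c) x z).trans
          ((h5 z).trans (dAt_eq_fderiv (hq t) x z).symm)
      have e2 : dAt (fun x => F (h₀ x + t • u x)) x z = fderiv ℝ F (h₀ x + t • u x)
        (dAt (fun x => h₀ x + t • u x) x z) := by
        have h2 := mfderiv_comp x (hF.contMDiff.mdifferentiableAt (by simp) (x := h₀ x + t • u x))
          ((contMDiff_line hh₀ hu t x).mdifferentiableAt (by simp))
        rw [mfderiv_eq_fderiv] at h2
        exact congr($h2 z)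
      simp only [Finset.sum_sub_distrib, ← Finset.sum_mul, h1, one_mul]
      rw [e1, e2, map_sub]
    · intro c _
      refine hi ht' (((hχ c).continuous.mul ?_).sub (continuous_mfderiv_sharpField kt hα (hχq c)))
      exact ((hF.continuous_fderiv (by simp)).comp (contMDiff_line hh₀ hu t).continuous).clm_apply
        hu.continuous

end

/-! ### Compact groups of automorphisms and the invariant mean. -/

section

open Filter Topology
variable {m : ℕ} {M : Type*} [TopologicalSpace M] [ChartedSpace (CSpace m) M]

/-- The topology of a group of automorphisms induced by the compact-open topology. -/
abbrev compactOpen (G : Subgroup (Aut m M)) : TopologicalSpace G :=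
  TopologicalSpace.induced (fun Φ : G => ((Φ : M ≃ₜ M) : C(M, M))) inferInstance

theorem compactSpace_compactOpen {G : Subgroup (Aut m M)} (hG : IsCompactGroup G) : @CompactSpace G
    (compactOpen G) := by
  let := compactOpen G
  refine ⟨?_⟩
  have hi : IsInducing (fun Φ : G => ((Φ : M ≃ₜ M) : C(M, M))) := ⟨rfl⟩
  rw [hi.isCompact_iff]
  refine (congrArg IsCompact ?_).mpr hG
  ext f
  simp

theorem continuous_of_compactOpen [LocallyCompactSpace M] (G : Subgroup (Aut m M)) :
    @Continuous (G × M) M (@instTopologicalSpaceProd _ _ (compactOpen G) _) _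
      (fun p => (p.1 : M ≃ₜ M) p.2) := by
  let := compactOpen G
  have hi : Continuous (fun Φ : G => ((Φ : M ≃ₜ M) : C(M, M))) := continuous_induced_dom
  exact (ContinuousEval.continuous_eval (F := C(M, M))).comp (hi.prodMap continuous_id)

theorem continuous_mul_compactOpen [LocallyCompactSpace M] (G : Subgroup (Aut m M)) :
    @ContinuousMul G (compactOpen G) _ := by
  let := compactOpen G
  have hi : Continuous (fun Φ : G => ((Φ : M ≃ₜ M) : C(M, M))) := continuous_induced_dom
  refine ⟨continuous_induced_rng.2 ?_⟩
  exact (hi.comp continuous_fst).compCM (hi.comp continuous_snd)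

theorem t2Space_compactOpen [T2Space M] (G : Subgroup (Aut m M)) : @T2Space G (compactOpen G) := by
  let := compactOpen G
  refine T2Space.of_injective_continuous (f := fun Φ : G => ((Φ : M ≃ₜ M) : C(M, M)))
    (fun Φ Ψ h => ?_) continuous_induced_dom
  exact Subtype.ext (Subtype.ext (Homeomorph.ext fun x => congr($h x)))

theorem isTopologicalGroup_compactOpen [T2Space M] [LocallyCompactSpace M] {G : Subgroup (Aut m M)}
    (hG : IsCompactGroup G) :
    @IsTopologicalGroup G (compactOpen G) _ := by
  let := compactOpen G
  have := compactSpace_compactOpen hG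
  have := continuous_mul_compactOpen G
  have := t2Space_compactOpen G
  -- The preimage of the closed set `C` under inversion is the projection along a compact factor of
  -- the closed set of pairs with product `1` and second entry in `C`.
  have hinv : ContinuousInv G := by
    refine ⟨continuous_iff_isClosed.2 fun C hC => ?_⟩
    have h1 : IsClosed ({q : G × G | q.1 * q.2 = 1} ∩ Prod.snd ⁻¹' C) :=
      (isClosed_eq continuous_mul continuous_const).inter (hC.preimage continuous_snd)
    convert isClosedMap_fst_of_compactSpace _ h1 using 1
    ext g
    simp [mul_eq_one_iff_inv_eq]
  exact { }

/-- Pull-back reverses products, so averaged pull-backs are invariant when the mean is invariant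
under right translation. The choice `ψ p = p⁻¹` turns left invariance of Haar measure into this. No
measurability of `f` is required. -/
theorem exists_right_invariant_mean [T2Space M] [LocallyCompactSpace M] {G : Subgroup (Aut m M)}
    (hG : IsCompactGroup G) :
    ∃ (_ : TopologicalSpace G) (_ : CompactSpace G) (_ : MeasurableSpace G) (_ : BorelSpace G)
      (μ : Measure G)
      (_ : IsProbabilityMeasure μ) (ψ : G → Aut m M), (∀ p, ψ p ∈ G) ∧ Continuous
        (fun q : G × M => (ψ q.1 : M ≃ₜ M) q.2) ∧
        ∀ θ ∈ G, ∀ f : Aut m M → ℝ, ∫ p, f (ψ p * θ) ∂μ = ∫ p, f (ψ p) ∂μ := by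
  let := compactOpen G
  have := compactSpace_compactOpen hG
  have := isTopologicalGroup_compactOpen hG
  let : MeasurableSpace G := borel G
  have : BorelSpace G := ⟨rfl⟩
  refine ⟨inferInstance, inferInstance, inferInstance, inferInstance, Measure.haarMeasure ⊤,
    ⟨Measure.haarMeasure_self⟩, fun p => (p⁻¹ : G), fun p => (p⁻¹ : G).2, ?_, fun θ hθ f => ?_⟩
  · exact (continuous_of_compactOpen G).comp (continuous_inv.prodMap continuous_id)
  · rw [← integral_mul_left_eq_self (fun p : G => f (p⁻¹ : G)) (⟨θ, hθ⟩ : G)⁻¹]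
    simp

/-- On a compact group the compact-open topology is that of pointwise convergence, since a
continuous injection of a compact space into a Hausdorff one is an embedding. So continuity of each
orbit of a flow in `G` gives joint continuity. -/
theorem continuous_of_forall_mem [T2Space M] [LocallyCompactSpace M] {G : Subgroup (Aut m M)}
    (hG : IsCompactGroup G) {T : Type*} [TopologicalSpace T] {θ : T → Aut m M}
    (hθ : ∀ t, θ t ∈ G) (hc : ∀ x, Continuous fun t => (θ t : M ≃ₜ M) x) : Continuous fun q : T × M
      => (θ q.1 : M ≃ₜ M) q.2 := by
  let := compactOpen G
  have := compactSpace_compactOpen hG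
  have hi : IsClosedEmbedding (fun (Φ : G) (x : M) => (Φ : M ≃ₜ M) x) := by
    refine Continuous.isClosedEmbedding (continuous_pi fun x => ?_) fun Φ Ψ h => Subtype.ext
      (Subtype.ext (Homeomorph.ext fun x => congr($h x)))
    exact (continuous_of_compactOpen G).comp (Continuous.prodMk_left x)
  have h2 : Continuous fun t => (⟨θ t, hθ t⟩ : G) := hi.isEmbedding.continuous_iff.2
    (continuous_pi hc)
  exact (continuous_of_compactOpen G).comp (h2.prodMap continuous_id)

end

/-! ### Cauchy's estimates for families of holomorphic maps. -/

section

open Filter Topology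

section Cauchy
variable {P E F : Type*} [TopologicalSpace P] [NormedAddCommGroup E] [NormedSpace ℂ E]
  [NormedAddCommGroup F] [NormedSpace ℂ F]

theorem hasDerivAt_comp_complex_line {f : E → F} {y v : E} {ζ : ℂ}
    (hf : DifferentiableAt ℂ f (y + ζ • v)) :
    HasDerivAt (fun ζ : ℂ => f (y + ζ • v)) (fderiv ℂ f (y + ζ • v) v) ζ := by
  have h1 : HasDerivAt (fun ζ : ℂ => y + ζ • v) v ζ := by
    simpa using ((hasDerivAt_id ζ).smul_const v).const_add y
  exact hf.hasFDerivAt.comp_hasDerivAt ζ h1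

/-- Cauchy's estimate along a complex line. -/
theorem norm_fderiv_apply_le {f : E → F} {y v : E} {r C : ℝ} (hr : 0 < r)
    (hf : ∀ ζ ∈ Metric.closedBall (0 : ℂ) r, DifferentiableAt ℂ f (y + ζ • v))
    (hC : ∀ ζ ∈ Metric.closedBall (0 : ℂ) r, ‖f (y + ζ • v)‖ ≤ C) : ‖fderiv ℂ f y v‖ ≤ C / r := by
  have h0 := hasDerivAt_comp_complex_line (hf 0 (Metric.mem_closedBall_self hr.le))
  simp only [zero_smul, add_zero] at h0
  rw [← h0.deriv]
  refine Complex.norm_deriv_le_of_forall_mem_sphere_norm_le hr (DifferentiableOn.diffContOnCl ?_)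
    fun ζ hζ => hC ζ (Metric.sphere_subset_closedBall hζ)
  rw [closure_ball _ hr.ne']
  exact fun ζ hζ => (hasDerivAt_comp_complex_line (hf ζ hζ)).differentiableAt.differentiableWithinAt

theorem exists_closedBall_line {Q : P × E → Prop} {p : P} {y : E} (v : E)
    (hQ : ∀ᶠ q in 𝓝 (p, y), Q q) :
    ∃ r > 0, ∀ ζ ∈ Metric.closedBall (0 : ℂ) r, ∀ᶠ q in 𝓝 (p, y + ζ • v), Q q := by
  have h1 : Tendsto (fun ζ : ℂ => (p, y + ζ • v)) (𝓝 0) (𝓝 (p, y)) := by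
    have : Continuous (fun ζ : ℂ => (p, y + ζ • v)) := by fun_prop
    simpa using this.tendsto 0
  obtain ⟨r, hr, h⟩ := Metric.nhds_basis_closedBall.eventually_iff.1
    (h1.eventually (eventually_eventually_nhds.2 hQ))
  exact ⟨r, hr, fun ζ hζ => h hζ⟩

/-- Cauchy's estimate is applied to the difference of two members of the family on a small disc of a
complex line, where joint continuity makes it uniformly small. The translation `a` brings
derivatives at different points to the same point. -/
theorem continuousAt_fderiv_family [FiniteDimensional ℂ E] {f : P → E → F} {q₀ : P × E}
    (hc : ∀ᶠ q in 𝓝 q₀, ContinuousAt (Function.uncurry f) q)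
      (hd : ∀ᶠ q in 𝓝 q₀, DifferentiableAt ℂ (f q.1) q.2) :
    ContinuousAt (fun q : P × E => fderiv ℂ (f q.1) q.2) q₀ := by
  refine continuousAt_clm_apply.2 fun v => ?_
  obtain ⟨p, y⟩ := q₀
  obtain ⟨r, hr, h⟩ := exists_closedBall_line v (hc.and hd)
  rw [Metric.continuousAt_iff']
  intro ε hε
  -- The bound carries the factor `r` because Cauchy's estimate divides by the radius, leaving `ε /
  -- 2`.
  have h2 : ∀ᶠ q : P × E in 𝓝 (p, y), ∀ ζ ∈ Metric.closedBall (0 : ℂ) r,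
      DifferentiableAt ℂ (f q.1) (q.2 + ζ • v) ∧ ‖f q.1 (q.2 + ζ • v) - f p (y + ζ • v)‖ ≤ ε / 2 * r
        := by
    refine (isCompact_closedBall _ _).eventually_forall_of_forall_eventually fun ζ hζ => ?_
    have hT : Tendsto (fun z : (P × E) × ℂ => (z.1.1, z.1.2 + z.2 • v)) (𝓝 ((p, y), ζ))
      (𝓝 (p, y + ζ • v)) :=
      (show Continuous fun z : (P × E) × ℂ => (z.1.1, z.1.2 + z.2 • v) by fun_prop).tendsto _
    have hT2 : Tendsto (fun z : (P × E) × ℂ => (p, y + z.2 • v)) (𝓝 ((p, y), ζ)) (𝓝 (p, y + ζ • v))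
      :=
      (show Continuous fun z : (P × E) × ℂ => (p, y + z.2 • v) by fun_prop).tendsto _
    have h3 := (h ζ hζ).self_of_nhds.1
    have h4 := (h3.tendsto.comp hT).sub (h3.tendsto.comp hT2)
    rw [sub_self] at h4
    filter_upwards [hT.eventually (h ζ hζ), h4.norm.eventually
      (ge_mem_nhds (by rw [norm_zero]; positivity : ‖(0 : F)‖ < ε / 2 * r))] with z hz hz2
    exact ⟨hz.2, hz2⟩
  filter_upwards [h2] with q hq
  have hd0 : ∀ ζ ∈ Metric.closedBall (0 : ℂ) r, DifferentiableAt ℂ (f p) (y + ζ • v) := fun ζ hζ =>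
    (h ζ hζ).self_of_nhds.2
  set a := q.2 - y
  have hg : ∀ ζ ∈ Metric.closedBall (0 : ℂ) r, DifferentiableAt ℂ (fun z => f q.1 (z + a))
    (y + ζ • v) := fun ζ hζ => by
    refine DifferentiableAt.comp _ (g := f q.1) ?_ (by fun_prop)
    convert (hq ζ hζ).1 using 1
    simp only [a]; abel
  have e := norm_fderiv_apply_le (f := (fun z => f q.1 (z + a)) - f p) hr
    (fun ζ hζ => (hg ζ hζ).sub (hd0 ζ hζ)) (fun ζ hζ => by
    have := (hq ζ hζ).2
    simp only [Pi.sub_apply]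
    rwa [show y + ζ • v + a = q.2 + ζ • v by simp only [a]; abel])
  have h0 : (0 : ℂ) ∈ Metric.closedBall (0 : ℂ) r := Metric.mem_closedBall_self hr.le
  have hg0 := hg 0 h0
  have hd00 := hd0 0 h0
  rw [zero_smul, add_zero] at hg0 hd00
  rw [fderiv_sub hg0 hd00, fderiv_comp_add_right] at e
  rw [dist_eq_norm]
  simp only [a, add_sub_cancel, _root_.sub_apply] at e ⊢
  refine e.trans_lt ?_
  rw [mul_div_cancel_right₀ _ hr.ne']
  linarith

/-- The time and space derivatives are interchanged by applying Cauchy's estimate to the remainder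
`f s - f 0 - s f₁ 0`, which the mean value inequality in `s` bounds by `ε r |s|` on a disc of radius
`r`. -/
theorem hasDerivAt_fderiv_family {f f₁ : ℝ → E → F} {y v : E}
    (hc : ∀ᶠ q in 𝓝 ((0 : ℝ), y), ContinuousAt (Function.uncurry f₁) q)
    (ht : ∀ᶠ q : ℝ × E in 𝓝 ((0 : ℝ), y), HasDerivAt (fun s => f s q.2) (f₁ q.1 q.2) q.1)
    (hd : ∀ᶠ q in 𝓝 ((0 : ℝ), y), DifferentiableAt ℂ (f q.1) q.2)
    (hd₁ : ∀ᶠ z in 𝓝 y, DifferentiableAt ℂ (f₁ 0) z) :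
    HasDerivAt (fun s => fderiv ℂ (f s) y v) (fderiv ℂ (f₁ 0) y v) 0 := by
  have hd₁' : ∀ᶠ q : ℝ × E in 𝓝 ((0 : ℝ), y), DifferentiableAt ℂ (f₁ 0) q.2 :=
    (continuous_snd.tendsto ((0 : ℝ), y)).eventually hd₁
  obtain ⟨r, hr, h⟩ := exists_closedBall_line v (((hc.and ht).and hd).and hd₁')
  rw [hasDerivAt_iff_isLittleO, Asymptotics.isLittleO_iff]
  intro ε hε
  have h2 : ∀ᶠ s : ℝ in 𝓝 0, ∀ ζ ∈ Metric.closedBall (0 : ℂ) r,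
      DifferentiableAt ℂ (f s) (y + ζ • v) ∧ HasDerivAt (fun s => f s (y + ζ • v))
        (f₁ s (y + ζ • v)) s ∧
        ‖f₁ s (y + ζ • v) - f₁ 0 (y + ζ • v)‖ ≤ ε * r := by
    refine (isCompact_closedBall _ _).eventually_forall_of_forall_eventually fun ζ hζ => ?_
    have hT : Tendsto (fun z : ℝ × ℂ => (z.1, y + z.2 • v)) (𝓝 (0, ζ)) (𝓝 (0, y + ζ • v)) :=
      (show Continuous fun z : ℝ × ℂ => (z.1, y + z.2 • v) by fun_prop).tendsto _
    have hT2 : Tendsto (fun z : ℝ × ℂ => ((0 : ℝ), y + z.2 • v)) (𝓝 (0, ζ)) (𝓝 (0, y + ζ • v)) :=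
      (show Continuous fun z : ℝ × ℂ => ((0 : ℝ), y + z.2 • v) by fun_prop).tendsto _
    have h3 := (h ζ hζ).self_of_nhds.1.1.1
    have h4 := (h3.tendsto.comp hT).sub (h3.tendsto.comp hT2)
    rw [sub_self] at h4
    filter_upwards [hT.eventually (h ζ hζ), h4.norm.eventually
      (ge_mem_nhds (by rw [norm_zero]; positivity : ‖(0 : F)‖ < ε * r))] with z hz hz2
    exact ⟨hz.1.2, hz.1.1.2, hz2⟩
  obtain ⟨δ, hδ, h2⟩ := Metric.eventually_nhds_iff_ball.1 h2
  have h0 : (0 : ℂ) ∈ Metric.closedBall (0 : ℂ) r := Metric.mem_closedBall_self hr.le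
  filter_upwards [Metric.ball_mem_nhds 0 hδ] with s hs
  have hd0 : ∀ s ∈ Metric.ball (0 : ℝ) δ, ∀ ζ ∈ Metric.closedBall (0 : ℂ) r, DifferentiableAt ℂ
    (f s) (y + ζ • v) := fun s hs ζ hζ => (h2 s hs ζ hζ).1
  have hd1 : ∀ ζ ∈ Metric.closedBall (0 : ℂ) r, DifferentiableAt ℂ (f₁ 0) (y + ζ • v) := fun ζ hζ =>
    (h ζ hζ).self_of_nhds.2
  have hm : (0 : ℝ) ∈ Metric.ball (0 : ℝ) δ := Metric.mem_ball_self hδ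
  have e := norm_fderiv_apply_le (f := f s - f 0 - (s : ℂ) • f₁ 0) (C := ε * r * ‖s - 0‖) hr
    (fun ζ hζ => ((hd0 s hs ζ hζ).sub (hd0 0 hm ζ hζ)).sub ((hd1 ζ hζ).const_smul _))
    (fun ζ hζ => by
    have := (convex_ball (0 : ℝ) δ).norm_image_sub_le_of_norm_hasDerivWithin_le
      (f := fun s => f s (y + ζ • v) - (s : ℝ) • f₁ 0 (y + ζ • v))
      (f' := fun s => f₁ s (y + ζ • v) - f₁ 0 (y + ζ • v)) (C := ε * r)
      (fun s hs => ?_) (fun s hs => (h2 s hs ζ hζ).2.2) hm hs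
    · rw [zero_smul, sub_zero] at this
      refine Eq.trans_le ?_ this
      simp only [Pi.sub_apply, Pi.smul_apply, Complex.coe_smul]
      congr 1; abel
    · have h5 := ((hasDerivAt_id s).smul_const (f₁ 0 (y + ζ • v)))
      rw [one_smul] at h5
      exact ((h2 s hs ζ hζ).2.1.sub h5).hasDerivWithinAt)
  have k1 := hd0 s hs 0 h0
  have k2 := hd0 0 hm 0 h0
  have k3 := hd1 0 h0
  rw [zero_smul, add_zero] at k1 k2 k3
  rw [fderiv_sub (k1.sub k2) (k3.const_smul _), fderiv_sub k1 k2, fderiv_const_smul k3] at e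
  simp only [_root_.sub_apply, _root_.smul_apply, Complex.coe_smul] at e
  rw [sub_zero s] at e ⊢
  refine e.trans_eq ?_
  field_simp

end Cauchy

end

/-! ### Automorphisms in charts and pull-back of forms. -/

section

open Filter Topology
variable {m : ℕ} {M : Type*} [TopologicalSpace M] [ChartedSpace (CSpace m) M]
  [IsManifold 𝓘(ℂ, CSpace m) ω M] [IsManifold 𝓘(ℝ, CSpace m) ∞ M]

/-- An automorphism in the preferred charts at `c` and `c'`. -/
def autChart (Φ : Aut m M) (c c' : M) (y : CSpace m) : CSpace m := chart m c'
    ((Φ : M ≃ₜ M) ((chart m c).symm y))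

theorem contDiffAt_autChart (Φ : Aut m M) {c c' : M} {y : CSpace m} (hy : y ∈ (chart m c).target)
    (hy' : (Φ : M ≃ₜ M) ((chart m c).symm y) ∈ (chart m c').source) :
    ContDiffAt ℂ ω (autChart Φ c c') y := by
  have h1 := (contMDiffOn_extChartAt_symm (I := 𝓘(ℂ, CSpace m)) (n := ω) c).contMDiffAt
    ((isOpen_extChartAt_target c).mem_nhds hy)
  have h2 := (contMDiffOn_extChartAt (I := 𝓘(ℂ, CSpace m)) (n := ω) (x := c')).contMDiffAt
    ((chartAt (CSpace m) c').open_source.mem_nhds (by simpa using hy'))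
  exact (ContMDiffAt.comp y h2 (ContMDiffAt.comp y (Φ.2.1 _) h1)).contDiffAt

theorem contDiffAt_autChart_real (Φ : Aut m M) {c c' : M} {y : CSpace m}
    (hy : y ∈ (chart m c).target) (hy' : (Φ : M ≃ₜ M) ((chart m c).symm y) ∈ (chart m c').source) :
    ContDiffAt ℝ ∞ (autChart Φ c c') y :=
  ((contDiffAt_autChart Φ hy hy').restrict_scalars ℝ).of_le le_top

theorem fderiv_autChart (Φ : Aut m M) {c c' : M} {y : CSpace m} (hy : y ∈ (chart m c).target)
    (hy' : (Φ : M ≃ₜ M) ((chart m c).symm y) ∈ (chart m c').source) :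
    fderiv ℝ (autChart Φ c c') y = (fderiv ℂ (autChart Φ c c') y).restrictScalars ℝ :=
  ((contDiffAt_autChart Φ hy hy').differentiableAt (by simp)).fderiv_restrictScalars ℝ

theorem mfderiv_chartInvDeriv (Φ : Aut m M) {c c' : M} {y : CSpace m} (hy : y ∈ (chart m c).target)
    (hy' : (Φ : M ≃ₜ M) ((chart m c).symm y) ∈ (chart m c').source) (v : CSpace m) :
    (mfderiv 𝓘(ℝ, CSpace m) 𝓘(ℝ, CSpace m) (Φ : M ≃ₜ M) ((chart m c).symm y) (chartInvDeriv c y v) :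
      CSpace m) = (chartInvDeriv c' (autChart Φ c c' y) (fderiv ℝ (autChart Φ c c') y v) : CSpace m)
      := by
  have hd := (Aut.contMDiff Φ ((chart m c).symm y)).mdifferentiableAt (by simp)
  have hc := mdifferentiableAt_chart c' hy'
  have h1 : fderiv ℝ (autChart Φ c c') y v = mfderiv 𝓘(ℝ, CSpace m) 𝓘(ℝ, CSpace m) (chart m c')
    ((Φ : M ≃ₜ M) ((chart m c).symm y)) (mfderiv 𝓘(ℝ, CSpace m) 𝓘(ℝ, CSpace m) (Φ : M ≃ₜ M)
    ((chart m c).symm y) (chartInvDeriv c y v)) :=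
    (fderiv_comp_chart_symm c hy (MDifferentiableAt.comp _ hc hd) v).trans
      congr($(mfderiv_comp ((chart m c).symm y) hc hd) _)
  have h2 : autChart Φ c c' y ∈ (chart m c').target := (chart m c').map_source hy'
  have h3 : (chart m c').symm (autChart Φ c c' y) = (Φ : M ≃ₜ M) ((chart m c).symm y) :=
    (chart m c').left_inv hy'
  rw [h1]
  have := chartInvDeriv_mfderiv_chart c' h2
  rw [h3] at this
  exact (this _).symm

/-- The pull-back of a form by an automorphism. -/
def pullback {k : ℕ} (Φ : Aut m M) (α : DForm m M k) : DForm m M k := fun x =>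
  (α ((Φ : M ≃ₜ M) x)).compContinuousLinearMap (mfderiv 𝓘(ℝ, CSpace m) 𝓘(ℝ, CSpace m) (Φ : M ≃ₜ M)
    x)

theorem DForm.congr_point {k : ℕ} (α : DForm m M k) {x x' : M} (h : x' = x)
    {w w' : Fin k → CSpace m} (hw : w = w') : α x w = α x' w' := by
  subst h hw; rfl

theorem inChart_pullback {k : ℕ} (Φ : Aut m M) (α : DForm m M k) {c c' : M} {y : CSpace m}
    (hy : y ∈ (chart m c).target) (hy' : (Φ : M ≃ₜ M) ((chart m c).symm y) ∈ (chart m c').source) :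
    (pullback Φ α).inChart c y = (α.inChart c' (autChart Φ c c' y)).compContinuousLinearMap
      (fderiv ℝ (autChart Φ c c') y) := by
  ext v
  exact α.congr_point ((chart m c').left_inv hy') (funext fun i => mfderiv_chartInvDeriv Φ hy hy'
    (v i))

theorem eventually_mem_autChart (Φ : Aut m M) {c c' : M} {y : CSpace m}
    (hy : y ∈ (chart m c).target) (hy' : (Φ : M ≃ₜ M) ((chart m c).symm y) ∈ (chart m c').source) :
    ∀ᶠ z in 𝓝 y, z ∈ (chart m c).target ∧ (Φ : M ≃ₜ M) ((chart m c).symm z) ∈ (chart m c').source :=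
      by
  have h1 := (continuousOn_extChartAt_symm (I := 𝓘(ℝ, CSpace m)) c).continuousAt
    ((isOpen_extChartAt_target c).mem_nhds hy)
  exact Filter.Eventually.and ((isOpen_extChartAt_target c).mem_nhds hy)
    (((Φ : M ≃ₜ M).continuous.continuousAt.comp h1).eventually
    ((isOpen_extChartAt_source c').mem_nhds hy'))

/-- A 1-form in a chart, as a linear form. -/
def covector (α : DForm m M 1) (c : M) (y : CSpace m) : CSpace m →L[ℝ] ℝ :=
    (ContinuousAlternatingMap.ofSubsingletonLIE (𝕜 := ℝ) (E := CSpace m) (F := ℝ) (0 : Fin 1)).symm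
    (α.inChart c y)

theorem covector_apply (α : DForm m M 1) (c : M) (y v : CSpace m) : covector α c y v = α.inChart c y
    ![v] := by
  change α.inChart c y _ = _
  congr 1
  ext i; fin_cases i; rfl

theorem contDiffAt_covector_iff {α : DForm m M 1} {c : M} {y : CSpace m} {n : WithTop ℕ∞} :
    ContDiffAt ℝ n (covector α c) y ↔ ContDiffAt ℝ n (α.inChart c) y :=
  (ContinuousAlternatingMap.ofSubsingletonLIE (𝕜 := ℝ) (E := CSpace m) (F := ℝ)
    (0 : Fin 1)).symm.toContinuousLinearEquiv.comp_contDiffAt_iff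

theorem covector_pullback (Φ : Aut m M) (α : DForm m M 1) {c c' : M} {y : CSpace m}
    (hy : y ∈ (chart m c).target) (hy' : (Φ : M ≃ₜ M) ((chart m c).symm y) ∈ (chart m c').source) :
    covector (pullback Φ α) c y = (covector α c' (autChart Φ c c' y)).comp
      (fderiv ℝ (autChart Φ c c') y) := by
  ext v
  rw [covector_apply, inChart_pullback Φ α hy hy', ContinuousLinearMap.comp_apply, covector_apply]
  change α.inChart _ _ _ = _
  congr 1
  ext i; fin_cases i; rfl

theorem DForm.IsSmooth.contDiffAt_covector {α : DForm m M 1} (hα : α.IsSmooth) {c : M}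
    {y : CSpace m} (hy : y ∈ (chart m c).target) : ContDiffAt ℝ ∞ (covector α c) y :=
  contDiffAt_covector_iff.2 ((hα c).contDiffAt ((isOpen_extChartAt_target c).mem_nhds hy))

theorem DForm.IsSmooth.pullback (Φ : Aut m M) {α : DForm m M 1} (hα : α.IsSmooth) :
    (pullback Φ α).IsSmooth := by
  intro c y hy
  have hy' : (Φ : M ≃ₜ M) ((chart m c).symm y) ∈ (chart m ((Φ : M ≃ₜ M)
    ((chart m c).symm y))).source := mem_extChartAt_source (I := 𝓘(ℝ, CSpace m)) _
  set c' := (Φ : M ≃ₜ M) ((chart m c).symm y)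
  refine (contDiffAt_covector_iff.1 (ContDiffAt.congr_of_eventuallyEq ?_
    ((eventually_mem_autChart Φ hy hy').mono fun z hz => covector_pullback Φ α hz.1
    hz.2))).contDiffWithinAt
  have h1 := contDiffAt_autChart_real Φ hy hy'
  exact (ContDiffAt.comp y (hα.contDiffAt_covector ((chart m c').map_source hy')) h1).clm_comp
    (h1.fderiv_right (m := ∞) le_rfl)

theorem HasExtDeriv.covector {α : DForm m M 1} {β : DForm m M 2} (h : HasExtDeriv α β)
    (hα : α.IsSmooth) {c : M} {y : CSpace m} (hy : y ∈ (chart m c).target) (u v : CSpace m) :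
    fderiv ℝ (covector α c) y u v - fderiv ℝ (covector α c) y v u = β.inChart c y ![u, v] := by
  have hd := hα.differentiableAt c hy
  have hd' := (hα.contDiffAt_covector hy).differentiableAt (by simp)
  have e : ∀ u v, fderiv ℝ (KahlerGeometry.covector α c) y u v = fderiv ℝ (α.inChart c) y u ![v] :=
    fun u v => by
    rw [← fderiv_alt_apply hd]
    simp only [← covector_apply]
    exact congr($(((ContinuousLinearMap.apply ℝ ℝ v).hasFDerivAt.comp y hd'.hasFDerivAt).fderiv)
      u).symm
  rw [← h c y hy, extDeriv_one hd, e, e]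

theorem HasExtDeriv.pullback {k : ℕ} (Φ : Aut m M) {α : DForm m M k} {β : DForm m M (k + 1)}
    (hα : α.IsSmooth) (h : HasExtDeriv α β) : HasExtDeriv (pullback Φ α) (pullback Φ β) := by
  intro c y hy
  have hy' : (Φ : M ≃ₜ M) ((chart m c).symm y) ∈ (chart m ((Φ : M ≃ₜ M)
    ((chart m c).symm y))).source := mem_extChartAt_source (I := 𝓘(ℝ, CSpace m)) _
  set c' := (Φ : M ≃ₜ M) ((chart m c).symm y)
  have ht : autChart Φ c c' y ∈ (chart m c').target := (chart m c').map_source hy'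
  rw [inChart_pullback Φ β hy hy', ← h c' _ ht, ← extDeriv_pullback (hα.differentiableAt c' ht)
    (contDiffAt_autChart_real Φ hy hy')
    (minSmoothness_of_isRCLikeNormedField.trans_le (WithTop.coe_le_coe.2 le_top))]
  exact Filter.EventuallyEq.extDeriv_eq ((eventually_mem_autChart Φ hy hy').mono fun z hz =>
    inChart_pullback Φ α hz.1 hz.2)

theorem pullback_mul {k : ℕ} (Φ Ψ : Aut m M) (α : DForm m M k) : pullback (Φ * Ψ) α = pullback Ψ
    (pullback Φ α) := by
  ext x v
  have h := mfderiv_comp x ((Aut.contMDiff Φ ((Ψ : M ≃ₜ M) x)).mdifferentiableAt (by simp))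
    ((Aut.contMDiff Ψ x).mdifferentiableAt (by simp))
  exact congrArg (α ((Φ : M ≃ₜ M) ((Ψ : M ≃ₜ M) x))) (funext fun i => congr($h (v i)))

theorem IsInvariantForm.pullback_eq {G : Subgroup (Aut m M)} {η : DForm m M 2}
    (h : IsInvariantForm G η) {Φ : Aut m M} (hΦ : Φ ∈ G) : pullback Φ η = η := by
  ext x v
  have hv : ![v 0, v 1] = v := by ext i; fin_cases i <;> rfl
  refine Eq.trans ?_ ((h Φ hΦ x (v 0) (v 1)).trans (congrArg (η x) hv))
  refine congrArg (η ((Φ : M ≃ₜ M) x)) ?_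
  ext i; fin_cases i <;> rfl

theorem pullback_sub {k : ℕ} (Φ : Aut m M) (α β : DForm m M k) : pullback Φ (α - β) = pullback Φ α -
    pullback Φ β := rfl

end

/-! ### Averages of families that are jointly continuous with their derivative. -/

section

open Filter Topology
theorem integrable_of_compactSpace {P F : Type*} [TopologicalSpace P] [CompactSpace P]
    [MeasurableSpace P] [BorelSpace P] {μ : Measure P} [IsFiniteMeasure μ] [NormedAddCommGroup F]
    {g : P → F} (hg : Continuous g) : Integrable g μ :=
  hg.integrable_of_hasCompactSupport (HasCompactSupport.of_compactSpace _)

section JointC1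
variable {P E F F' F'' : Type*} [TopologicalSpace P] [NormedAddCommGroup E] [NormedSpace ℝ E]
  [NormedAddCommGroup F] [NormedSpace ℝ F]
  [NormedAddCommGroup F'] [NormedSpace ℝ F'] [NormedAddCommGroup F''] [NormedSpace ℝ F'']

/-- A family of maps which near `q₀` is jointly continuous together with its derivative. -/
def IsC1Family (f : P → E → F) (q₀ : P × E) : Prop :=
  ∀ᶠ q in 𝓝 q₀, ContinuousAt (Function.uncurry f) q ∧ DifferentiableAt ℝ (f q.1) q.2 ∧ ContinuousAt
    (fun q : P × E => fderiv ℝ (f q.1) q.2) q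

theorem IsC1Family.congr {f g : P → E → F} {q₀ : P × E} (hf : IsC1Family f q₀)
    (h : ∀ᶠ q in 𝓝 q₀, f q.1 q.2 = g q.1 q.2) : IsC1Family g q₀ := by
  filter_upwards [hf, eventually_eventually_nhds.2 h] with q hq h1
  have h2 : ∀ᶠ q' in 𝓝 q, f q'.1 =ᶠ[𝓝 q'.2] g q'.1 := by
    filter_upwards [eventually_eventually_nhds.2 h1] with q' hq'
    exact ((Continuous.prodMk_right q'.1).tendsto q'.2).eventually hq'
  refine ⟨hq.1.congr h1, h2.self_of_nhds.differentiableAt_iff.1 hq.2.1, hq.2.2.congr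
    (h2.mono fun q' hq' => hq'.fderiv_eq)⟩

theorem IsC1Family.clm_comp {f : P → E → F' →L[ℝ] F''} {g : P → E → F →L[ℝ] F'} {q₀ : P × E}
    (hf : IsC1Family f q₀) (hg : IsC1Family g q₀) :
    IsC1Family (fun p y => (f p y).comp (g p y)) q₀ := by
  filter_upwards [hf, hg, eventually_eventually_nhds.2 (hf.and hg)] with q hf hg h
  refine ⟨hf.1.clm_comp hg.1, hf.2.1.clm_comp hg.2.1, ?_⟩
  refine ContinuousAt.congr ?_ (h.mono fun q' h' => (fderiv_clm_comp h'.1.2.1 h'.2.2.1).symm)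
  refine ContinuousAt.add ?_ ?_
  · exact ((ContinuousLinearMap.compL ℝ F F' F'').continuous.continuousAt.comp hf.1).clm_comp hg.2.2
  · exact ((ContinuousLinearMap.compL ℝ F F' F'').flip.continuous.continuousAt.comp hg.1).clm_comp
      hf.2.2

theorem IsC1Family.comp {f : P → E → F} {h : F → F'} {q₀ : P × E} (hf : IsC1Family f q₀)
    (hh : ContDiffAt ℝ 2 h (f q₀.1 q₀.2)) :
    IsC1Family (fun p y => h (f p y)) q₀ := by
  have h1 : ∀ᶠ q : P × E in 𝓝 q₀, ContDiffAt ℝ 2 h (f q.1 q.2) := hf.self_of_nhds.1.eventually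
    (hh.eventually (by simp))
  filter_upwards [hf, h1, eventually_eventually_nhds.2 (hf.and h1)] with q hf h1 h
  refine ⟨ContinuousAt.comp (f := Function.uncurry f) h1.continuousAt hf.1,
    (h1.differentiableAt (by simp)).comp _ hf.2.1, ?_⟩
  refine ContinuousAt.congr ?_ (h.mono fun q' h' => (fderiv_comp q'.2
    (h'.2.differentiableAt (by simp)) h'.1.2.1).symm)
  exact (ContinuousAt.comp (f := Function.uncurry f) (h1.fderiv_right (m := 1)
    (by norm_num)).continuousAt hf.1).clm_comp hf.2.2

/-- Compactness of `P` makes the local hypotheses hold on one neighbourhood of `y` for all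
parameters, and bounds the derivatives there by the constant `C + 1`. -/
theorem IsC1Family.hasFDerivAt_integral [CompactSpace P] [MeasurableSpace P] [BorelSpace P]
    {μ : Measure P} [IsFiniteMeasure μ]
    {f : P → E → F} {y : E} (hf : ∀ p, IsC1Family f (p, y)) :
    HasFDerivAt (fun z => ∫ p, f p z ∂μ) (∫ p, fderiv ℝ (f p) y ∂μ) y ∧
      (∀ᶠ z in 𝓝 y, Integrable (fun p => f p z) μ) ∧ Integrable (fun p => fderiv ℝ (f p) y) μ := by
  have h1 : ∀ᶠ z in 𝓝 y, ∀ p ∈ (Set.univ : Set P), ContinuousAt (Function.uncurry f) (p, z) ∧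
    DifferentiableAt ℝ (f p) z ∧ ContinuousAt (fun q : P × E => fderiv ℝ (f q.1) q.2) (p, z) := by
    refine isCompact_univ.eventually_forall_of_forall_eventually fun p _ => ?_
    exact (continuous_swap.tendsto (y, p)).eventually (hf p)
  have hc : Continuous fun p => fderiv ℝ (f p) y := continuous_iff_continuousAt.2 fun p =>
    ContinuousAt.comp (f := fun p => (p, y)) (g := fun q : P × E => fderiv ℝ (f q.1) q.2)
      (hf p).self_of_nhds.2.2 (Continuous.prodMk_left y).continuousAt
  obtain ⟨C, hC⟩ := isCompact_univ.exists_bound_of_continuousOn hc.continuousOn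
  have h2 : ∀ᶠ z in 𝓝 y, ∀ p ∈ (Set.univ : Set P), ‖fderiv ℝ (f p) z‖ ≤ C + 1 := by
    refine isCompact_univ.eventually_forall_of_forall_eventually fun p _ => ?_
    exact (continuous_swap.tendsto (y, p)).eventually ((hf p).self_of_nhds.2.2.norm.eventually
      (ge_mem_nhds (by linarith [hC p trivial] : ‖fderiv ℝ (f p) y‖ < C + 1)))
  have hfc : ∀ᶠ z in 𝓝 y, Integrable (fun p => f p z) μ := h1.mono fun z hz =>
    integrable_of_compactSpace (continuous_iff_continuousAt.2 fun p =>
    ContinuousAt.comp (f := fun p => (p, z)) (g := Function.uncurry f) (hz p trivial).1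
      (Continuous.prodMk_left z).continuousAt)
  refine ⟨?_, hfc, integrable_of_compactSpace hc⟩
  exact hasFDerivAt_integral_of_dominated_of_fderiv_le (F := fun z p => f p z)
    (F' := fun z p => fderiv ℝ (f p) z) (bound := fun _ => C + 1) (h1.and h2)
    (hfc.mono fun z hz => hz.aestronglyMeasurable) hfc.self_of_nhds
      (integrable_of_compactSpace hc).aestronglyMeasurable (Eventually.of_forall fun p z hz => hz.2
      p trivial)
    (integrable_const _) (Eventually.of_forall fun p z hz => (hz.1 p trivial).2.1.hasFDerivAt)

end JointC1

section holomorphic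
variable {P E F : Type*} [TopologicalSpace P] [NormedAddCommGroup E] [NormedSpace ℂ E]
  [FiniteDimensional ℂ E] [NormedAddCommGroup F] [NormedSpace ℂ F]

/-- Joint continuity and holomorphy in the space variable suffice; the parameter space needs only a
topology, so no Lie group structure on `G` is used. -/
theorem isC1Family_of_holomorphic {f : P → E → F} {q₀ : P × E}
    (hc : ∀ᶠ q in 𝓝 q₀, ContinuousAt (Function.uncurry f) q)
      (hd : ∀ᶠ q in 𝓝 q₀, DifferentiableAt ℂ (f q.1) q.2) : IsC1Family f q₀ := by
  filter_upwards [hc, hd, eventually_eventually_nhds.2 hc, eventually_eventually_nhds.2 hd] with q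
    h1 h2 h3 h4
  refine ⟨h1, h2.restrictScalars ℝ, ContinuousAt.congr ?_ (h4.mono fun q' h =>
    (h.fderiv_restrictScalars ℝ).symm)⟩
  exact ContinuousAt.comp (g := ContinuousLinearMap.restrictScalarsL ℂ E F ℝ ℝ)
    (ContinuousLinearMap.continuous _).continuousAt (continuousAt_fderiv_family h3 h4)

theorem isC1Family_fderiv_of_holomorphic {f : P → E → F} {q₀ : P × E}
    (hc : ∀ᶠ q in 𝓝 q₀, ContinuousAt (Function.uncurry f) q)
      (hd : ∀ᶠ q in 𝓝 q₀, ContDiffAt ℂ 2 (f q.1) q.2) : IsC1Family (fun p => fderiv ℝ (f p)) q₀ :=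
      by
  have hd1 : ∀ᶠ q in 𝓝 q₀, DifferentiableAt ℂ (f q.1) q.2 := hd.mono fun q h => h.differentiableAt
    (by simp)
  have h1 : IsC1Family (fun p => fderiv ℂ (f p)) q₀ := by
    refine isC1Family_of_holomorphic ?_ (hd.mono fun q h => (h.fderiv_right (m := 1)
      (by norm_num)).differentiableAt (by simp))
    filter_upwards [eventually_eventually_nhds.2 hc, eventually_eventually_nhds.2 hd1] with q h1 h2
    exact continuousAt_fderiv_family h1 h2
  refine (h1.comp (h := ContinuousLinearMap.restrictScalarsL ℂ E F ℝ ℝ)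
    (ContinuousLinearMap.contDiff _).contDiffAt).congr ?_
  exact hd1.mono fun q h => (h.fderiv_restrictScalars ℝ).symm

end holomorphic

end

/-! ### Pull-backs along the group, flows and the Lie derivative. -/

section

open Filter Topology
variable {m : ℕ} {M : Type*} [TopologicalSpace M] [ChartedSpace (CSpace m) M]
  [IsManifold 𝓘(ℂ, CSpace m) ω M] [IsManifold 𝓘(ℝ, CSpace m) ∞ M]

section family
variable {P : Type*} [TopologicalSpace P] {ψ : P → Aut m M}

theorem eventually_autChart_family (hψ : Continuous fun q : P × M => (ψ q.1 : M ≃ₜ M) q.2)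
    {c c' : M} {p : P} {y : CSpace m} (hy : y ∈ (chart m c).target)
    (hy' : (ψ p : M ≃ₜ M) ((chart m c).symm y) ∈ (chart m c').source) :
    ∀ᶠ q : P × CSpace m in 𝓝 (p, y), q.2 ∈ (chart m c).target ∧ (ψ q.1 : M ≃ₜ M)
      ((chart m c).symm q.2) ∈ (chart m c').source ∧ ContinuousAt
      (fun q : P × CSpace m => autChart (ψ q.1) c c' q.2) q := by
  have h1 : ∀ q : P × CSpace m, q.2 ∈ (chart m c).target → ContinuousAt
    (fun q : P × CSpace m => (ψ q.1 : M ≃ₜ M) ((chart m c).symm q.2)) q := fun q hq => by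
    have h := (continuousOn_extChartAt_symm (I := 𝓘(ℝ, CSpace m)) c).continuousAt
      ((isOpen_extChartAt_target c).mem_nhds hq)
    exact hψ.continuousAt.comp (continuousAt_fst.prodMk (h.comp continuousAt_snd))
  filter_upwards [continuousAt_snd.eventually ((isOpen_extChartAt_target c).mem_nhds hy),
    (h1 (p, y) hy).eventually ((isOpen_extChartAt_source c').mem_nhds hy')] with q h2 h3
  refine ⟨h2, h3, ?_⟩
  exact ((continuousOn_extChartAt (I := 𝓘(ℝ, CSpace m)) c').continuousAt
    ((isOpen_extChartAt_source c').mem_nhds h3)).comp (f := fun q : P × CSpace m => (ψ q.1 : M ≃ₜ M)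
    ((chart m c).symm q.2)) (h1 q h2)

/-- In charts the pull-back involves the coefficients of the smooth form `α` along a holomorphic map
and the derivative of that map; both are families of the required kind. -/
theorem isC1Family_covector (hψ : Continuous fun q : P × M => (ψ q.1 : M ≃ₜ M) q.2)
    {α : DForm m M 1} (hα : α.IsSmooth) {c : M} {y : CSpace m} (hy : y ∈ (chart m c).target) (p : P)
    :
    IsC1Family (fun p => covector (pullback (ψ p) α) c) (p, y) := by
  have hy' : (ψ p : M ≃ₜ M) ((chart m c).symm y) ∈ (chart m ((ψ p : M ≃ₜ M)
    ((chart m c).symm y))).source := mem_extChartAt_source (I := 𝓘(ℝ, CSpace m)) _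
  set c' := (ψ p : M ≃ₜ M) ((chart m c).symm y)
  have he := eventually_autChart_family hψ hy hy'
  have hc := he.mono fun q h => h.2.2
  have hd : ∀ᶠ q : P × CSpace m in 𝓝 (p, y), ContDiffAt ℂ 2 (autChart (ψ q.1) c c') q.2 := he.mono
    fun q h => (contDiffAt_autChart _ h.1 h.2.1).of_le le_top
  have h1 : IsC1Family (fun p => autChart (ψ p) c c') (p, y) := isC1Family_of_holomorphic hc
    (hd.mono fun q h => h.differentiableAt (by simp))
  have h2 : IsC1Family (fun p => fderiv ℝ (autChart (ψ p) c c')) (p, y) :=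
    isC1Family_fderiv_of_holomorphic hc hd
  refine ((h1.comp (h := covector α c') ?_).clm_comp h2).congr
    (he.mono fun q h => (covector_pullback _ _ h.1 h.2.1).symm)
  exact (hα.contDiffAt_covector ((chart m c').map_source hy')).of_le (WithTop.coe_le_coe.2 le_top)

end family

theorem hasDerivAt_flow {X : VField m M} {θ : ℝ → Aut m M} (hθ : IsFlow X θ) {c c' : M}
    {z : CSpace m} {s : ℝ} (hz : (θ s : M ≃ₜ M) ((chart m c).symm z) ∈ (chart m c').source) :
    HasDerivAt (fun s => autChart (θ s) c c' z) (X.inChart c' (autChart (θ s) c c' z)) s := by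
  have h1 := hθ.2 ((chart m c).symm z) s
  have h2 := (mdifferentiableAt_chart c' hz).hasMFDerivAt.comp s h1
  have h3 : MDifferentiableAt 𝓘(ℝ, ℝ) 𝓘(ℝ, CSpace m) (fun s => autChart (θ s) c c' z) s :=
    h2.mdifferentiableAt
  have h4 : fderiv ℝ (fun s => autChart (θ s) c c' z) s 1 = _ :=
    (congr($(mfderiv_eq_fderiv (f := fun s => autChart (θ s) c c' z)) 1)).symm.trans
    congr($(h2.mfderiv) 1)
  refine h3.differentiableAt.hasFDerivAt.hasDerivAt.congr_deriv (h4.trans ?_)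
  have key : ∀ x, (θ s : M ≃ₜ M) ((chart m c).symm z) = x → mfderiv 𝓘(ℝ, CSpace m) 𝓘(ℝ, CSpace m)
    (chart m c') ((θ s : M ≃ₜ M) ((chart m c).symm z)) (X ((θ s : M ≃ₜ M) ((chart m c).symm z))) =
    (mfderiv 𝓘(ℝ, CSpace m) 𝓘(ℝ, CSpace m) (chart m c') x (X x) : CSpace m) := by
    rintro _ rfl; rfl
  refine Eq.trans ?_ (key _ ((chart m c').left_inv hz).symm)
  exact congrArg (mfderiv 𝓘(ℝ, CSpace m) 𝓘(ℝ, CSpace m) (chart m c')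
    ((θ s : M ≃ₜ M) ((chart m c).symm z))) (one_smul ℝ (X ((θ s : M ≃ₜ M) ((chart m c).symm z))))

/-- The linear form `v ↦ (L_X β)(v)` in terms of local coordinates. -/
def lieDeriv (β : CSpace m → CSpace m →L[ℝ] ℝ) (X : CSpace m → CSpace m) (y v : CSpace m) : ℝ :=
  fderiv ℝ β y (X y) v + β y (fderiv ℝ X y v)

/-- The invariance `hinv` is differentiated at `s = 0`. The derivative in `s` of the differential of
the flow is the differential of `X`, by the interchange of derivatives for holomorphic families. -/
theorem lieDeriv_eq_zero_of_flow {X : VField m M} (hX : IsHolomorphicField X) {θ : ℝ → Aut m M}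
    (hθ : IsFlow X θ) (hθc : Continuous fun q : ℝ × M => (θ q.1 : M ≃ₜ M) q.2)
    {β : CSpace m → CSpace m →L[ℝ] ℝ} {c : M} {y : CSpace m} (hy : y ∈ (chart m c).target)
      (hβ : DifferentiableAt ℝ β y) (v : CSpace m)
    (hinv : ∀ᶠ s in 𝓝 (0 : ℝ), β (autChart (θ s) c c y) (fderiv ℝ (autChart (θ s) c c) y v) = β y v)
      : lieDeriv β (X.inChart c) y v = 0 := by
  have hθ0 : ∀ z ∈ (chart m c).target, (θ 0 : M ≃ₜ M) ((chart m c).symm z) = (chart m c).symm z :=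
    fun z _ => hθ.1 _
  have hy' : (θ 0 : M ≃ₜ M) ((chart m c).symm y) ∈ (chart m c).source :=
    by rw [hθ0 y hy]; exact (chart m c).map_target hy
  have he := eventually_autChart_family hθc hy hy'
  have hid : autChart (θ 0) c c =ᶠ[𝓝 y] id := by
    filter_upwards [(isOpen_extChartAt_target c).mem_nhds hy] with z hz
    rw [autChart, hθ0 z hz, (chart m c).right_inv hz, id]
  have hXd : ∀ z ∈ (chart m c).target, ContDiffAt ℂ ω (X.inChart c) z := fun z hz =>
    (hX.contDiffOn_inChart_complex c).contDiffAt ((isOpen_extChartAt_target c).mem_nhds hz)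
  have hX0 : X.inChart c ∘ autChart (θ 0) c c =ᶠ[𝓝 y] X.inChart c := hid.mono fun z hz =>
    by rw [Function.comp_apply, hz, id]
  have h1 := hasDerivAt_fderiv_family (f := fun s => autChart (θ s) c c)
    (f₁ := fun s => X.inChart c ∘ autChart (θ s) c c) (y := y) (v := v)
    (he.mono fun q h => ContinuousAt.comp (g := X.inChart c)
      (hXd _ ((chart m c).map_source h.2.1)).continuousAt h.2.2)
    (he.mono fun q h => hasDerivAt_flow hθ h.2.1) (he.mono fun q h =>
      (contDiffAt_autChart _ h.1 h.2.1).differentiableAt (by simp))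
    (by
      filter_upwards [eventually_eventually_nhds.2 hX0, (isOpen_extChartAt_target c).mem_nhds
        hy] with z h hz
      exact ((hXd z hz).differentiableAt (by simp)).congr_of_eventuallyEq h)
  have hs : ∀ᶠ s in 𝓝 (0 : ℝ), (θ s : M ≃ₜ M) ((chart m c).symm y) ∈ (chart m c).source :=
    ((Continuous.prodMk_left y).tendsto (0 : ℝ)).eventually (he.mono fun q h => h.2.1)
  have h2 : HasDerivAt (fun s => fderiv ℝ (autChart (θ s) c c) y v) (fderiv ℝ (X.inChart c) y v) 0
    := by
    rw [hX0.fderiv_eq] at h1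
    rw [((hXd y hy).differentiableAt (by simp)).fderiv_restrictScalars ℝ]
    refine h1.congr_of_eventuallyEq (hs.mono fun s h => ?_)
    simp only [fderiv_autChart (θ s) hy h, ContinuousLinearMap.coe_restrictScalars']
  have h3 : HasDerivAt (fun s => autChart (θ s) c c y) (X.inChart c y) 0 := by
    have := hasDerivAt_flow hθ hy'
    rwa [hid.self_of_nhds] at this
  have h4 : HasDerivAt (fun s => β (autChart (θ s) c c y)) (fderiv ℝ β y (X.inChart c y)) 0 := by
    refine HasFDerivAt.comp_hasDerivAt 0 ?_ h3
    rw [hid.self_of_nhds]; exact hβ.hasFDerivAt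
  have h5 := h4.clm_apply h2
  rw [hid.self_of_nhds, hid.fderiv_eq, fderiv_id] at h5
  exact h5.unique ((hasDerivAt_const (0 : ℝ) (β y v)).congr_of_eventuallyEq hinv)

end

/-! ### The averaged primitive and its values on the Lie algebra. -/

section

open Filter Topology
variable {m : ℕ} {M : Type*} [TopologicalSpace M] [ChartedSpace (CSpace m) M]
  [IsManifold 𝓘(ℂ, CSpace m) ω M] [IsManifold 𝓘(ℝ, CSpace m) ∞ M]
  {G : Subgroup (Aut m M)}

theorem contDiffOn_inChart_of_mem_lieAlg {X : VField m M} (hX : X ∈ lieAlg G) (c : M) : ContDiffOn ℝ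
    ∞ (X.inChart c) (chart m c).target := by
  induction hX using Submodule.span_induction with
  | mem X h => exact h.1.contDiffOn_inChart c
  | zero =>
    have : VField.inChart (0 : VField m M) c = 0 :=
      by simpa using VField.inChart_smul (0 : ℝ) (0 : VField m M) c
    rw [this]; exact contDiffOn_const
  | add X Y _ _ hX hY => rw [VField.inChart_add]; exact hX.add hY
  | smul a X _ hX => rw [VField.inChart_smul]; exact hX.const_smul a

/-- The Lie derivative is linear in the field, so the generators of the span suffice. -/
theorem lieDeriv_eq_zero_of_mem_lieAlg {c : M} {y : CSpace m} (hy : y ∈ (chart m c).target)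
    {β : CSpace m → CSpace m →L[ℝ] ℝ} (v : CSpace m)
    (h : ∀ X : VField m M, IsHolomorphicField X → (∃ θ : ℝ → Aut m M, IsFlow X θ ∧ ∀ t, θ t ∈ G) →
      lieDeriv β (X.inChart c) y v = 0)
    {X : VField m M} (hX : X ∈ lieAlg G) : lieDeriv β (X.inChart c) y v = 0 := by
  have hd : ∀ X ∈ lieAlg G, DifferentiableAt ℝ (VField.inChart X c) y := fun X hX =>
    ((contDiffOn_inChart_of_mem_lieAlg hX c).contDiffAt ((isOpen_extChartAt_target c).mem_nhds
    hy)).differentiableAt (by simp)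
  induction hX using Submodule.span_induction with
  | mem X hX => exact h X hX.1 hX.2
  | zero =>
    have : VField.inChart (0 : VField m M) c = 0 :=
      by simpa using VField.inChart_smul (0 : ℝ) (0 : VField m M) c
    simp [this, lieDeriv]
  | add X Y hX' hY' hX hY =>
    rw [VField.inChart_add, lieDeriv, fderiv_add (hd X hX') (hd Y hY')]
    rw [lieDeriv] at hX hY
    simp only [Pi.add_apply, map_add, _root_.add_apply]
    linarith
  | smul a X hX' hX =>
    rw [VField.inChart_smul, lieDeriv, fderiv_const_smul (hd X hX')]
    rw [lieDeriv] at hX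
    simp only [Pi.smul_apply, map_smul, _root_.smul_apply, ← smul_add, hX, smul_zero]

section average
variable {P : Type*} [TopologicalSpace P] [CompactSpace P] [MeasurableSpace P] [BorelSpace P]
  {μ : Measure P} [IsProbabilityMeasure μ] {ψ : P → Aut m M}
  {α : DForm m M 1} {A : DForm m M 2}

/-- The average of the pull-backs of a 1-form, in a chart. -/
def avgCovector (μ : Measure P) (ψ : P → Aut m M) (α : DForm m M 1) (c : M) (y : CSpace m) : CSpace
    m →L[ℝ] ℝ := ∫ p, covector (pullback (ψ p) α) c y ∂μ

/-- The average of the values of the pull-backs of a 1-form on a vector field. -/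
def avgEval (μ : Measure P) (ψ : P → Aut m M) (α : DForm m M 1) (X : VField m M) (x : M) : ℝ := ∫ p,
    pullback (ψ p) α x ![X x] ∂μ

theorem avgCovector_apply (hψ : Continuous fun q : P × M => (ψ q.1 : M ≃ₜ M) q.2) (hα : α.IsSmooth)
    {c : M} {y : CSpace m} (hy : y ∈ (chart m c).target) (v : CSpace m) :
    avgCovector μ ψ α c y v = ∫ p, covector (pullback (ψ p) α) c y v ∂μ :=
  ContinuousLinearMap.integral_apply (IsC1Family.hasFDerivAt_integral (μ := μ)
    (isC1Family_covector hψ hα hy)).2.1.self_of_nhds v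

theorem differentiableAt_avgCovector (hψ : Continuous fun q : P × M => (ψ q.1 : M ≃ₜ M) q.2)
    (hα : α.IsSmooth) {c : M} {y : CSpace m} (hy : y ∈ (chart m c).target) :
    DifferentiableAt ℝ (avgCovector μ ψ α c) y :=
  (IsC1Family.hasFDerivAt_integral (μ := μ) (isC1Family_covector hψ hα hy)).1.differentiableAt

/-- All pull-backs have the same exterior derivative `A`, and the mean has total mass one. -/
theorem fderiv_avgCovector_sub (hψ : Continuous fun q : P × M => (ψ q.1 : M ≃ₜ M) q.2)
    (hα : α.IsSmooth) (hA : ∀ p, HasExtDeriv (pullback (ψ p) α) A) {c : M} {y : CSpace m}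
    (hy : y ∈ (chart m c).target) (u v : CSpace m) :
    fderiv ℝ (avgCovector μ ψ α c) y u v - fderiv ℝ (avgCovector μ ψ α c) y v u = A.inChart c y
      ![u, v] := by
  obtain ⟨h1, -, h2⟩ := IsC1Family.hasFDerivAt_integral (μ := μ) (isC1Family_covector hψ hα hy)
  have h3 : ∀ u v, fderiv ℝ (avgCovector μ ψ α c) y u v = ∫ p, fderiv ℝ
    (covector (pullback (ψ p) α) c) y u v ∂μ := fun u v => by
    have h4 : fderiv ℝ (avgCovector μ ψ α c) y = _ := h1.fderiv
    rw [h4, ContinuousLinearMap.integral_apply h2, ContinuousLinearMap.integral_apply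
      (h2.apply_continuousLinearMap u)]
  rw [h3, h3, ← integral_sub ((h2.apply_continuousLinearMap u).apply_continuousLinearMap v)
    ((h2.apply_continuousLinearMap v).apply_continuousLinearMap u)]
  simp only [fun p => (hA p).covector (hα.pullback (ψ p)) hy u v, integral_const, probReal_univ,
    one_smul]

/-- Right invariance of the mean makes the averaged form invariant under every one-parameter
subgroup of `G`. -/
theorem lieDeriv_avgCovector [T2Space M] [LocallyCompactSpace M] (hG : IsCompactGroup G)
    (hψ : Continuous fun q : P × M => (ψ q.1 : M ≃ₜ M) q.2)
    (hinv : ∀ θ ∈ G, ∀ f : Aut m M → ℝ, ∫ p, f (ψ p * θ) ∂μ = ∫ p, f (ψ p) ∂μ) (hα : α.IsSmooth)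
      {X : VField m M} (hX : X ∈ lieAlg G) {c : M} {y : CSpace m} (hy : y ∈ (chart m c).target)
      (v : CSpace m) :
    lieDeriv (avgCovector μ ψ α c) (X.inChart c) y v = 0 := by
  refine lieDeriv_eq_zero_of_mem_lieAlg hy v (fun X hX ⟨θ, hθ, hθG⟩ => ?_) hX
  have hθc := continuous_of_forall_mem hG hθG fun x => continuous_iff_continuousAt.2 fun t =>
    (hθ.2 x t).continuousAt
  refine lieDeriv_eq_zero_of_flow hX hθ hθc hy (differentiableAt_avgCovector hψ hα hy) v ?_
  have hs : ∀ᶠ s in 𝓝 (0 : ℝ), (θ s : M ≃ₜ M) ((chart m c).symm y) ∈ (chart m c).source := by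
    refine (hθc.comp (Continuous.prodMk_left _)).continuousAt.eventually
      ((isOpen_extChartAt_source c).mem_nhds ?_)
    exact (congrArg (· ∈ (chart m c).source) (hθ.1 _)).mpr ((chart m c).map_target hy)
  filter_upwards [hs] with s hs
  rw [avgCovector_apply (y := autChart (θ s) c c y) hψ hα ((chart m c).map_source hs),
    avgCovector_apply hψ hα hy, ← hinv (θ s) (hθG s) fun Φ => covector (pullback Φ α) c y v]
  refine integral_congr_ae (Eventually.of_forall fun p => ?_)
  simp only [pullback_mul]
  rw [covector_pullback (θ s) _ hy hs]
  rfl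

theorem avgEval_symm (hψ : Continuous fun q : P × M => (ψ q.1 : M ≃ₜ M) q.2) (hα : α.IsSmooth)
    (X : VField m M) {c : M} {y : CSpace m} (hy : y ∈ (chart m c).target) :
    avgEval μ ψ α X ((chart m c).symm y) = avgCovector μ ψ α c y (X.inChart c y) := by
  rw [avgCovector_apply hψ hα hy, avgEval]
  refine integral_congr_ae (Eventually.of_forall fun p => ?_)
  simp only [covector_apply]
  rw [inChart_apply₁, X.chartInvDeriv_inChart c hy]

/-- Cartan's formula for the averaged form `β`: from `L_X β = 0` and `dβ = A` follows `d(β(X)) =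
-ι_X A`. -/
theorem hasFDerivAt_avgEval [T2Space M] [LocallyCompactSpace M] (hG : IsCompactGroup G)
    (hψ : Continuous fun q : P × M => (ψ q.1 : M ≃ₜ M) q.2)
    (hinv : ∀ θ ∈ G, ∀ f : Aut m M → ℝ, ∫ p, f (ψ p * θ) ∂μ = ∫ p, f (ψ p) ∂μ) (hα : α.IsSmooth)
      (hA : ∀ p, HasExtDeriv (pullback (ψ p) α) A)
    {X : VField m M} (hX : X ∈ lieAlg G) {c : M} {y : CSpace m} (hy : y ∈ (chart m c).target) :
    DifferentiableAt ℝ (fun z => avgEval μ ψ α X ((chart m c).symm z)) y ∧ ∀ v, fderiv ℝ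
      (fun z => avgEval μ ψ α X ((chart m c).symm z)) y v = -A.inChart c y ![X.inChart c y, v] := by
  have h1 : (fun z => avgEval μ ψ α X ((chart m c).symm z)) =ᶠ[𝓝 y] fun z => avgCovector μ ψ α c z
    (X.inChart c z) := by
    filter_upwards [(isOpen_extChartAt_target c).mem_nhds hy] with z hz
    exact avgEval_symm hψ hα X hz
  have hd := differentiableAt_avgCovector (μ := μ) hψ hα hy
  have hXd : DifferentiableAt ℝ (X.inChart c) y := ((contDiffOn_inChart_of_mem_lieAlg hX
    c).contDiffAt ((isOpen_extChartAt_target c).mem_nhds hy)).differentiableAt (by simp)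
  refine ⟨(hd.clm_apply hXd).congr_of_eventuallyEq h1, fun v => ?_⟩
  have h2 := lieDeriv_avgCovector hG hψ hinv hα hX hy v
  rw [lieDeriv] at h2
  rw [h1.fderiv_eq, fderiv_clm_apply hd hXd, ← fderiv_avgCovector_sub (μ := μ) hψ hα hA hy]
  simp only [_root_.add_apply, ContinuousLinearMap.comp_apply, ContinuousLinearMap.flip_apply]
  linarith

/-- Joint continuity in the group element and the point is what exchanging the two integrals
requires. -/
theorem continuous_pullback_apply (hψ : Continuous fun q : P × M => (ψ q.1 : M ≃ₜ M) q.2)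
    (hα : α.IsSmooth) {X : VField m M} (hX : X ∈ lieAlg G) :
    Continuous fun q : P × M => pullback (ψ q.1) α q.2 ![X q.2] := by
  refine continuous_iff_continuousAt.2 fun ⟨p, x⟩ => ?_
  have hy : chart m x x ∈ (chart m x).target := mem_extChartAt_target x
  have h1 : (fun q : P × M => pullback (ψ q.1) α q.2 ![X q.2]) =ᶠ[𝓝 (p, x)] fun q => covector
    (pullback (ψ q.1) α) x (chart m x q.2) (X.inChart x (chart m x q.2)) := by
    filter_upwards [continuousAt_snd.eventually ((isOpen_extChartAt_source (I := 𝓘(ℝ, CSpace m))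
      x).mem_nhds (mem_extChartAt_source x))] with q hq
    have hq' : chart m x q.2 ∈ (chart m x).target := (chart m x).map_source hq
    have h2 : (chart m x).symm (chart m x q.2) = q.2 := (chart m x).left_inv hq
    rw [covector_apply, inChart_apply₁, X.chartInvDeriv_inChart x hq', h2]
  refine ContinuousAt.congr ?_ h1.symm
  have hc : ContinuousAt (fun q : P × M => chart m x q.2) (p, x) :=
    ((continuousOn_extChartAt (I := 𝓘(ℝ, CSpace m)) x).continuousAt
      ((isOpen_extChartAt_source x).mem_nhds (mem_extChartAt_source x))).comp continuousAt_snd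
  refine ContinuousAt.clm_apply ?_ ?_
  · exact ContinuousAt.comp (f := fun q : P × M => (q.1, chart m x q.2))
      (g := Function.uncurry fun p => covector (pullback (ψ p) α) x)
      (isC1Family_covector hψ hα hy p).self_of_nhds.1 (continuousAt_fst.prodMk hc)
  · exact ContinuousAt.comp (f := fun q : P × M => chart m x q.2) (g := X.inChart x)
      ((contDiffOn_inChart_of_mem_lieAlg hX x).continuousOn.continuousAt
      ((isOpen_extChartAt_target x).mem_nhds hy)) hc

end average

theorem contDiffOn_inChart_apply {A : DForm m M 2} (hA : A.IsSmooth) {X : VField m M}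
    (hX : X ∈ lieAlg G) (c : M) (v : CSpace m) :
    ContDiffOn ℝ ∞ (fun y => A.inChart c y ![X.inChart c y, v]) (chart m c).target := by
  have h1 : ∀ y, A.inChart c y ![X.inChart c y, v] = ∑ a, (realBasis m).repr (X.inChart c y) a *
    A.inChart c y ![realBasis m a, v] := fun y => by
    have h := congr(form2 (A.inChart c y) $((realBasis m).sum_repr (X.inChart c y)) v)
    simp only [map_sum, map_smul, LinearMap.sum_apply, LinearMap.smul_apply, smul_eq_mul] at h
    exact h.symm
  simp only [h1]
  refine ContDiffOn.sum fun a _ => ContDiffOn.mul ?_ ((contDiff_apply_alt _).comp_contDiffOn (hA c))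
  exact (LinearMap.toContinuousLinearMap ((realBasis m).coord a)).contDiff.comp_contDiffOn
    (contDiffOn_inChart_of_mem_lieAlg hX c)

/-- A function with smooth derivative `-ι_X A` in all charts is smooth with differential `-ι_X A`. -/
theorem contMDiff_of_fderiv_eq {A : DForm m M 2} (hA : A.IsSmooth) {X : VField m M}
    (hX : X ∈ lieAlg G) {g : M → ℝ}
    (hg : ∀ c : M, ∀ y ∈ (chart m c).target, DifferentiableAt ℝ (fun z => g ((chart m c).symm z)) y
      ∧ ∀ v, fderiv ℝ (fun z => g ((chart m c).symm z)) y v = -A.inChart c y ![X.inChart c y, v]) :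
    ContMDiff 𝓘(ℝ, CSpace m) 𝓘(ℝ, ℝ) ∞ g ∧ ∀ x (v : TangentSpace 𝓘(ℝ, CSpace m) x), A x ![X x, v] =
      -dAt g x v := by
  have hs : ∀ c : M, ContDiffOn ℝ ∞ (fun z => g ((chart m c).symm z)) (chart m c).target := fun c =>
    by
    -- Only differentiability of `g` is known, but its derivative is a smooth expression in `A` and
    -- `X`, so `g` is smooth as well.
    rw [contDiffOn_infty_iff_fderiv_of_isOpen (isOpen_extChartAt_target c)]
    refine ⟨fun y hy => (hg c y hy).1.differentiableWithinAt, contDiffOn_clm_apply.2 fun v => ?_⟩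
    exact (contDiffOn_inChart_apply hA hX c v).neg.congr fun y hy => (hg c y hy).2 v
  have hsm : ContMDiff 𝓘(ℝ, CSpace m) 𝓘(ℝ, ℝ) ∞ g := fun x => by
    have h1 := ((hs x).contDiffAt ((isOpen_extChartAt_target x).mem_nhds
      (mem_extChartAt_target x))).contMDiffAt
    refine (ContMDiffAt.comp x h1 contMDiffAt_extChartAt).congr_of_eventuallyEq ?_
    filter_upwards [(isOpen_extChartAt_source (I := 𝓘(ℝ, CSpace m)) x).mem_nhds
      (mem_extChartAt_source x)] with z hz
    exact congrArg g ((chart m x).left_inv hz).symm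
  refine ⟨hsm, fun x => ?_⟩
  have h2 : ∀ c : M, ∀ y ∈ (chart m c).target, ∀ v : TangentSpace 𝓘(ℝ, CSpace m)
    ((chart m c).symm y), A ((chart m c).symm y) ![X ((chart m c).symm y), v] = -dAt g
    ((chart m c).symm y) v := fun c y hy v => by
    have h3 : ∀ w, A ((chart m c).symm y) ![X ((chart m c).symm y), chartInvDeriv c y w] = -dAt g
      ((chart m c).symm y) (chartInvDeriv c y w) := fun w => by
      have h3 := (hg c y hy).2 w
      rw [fderiv_comp_chart_symm' c hy hsm, inChart_apply₂, X.chartInvDeriv_inChart c hy] at h3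
      rw [h3, neg_neg]
    have h4 := h3 (mfderiv 𝓘(ℝ, CSpace m) 𝓘(ℝ, CSpace m) (chart m c) ((chart m c).symm y) v)
    rwa [chartInvDeriv_mfderiv_chart c hy] at h4
  have h4 := h2 x (chart m x x) (mem_extChartAt_target x)
  rwa [show (chart m x).symm (chart m x x) = x from extChartAt_to_inv x] at h4

theorem exists_eq_const_of_dAt_eq_zero [ConnectedSpace M] {g : M → ℝ}
    (hg : ContMDiff 𝓘(ℝ, CSpace m) 𝓘(ℝ, ℝ) ∞ g) (h : ∀ x v, dAt (m := m) g x v = 0) : ∃ r, ∀ x, g x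
    = r := by
  have hl : IsLocallyConstant g := by
    refine (IsLocallyConstant.iff_eventually_eq g).2 fun x => ?_
    obtain ⟨r, hr, hb⟩ := Metric.isOpen_iff.1 (isOpen_extChartAt_target (I := 𝓘(ℝ, CSpace m)) x) _
      (mem_extChartAt_target x)
    have hc := (continuousOn_extChartAt (I := 𝓘(ℝ, CSpace m)) x).continuousAt
      ((isOpen_extChartAt_source x).mem_nhds (mem_extChartAt_source x))
    filter_upwards [hc.eventually (Metric.ball_mem_nhds _ hr),
      (isOpen_extChartAt_source (I := 𝓘(ℝ, CSpace m)) x).mem_nhds (mem_extChartAt_source x)] with z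
      hz hz'
    have h2 := (Metric.isOpen_ball (x := chart m x x) (ε := r)).is_const_of_fderiv_eq_zero (𝕜 := ℝ)
      (f := fun z => g ((chart m x).symm z)) (convex_ball _ _).isPreconnected
      (fun y hy => (((contDiffOn_comp_symm hg x).contDiffAt ((isOpen_extChartAt_target x).mem_nhds
        (hb hy))).differentiableAt (by simp)).differentiableWithinAt)
      (fun y hy => by ext v; rw [fderiv_comp_chart_symm' x (hb hy) hg, h]; rfl) hz
        (Metric.mem_ball_self hr)
    rwa [show (chart m x).symm (chart m x x) = x from extChartAt_to_inv x, show (chart m x).symm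
      (chart m x z) = z from (chart m x).left_inv hz'] at h2
  exact ⟨g (Classical.arbitrary M), fun x => hl.apply_eq_of_preconnectedSpace _ _⟩

end

/-! ### Potentials: linearity, uniqueness, normalization. -/

section

open Filter Topology
variable {m : ℕ} {M : Type*} [TopologicalSpace M] [ChartedSpace (CSpace m) M]
  [IsManifold 𝓘(ℂ, CSpace m) ω M] [IsManifold 𝓘(ℝ, CSpace m) ∞ M]
  {G : Subgroup (Aut m M)}

section differential
variable {V : Type*} [NormedAddCommGroup V] [NormedSpace ℝ V]

theorem hasFDerivAt_comp_symm {h : M → V} (hh : ContMDiff 𝓘(ℝ, CSpace m) 𝓘(ℝ, V) ∞ h) (x : M) :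
    HasFDerivAt (fun y => h ((chart m x).symm y)) (fderiv ℝ (fun y => h ((chart m x).symm y))
      (chart m x x)) (chart m x x) :=
  (((contDiffOn_comp_symm hh x).contDiffAt ((isOpen_extChartAt_target x).mem_nhds
    (mem_extChartAt_target x))).differentiableAt (by simp)).hasFDerivAt

theorem clm_dAt {W : Type*} [NormedAddCommGroup W] [NormedSpace ℝ W] (L : V →L[ℝ] W) {h : M → V}
    (hh : ContMDiff 𝓘(ℝ, CSpace m) 𝓘(ℝ, V) ∞ h) (x : M) (v : TangentSpace 𝓘(ℝ, CSpace m) x) :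
    dAt (fun x => L (h x)) x v = L (dAt h x v) :=
  (dAt_eq_fderiv (L.contDiff.contMDiff.comp hh) x v).trans (congr($((L.hasFDerivAt.comp _
    (hasFDerivAt_comp_symm hh x)).fderiv) v).trans
    (congrArg L (dAt_eq_fderiv hh x v).symm))

theorem dAt_line {h u : M → V} (hh : ContMDiff 𝓘(ℝ, CSpace m) 𝓘(ℝ, V) ∞ h)
    (hu : ContMDiff 𝓘(ℝ, CSpace m) 𝓘(ℝ, V) ∞ u) (t : ℝ) (x : M) (v : TangentSpace 𝓘(ℝ, CSpace m) x)
    :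
    dAt (fun x => h x + t • u x) x v = dAt h x v + t • dAt u x v :=
  (dAt_eq_fderiv (contMDiff_line hh hu t) x v).trans (congr($(((hasFDerivAt_comp_symm hh x).add
    ((hasFDerivAt_comp_symm hu x).const_smul t)).fderiv) v).trans
    congr($(dAt_eq_fderiv hh x v) + t • $(dAt_eq_fderiv hu x v)).symm)

theorem dAt_const (r : V) (x : M) (v : TangentSpace 𝓘(ℝ, CSpace m) x) : dAt (fun _ : M => r) x v = 0
    :=
  congr($(mfderiv_const (I := 𝓘(ℝ, CSpace m)) (I' := 𝓘(ℝ, V)) (x := x) (c := r)) v)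

end differential

section potential
variable {η η₀ η₁ : DForm m M 2} {X : VField m M}

/-- `f` is a smooth function with `ι_X η = -df`. -/
def IsPotential (η : DForm m M 2) (X : VField m M) (f : M → ℝ) : Prop :=
  ContMDiff 𝓘(ℝ, CSpace m) 𝓘(ℝ, ℝ) ∞ f ∧ ∀ (x : M) (v : TangentSpace 𝓘(ℝ, CSpace m) x), η x
    ![X x, v] = -dAt f x v

theorem IsKillingPotential.isPotential [MeasurableSpace M] {a : ℝ} {f : M → ℝ}
    (h : IsKillingPotential η X a f) : IsPotential η X f := ⟨h.smooth, h.contract⟩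

/-- No positivity of the forms is needed, so this applies to the difference of two Kähler forms and
yields potentials along the segment. -/
theorem IsPotential.add_smul {f g : M → ℝ} (hf : IsPotential η₀ X f) (hg : IsPotential η₁ X g)
    (t : ℝ) : IsPotential (η₀ + t • η₁) X (fun x => f x + t • g x) := by
  refine ⟨contMDiff_line hf.1 hg.1 t, fun x v => ?_⟩
  rw [dAt_line hf.1 hg.1]
  have := hf.2 x v
  have := hg.2 x v
  change η₀ x _ + t * η₁ x _ = _
  simp only [smul_eq_mul] at *
  linear_combination hf.2 x v + t * hg.2 x v

theorem isPotential_const (X : VField m M) (r : ℝ) : IsPotential (0 : DForm m M 2) X (fun _ => r) :=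
  ⟨contMDiff_const, fun x v => by rw [dAt_const]; simp⟩

theorem IsPotential.exists_add_const [ConnectedSpace M] {f g : M → ℝ} (hf : IsPotential η X f)
    (hg : IsPotential η X g) : ∃ r, ∀ x, f x = g x + r := by
  have h := hf.add_smul hg (-1)
  obtain ⟨r, hr⟩ := exists_eq_const_of_dAt_eq_zero h.1 fun x v => by
    have h2 := h.2 x v
    have h3 : (η + (-1 : ℝ) • η) x ![X x, v] = 0 := by
      rw [neg_one_smul, add_neg_cancel]; rfl
    linarith
  exact ⟨r, fun x => by have := hr x; simp only [smul_eq_mul] at this; linarith⟩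

theorem IsKillingPotential.add_smul [MeasurableSpace M] [CompactSpace M] [T2Space M] [BorelSpace M]
    (k : IsKahler η) {X Y : VField m M} {a b : ℝ} {f g : M → ℝ} (hf : IsKillingPotential η X a f)
    (hg : IsKillingPotential η Y b g) (t : ℝ) :
    IsKillingPotential η (X + t • Y) (a + t * b) (f + t • g) where
  smooth := contMDiff_line hf.smooth hg.smooth t
  contract x v := by
    refine Eq.trans ?_ (congrArg (fun r : ℝ => -r) (dAt_line hf.smooth hg.smooth t x v)).symm
    have h := congr($((form2 (η x)).map_add (X x) (t • Y x)) v)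
    rw [(form2 (η x)).map_smul] at h
    refine h.trans ?_
    have h1 : η x ![X x, v] = -dAt f x v := hf.contract x v
    have h2 : η x ![Y x, v] = -dAt g x v := hg.contract x v
    change η x ![X x, v] + t * η x ![Y x, v] = _
    rw [h1, h2, smul_eq_mul]
    ring
  integral_eq := by
    have := isFiniteMeasure_kahlerVolume k.closed.1
    have h1 := integrable_of_compactSpace (μ := kahlerVolume η) hf.smooth.continuous
    have h2 := integrable_of_compactSpace (μ := kahlerVolume η) hg.smooth.continuous
    simp only [Pi.add_apply, Pi.smul_apply, smul_eq_mul]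
    rw [integral_add h1 (h2.const_mul t), integral_const_mul, hf.integral_eq, hg.integral_eq]

theorem IsKahler.kahlerVolume_real_pos [Nonempty M] [MeasurableSpace M] [CompactSpace M] [T2Space M]
    [BorelSpace M] (k : IsKahler η) : 0 < (kahlerVolume η).real Set.univ := by
  have := isFiniteMeasure_kahlerVolume k.closed.1
  exact ENNReal.toReal_pos (kahlerVolume_univ_ne_zero k) (measure_ne_top _ _)

theorem IsKillingPotential.unique [ConnectedSpace M] [MeasurableSpace M] [CompactSpace M]
    [T2Space M] [BorelSpace M] (k : IsKahler η) {a : ℝ} {f g : M → ℝ}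
    (hf : IsKillingPotential η X a f) (hg : IsKillingPotential η X a g) : f = g := by
  obtain ⟨r, hr⟩ := hf.isPotential.exists_add_const hg.isPotential
  have := isFiniteMeasure_kahlerVolume k.closed.1
  have h2 := integrable_of_compactSpace (μ := kahlerVolume η) hg.smooth.continuous
  have h3 := hf.integral_eq
  simp only [hr] at h3
  rw [integral_add h2 (integrable_const r), hg.integral_eq, integral_const, smul_eq_mul] at h3
  have h4 : r = 0 := by
    have := k.kahlerVolume_real_pos
    by_contra h5
    exact (mul_ne_zero this.ne' h5) (by linarith)
  ext x
  rw [hr, h4, add_zero]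

theorem IsPotential.exists_isKillingPotential [Nonempty M] [MeasurableSpace M] [CompactSpace M]
    [T2Space M] [BorelSpace M] (k : IsKahler η) {f : M → ℝ} (hf : IsPotential η X f) (a : ℝ) : ∃ g,
    IsKillingPotential η X a g := by
  have := isFiniteMeasure_kahlerVolume k.closed.1
  have hp := k.kahlerVolume_real_pos
  obtain ⟨r, hr⟩ : ∃ r, r = (a - ∫ x, f x ∂(kahlerVolume η)) / (kahlerVolume η).real Set.univ :=
    ⟨_, rfl⟩
  -- A constant is a potential for the zero form, so adding it keeps `f` a potential; `r` is the
  -- shift that corrects the integral.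
  have h := hf.add_smul (isPotential_const X r) 1
  rw [smul_zero, add_zero] at h
  refine ⟨_, h.1, h.2, ?_⟩
  rw [integral_add (integrable_of_compactSpace hf.1.continuous) (integrable_const _),
    integral_const, hr, one_smul, smul_eq_mul]
  field_simp
  ring

end potential

end

/-! ### Invariance of integrals of functions of normalized potentials. -/

section

open Filter Topology
variable {m : ℕ} {M : Type*} [TopologicalSpace M] [ChartedSpace (CSpace m) M]
  [IsManifold 𝓘(ℂ, CSpace m) ω M] [IsManifold 𝓘(ℝ, CSpace m) ∞ M]
  {G : Subgroup (Aut m M)} {Ω : DeRhamH2 m M} {η₀ η₁ : DForm m M 2}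

theorem exists_primitive_of_mem_kahlerSpace (h₀ : η₀ ∈ kahlerSpace G Ω) (h₁ : η₁ ∈ kahlerSpace G Ω)
    : ∃ α : DForm m M 1, α.IsSmooth ∧ HasExtDeriv α (η₁ - η₀) := by
  obtain ⟨k₀, e₀, -⟩ := h₀
  obtain ⟨k₁, e₁, -⟩ := h₁
  exact ((Submodule.Quotient.eq _).1 (e₁.trans e₀.symm)).2

/-- With `Z` the field dual to `α`: `dh(Z) = -η(X, Z) = η(Z, X) = α(X)`. -/
theorem dAt_sharpField {ι : Type*} [Fintype ι] {η : DForm m M 2} (k : IsKahler η)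
    {X : ι → VField m M} {h : M → ι → ℝ} (hh : ∀ i, IsPotential η (X i) fun x => h x i)
    (α : DForm m M 1) (x : M) :
    dAt h x (sharpField η α x) = fun i => α x ![X i x] := by
  have hs : ContMDiff 𝓘(ℝ, CSpace m) 𝓘(ℝ, ι → ℝ) ∞ h := contMDiff_pi_space.2 fun i => (hh i).1
  ext i
  refine (clm_dAt (ContinuousLinearMap.proj (R := ℝ) (φ := fun _ : ι => ℝ) i) hs x _).symm.trans ?_
  have h1 := (hh i).2 x (sharpField η α x)
  rw [form2_alt, sharpField_spec k] at h1
  exact (neg_injective h1).symm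

variable [CompactSpace M] [T2Space M] [MeasurableSpace M] [BorelSpace M]

/-- The derivative does not depend on the primitive used to compute it, and each pull-back of `α` by
`G` is a smooth primitive. Averaging these formulas over `G`, with Fubini and linearity of the
differential of `F`, replaces `α(X)` by its mean `D`. Only smooth primitives enter, and `D` depends
on neither `t` nor `F`. -/
theorem hasDerivAt_integral_segment {ι : Type*} [Fintype ι] (hG : IsCompactGroup G)
    (hη₀ : η₀ ∈ kahlerSpace G Ω) (hη₁ : η₁ ∈ kahlerSpace G Ω) :
    ∃ D : VField m M → M → ℝ, (∀ X ∈ lieAlg G, IsPotential (η₁ - η₀) X (D X)) ∧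
      ∀ {X : ι → VField m M} {h u : M → ι → ℝ} {F : (ι → ℝ) → ℝ}, (∀ i, X i ∈ lieAlg G) → ContDiff ℝ
        ∞ F → (∀ i, IsPotential η₀ (X i) fun x => h x i) → (∀ i, IsPotential (η₁ - η₀) (X i) fun x
        => u x i) →
        ContinuousOn (fun t => ∫ x, F (h x + t • u x) ∂(kahlerVolume
          (KahlerGeometry.segment η₀ η₁ t))) (Set.Icc 0 1) ∧
        ∀ t ∈ Set.Ioo (0 : ℝ) 1, HasDerivAt (fun t => ∫ x, F (h x + t • u x)
          ∂(kahlerVolume (KahlerGeometry.segment η₀ η₁ t)))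
          (∫ x, fderiv ℝ F (h x + t • u x) (u x - fun i => D (X i) x)
            ∂(kahlerVolume (KahlerGeometry.segment η₀ η₁ t))) t := by
  obtain ⟨α, hα, hdα⟩ := exists_primitive_of_mem_kahlerSpace hη₀ hη₁
  obtain ⟨k₀, -, i₀⟩ := hη₀
  obtain ⟨k₁, -, i₁⟩ := hη₁
  obtain ⟨_, _, _, _, μ, _, ψ, hψG, hψ, hinv⟩ := exists_right_invariant_mean hG
  have hA : ∀ p, HasExtDeriv (pullback (ψ p) α) (η₁ - η₀) := fun p => by
    have := hdα.pullback (ψ p) hα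
    rwa [pullback_sub, i₀.pullback_eq (hψG p), i₁.pullback_eq (hψG p)] at this
  have hsm : (η₁ - η₀).IsSmooth := (sub_mem k₁.closed k₀.closed).1
  refine ⟨avgEval μ ψ α, fun X hX => contMDiff_of_fderiv_eq hsm hX fun c y hy => hasFDerivAt_avgEval
    hG hψ hinv hα hA hX hy, ?_⟩
  intro X h u F hX hF hh hu
  have hhs : ContMDiff 𝓘(ℝ, CSpace m) 𝓘(ℝ, ι → ℝ) ∞ h := contMDiff_pi_space.2 fun i => (hh i).1
  have hus : ContMDiff 𝓘(ℝ, CSpace m) 𝓘(ℝ, ι → ℝ) ∞ u := contMDiff_pi_space.2 fun i => (hu i).1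
  obtain ⟨hc, hd⟩ := integral_segment F k₀ k₁ hF hhs hus
  refine ⟨hc, fun t ht => ?_⟩
  have kt := k₀.segment k₁ (Set.Ioo_subset_Icc_self ht)
  have := isFiniteMeasure_kahlerVolume kt.closed.1
  set ν := kahlerVolume (KahlerGeometry.segment η₀ η₁ t)
  have hht : ∀ i, IsPotential (KahlerGeometry.segment η₀ η₁ t) (X i) fun x => (h x + t • u x) i :=
    fun i => (hh i).add_smul (hu i) t
  let b : G → M → ι → ℝ := fun p x i => pullback (ψ p) α x ![X i x]
  have hb : Continuous fun q : G × M => b q.1 q.2 := continuous_pi fun i =>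
    continuous_pullback_apply hψ hα (hX i)
  have hdp : ∀ p, HasDerivAt (fun t => ∫ x, F (h x + t • u x)
    ∂(kahlerVolume (KahlerGeometry.segment η₀ η₁ t))) (∫ x, fderiv ℝ F (h x + t • u x) (u x - b p x)
    ∂ν) t := fun p => by
    refine (hd _ (hα.pullback (ψ p)) (hA p) t ht).congr_deriv
      (integral_congr_ae (Eventually.of_forall fun x => ?_))
    simp only [dAt_sharpField kt hht]
    rfl
  have p₀ : G := 1
  refine (hdp p₀).congr_deriv ?_
  have hcont : Continuous (Function.uncurry fun (p : G) x => fderiv ℝ F (h x + t • u x)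
    (u x - b p x)) :=
    ((hF.continuous_fderiv (by simp)).comp ((contMDiff_line hhs hus t).continuous.comp
      continuous_snd)).clm_apply ((hus.continuous.comp continuous_snd).sub hb)
  -- By uniqueness of derivatives the inner integral is the same for every `p`, so averaging does
  -- not change it.
  have e1 : ∫ p, ∫ x, fderiv ℝ F (h x + t • u x) (u x - b p x) ∂ν ∂μ = ∫ x, fderiv ℝ F
    (h x + t • u x) (u x - b p₀ x) ∂ν := by
    rw [integral_congr_ae (Eventually.of_forall fun p => (hdp p).unique (hdp p₀)), integral_const,
      probReal_univ, one_smul]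
  rw [← e1, integral_integral_swap_of_hasCompactSupport hcont (HasCompactSupport.of_compactSpace _)]
  refine integral_congr_ae (Eventually.of_forall fun x => ?_)
  have hbx : Continuous fun p => b p x := hb.comp (Continuous.prodMk_left x)
  have hbi : Integrable (fun p => b p x) μ := integrable_of_compactSpace hbx
  have e2 : (fun i => avgEval μ ψ α (X i) x) = ∫ p, b p x ∂μ := by
    ext i
    exact (ContinuousLinearMap.integral_comp_comm (ContinuousLinearMap.proj (R := ℝ)
      (φ := fun _ : ι => ℝ) i) hbi)
  simp only
  have e3 : Integrable (fun p => u x - b p x) μ := (integrable_const _).sub hbi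
  rw [e2, (fderiv ℝ F (h x + t • u x)).integral_comp_comm e3, integral_sub (integrable_const _) hbi,
    integral_const, probReal_univ, one_smul]

/-- Both `h₁ - h₀` and `D` are potentials for `η₁ - η₀`, so on the connected `M` they differ by a
constant vector `r`, and the derivative along the segment is the integral of `dF(r)`. The
normalization gives `r = 0`. -/
theorem integral_comp_eq_of_integral_eq [ConnectedSpace M] {ι : Type*} [Fintype ι]
    (hG : IsCompactGroup G) (hη₀ : η₀ ∈ kahlerSpace G Ω) (hη₁ : η₁ ∈ kahlerSpace G Ω)
    {X : ι → VField m M} {a : ι → ℝ} {h₀ h₁ : M → ι → ℝ} {F : (ι → ℝ) → ℝ}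
      (hX : ∀ i, X i ∈ lieAlg G) (hF : ContDiff ℝ ∞ F)
    (hh₀ : ∀ i, IsKillingPotential η₀ (X i) (a i) fun x => h₀ x i)
      (hh₁ : ∀ i, IsKillingPotential η₁ (X i) (a i) fun x => h₁ x i) :
    ∫ x, F (h₀ x) ∂(kahlerVolume η₀) = ∫ x, F (h₁ x) ∂(kahlerVolume η₁) := by
  obtain ⟨D, hD, hI⟩ := hasDerivAt_integral_segment (ι := ι) hG hη₀ hη₁
  have k₀ := hη₀.1
  have k₁ := hη₁.1
  have hs0 : KahlerGeometry.segment η₀ η₁ 0 = η₀ := by simp [segment_eq]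
  have hs1 : KahlerGeometry.segment η₀ η₁ 1 = η₁ := by simp [segment_eq]
  have hu : ∀ i, IsPotential (η₁ - η₀) (X i) fun x => (h₁ x - h₀ x) i := fun i => by
    have := (hh₁ i).isPotential.add_smul (hh₀ i).isPotential (-1)
    simpa only [neg_one_smul, ← sub_eq_add_neg, ← Pi.sub_apply (h₁ _) (h₀ _) i] using this
  have hc : ∀ i, ∃ r, ∀ x, (h₁ x - h₀ x) i = D (X i) x + r := fun i => (hu i).exists_add_const
    (hD _ (hX i))
  choose r hr using hc
  have hw : ∀ x, (h₁ x - h₀ x - fun i => D (X i) x) = r := fun x => by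
    ext i
    have := hr i x
    simp only [Pi.sub_apply] at this ⊢
    linarith
  have hI' := fun {F : (ι → ℝ) → ℝ} (hF : ContDiff ℝ ∞ F) => hI (F := F) hX hF
    (fun i => (hh₀ i).isPotential) hu
  simp only [hw] at hI'
  have key : ∀ {F : (ι → ℝ) → ℝ}, ContDiff ℝ ∞ F → ∃ t ∈ Set.Ioo (0 : ℝ) 1, ∫ x, fderiv ℝ F
    (h₀ x + t • (h₁ x - h₀ x)) r ∂(kahlerVolume (KahlerGeometry.segment η₀ η₁ t)) = ∫ x, F (h₁ x)
    ∂(kahlerVolume η₁) - ∫ x, F (h₀ x) ∂(kahlerVolume η₀) := fun {F} hF => by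
    obtain ⟨t, ht, e⟩ := exists_hasDerivAt_eq_slope _ _ zero_lt_one (hI' hF).1 (hI' hF).2
    refine ⟨t, ht, e.trans ?_⟩
    simp only [zero_smul, add_zero, one_smul, add_sub_cancel, hs0, hs1, sub_zero, div_one]
  -- For `F` the `i`-th coordinate the mean value theorem gives `r i` times a positive volume, and
  -- this equals the difference `a i - a i` of the integrals at the ends.
  have hr0 : r = 0 := by
    ext i
    obtain ⟨t, ht, e⟩ := key (ContinuousLinearMap.proj (R := ℝ) (φ := fun _ : ι => ℝ) i).contDiff
    simp only [ContinuousLinearMap.fderiv, ContinuousLinearMap.proj_apply] at e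
    rw [(hh₀ i).integral_eq, (hh₁ i).integral_eq, sub_self, integral_const, smul_eq_mul] at e
    exact (mul_eq_zero.1 e).resolve_left (k₀.segment k₁ (Set.Ioo_subset_Icc_self
      ht)).kahlerVolume_real_pos.ne'
  obtain ⟨t, ht, e⟩ := key hF
  simp only [hr0, map_zero, integral_zero] at e
  linarith

/-- Adding `D X`, a potential for `η₁ - η₀`, carries a potential from one form to the other; a
constant then restores the integral. So which fields have potentials depends only on the class. -/
theorem exists_isKillingPotential_of_mem_kahlerSpace [ConnectedSpace M] (hG : IsCompactGroup G)
    (hη₀ : η₀ ∈ kahlerSpace G Ω) (hη₁ : η₁ ∈ kahlerSpace G Ω) {X : VField m M} (hX : X ∈ lieAlg G)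
    {a : ℝ} {h : M → ℝ}
    (hh : IsKillingPotential η₀ X a h) : ∃ h', IsKillingPotential η₁ X a h' := by
  obtain ⟨D, hD, -⟩ := hasDerivAt_integral_segment (ι := Unit) hG hη₀ hη₁
  have h1 := hh.isPotential.add_smul (hD X hX) 1
  rw [one_smul, add_sub_cancel] at h1
  exact h1.exists_isKillingPotential hη₁.1 a

end

/-! ### The weighted product of potentials. -/

section

open Filter Topology
-- The invariance statement needs `F` smooth on the whole vector space. Here `c` is blended with the
-- constant `ε` by a transition that is `0` for `c ≤ ε / 2` and `1` for `c ≥ ε`, so the base of the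
-- power stays positive.
theorem exists_contDiff_eq_inv_pow {ε : ℝ} (hε : 0 < ε) (n : ℕ) : ∃ k : ℝ → ℝ, ContDiff ℝ ∞ k ∧ ∀ c,
    ε ≤ c → k c = (c ^ n)⁻¹ := by
  have hs : ContDiff ℝ ∞ fun c : ℝ => Real.smoothTransition (2 * c / ε - 1) :=
    Real.smoothTransition.contDiff.comp (by fun_prop)
  have hφ : ContDiff ℝ ∞ fun c : ℝ => Real.smoothTransition (2 * c / ε - 1) * c +
    (1 - Real.smoothTransition (2 * c / ε - 1)) * ε := by fun_prop
  have hpos : ∀ c : ℝ, 0 < Real.smoothTransition (2 * c / ε - 1) * c +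
    (1 - Real.smoothTransition (2 * c / ε - 1)) * ε := fun c => by
    rcases le_or_gt c (ε / 2) with h | h
    · rw [Real.smoothTransition.zero_of_nonpos]
      · simpa using hε
      · rw [sub_nonpos, div_le_one hε]; linarith
    · have hc : 0 < c := by linarith
      have h0 := Real.smoothTransition.nonneg (2 * c / ε - 1)
      have h1 := Real.smoothTransition.le_one (2 * c / ε - 1)
      rcases h0.eq_or_lt with h2 | h2
      · rw [← h2]; simpa using hε
      · have := mul_pos h2 hc
        have := mul_nonneg (sub_nonneg.2 h1) hε.le
        linarith
  refine ⟨fun c => ((Real.smoothTransition (2 * c / ε - 1) * c +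
    (1 - Real.smoothTransition (2 * c / ε - 1)) * ε) ^ n)⁻¹, (hφ.pow n).inv fun c =>
    (pow_pos (hpos c) n).ne', fun c hc => ?_⟩
  have : Real.smoothTransition (2 * c / ε - 1) = 1 := Real.smoothTransition.one_of_one_le (by
    have : 2 ≤ 2 * c / ε := by rw [le_div_iff₀ hε]; linarith
    linarith)
  simp only [this]
  simp

theorem exists_pos_forall_le {X : Type*} [TopologicalSpace X] [CompactSpace X] [Nonempty X]
    {f : X → ℝ} (hf : Continuous f) (h : ∀ x, 0 < f x) : ∃ ε > 0, ∀ x, ε ≤ f x := by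
  obtain ⟨x, -, hx⟩ := isCompact_univ.exists_isMinOn Set.univ_nonempty hf.continuousOn
  exact ⟨f x, h x, fun y => hx (Set.mem_univ y)⟩

variable {m : ℕ} {M : Type*} [TopologicalSpace M] [ChartedSpace (CSpace m) M]
  [IsManifold 𝓘(ℂ, CSpace m) ω M] [IsManifold 𝓘(ℝ, CSpace m) ∞ M]
  {G : Subgroup (Aut m M)} {Ω : DeRhamH2 m M} {η₀ η₁ : DForm m M 2}
  [CompactSpace M] [T2Space M] [ConnectedSpace M] [MeasurableSpace M] [BorelSpace M]

/-- The three fields `H`, `H'`, `K` are treated at once with `F(v) = v 0 * v 1 * k (v 2)`, where `k`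
is the inverse power above a common positive lower bound of `f₀` and `f₁`. -/
theorem integral_mul_div_pow_eq (hG : IsCompactGroup G) (hη₀ : η₀ ∈ kahlerSpace G Ω)
    (hη₁ : η₁ ∈ kahlerSpace G Ω) {H H' K : VField m M} (hH : H ∈ lieAlg G) (hH' : H' ∈ lieAlg G)
    (hK : K ∈ lieAlg G)
    {b b' a : ℝ} {h₀ h₀' f₀ h₁ h₁' f₁ : M → ℝ} (e₀ : IsKillingPotential η₀ H b h₀)
      (e₁ : IsKillingPotential η₁ H b h₁)
    (e₀' : IsKillingPotential η₀ H' b' h₀') (e₁' : IsKillingPotential η₁ H' b' h₁')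
      (eK₀ : IsKillingPotential η₀ K a f₀) (eK₁ : IsKillingPotential η₁ K a f₁)
    (p₀ : ∀ x, 0 < f₀ x) (p₁ : ∀ x, 0 < f₁ x) (n : ℕ) :
    ∫ x, h₀ x * h₀' x / f₀ x ^ n ∂(kahlerVolume η₀) = ∫ x, h₁ x * h₁' x / f₁ x ^ n
      ∂(kahlerVolume η₁) := by
  obtain ⟨ε₀, q₀, l₀⟩ := exists_pos_forall_le eK₀.smooth.continuous p₀
  obtain ⟨ε₁, q₁, l₁⟩ := exists_pos_forall_le eK₁.smooth.continuous p₁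
  obtain ⟨k, hk, hk'⟩ := exists_contDiff_eq_inv_pow (lt_min q₀ q₁) n
  have h := integral_comp_eq_of_integral_eq (ι := Fin 3) hG hη₀ hη₁ (X := ![H, H', K])
    (a := ![b, b', a]) (h₀ := fun x => ![h₀ x, h₀' x, f₀ x]) (h₁ := fun x => ![h₁ x, h₁' x, f₁ x])
    (F := fun v => v 0 * v 1 * k (v 2)) (by intro i; fin_cases i <;> assumption) (by fun_prop)
      (by intro i; fin_cases i <;> assumption) (by intro i; fin_cases i <;> assumption)
  simp only [Matrix.cons_val_zero, Matrix.cons_val_one, Matrix.cons_val] at h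
  simpa only [hk' _ ((min_le_left _ _).trans (l₀ _)), hk' _ ((min_le_right _ _).trans (l₁ _)), ←
    div_eq_mul_inv] using h

theorem isKillingPotential_zero (η : DForm m M 2) : IsKillingPotential η 0 0 0 where
  smooth := contMDiff_const
  contract x v := by
    refine Eq.trans ?_ ((isPotential_const (m := m) (M := M) 0 0).2 x v)
    exact congr($((form2 (η x)).map_zero) v)
  integral_eq := by simp

/-- The elements of `𝔤` which have a Killing potential with integral zero. -/
def potentialSubmodule (G : Subgroup (Aut m M)) (k : IsKahler η₀) : Submodule ℝ (lieAlg G) where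
  carrier := {H | ∃ h, IsKillingPotential η₀ (H : VField m M) 0 h}
  zero_mem' := ⟨0, isKillingPotential_zero η₀⟩
  add_mem' := fun {H H'} ⟨h, hh⟩ ⟨h', hh'⟩ => ⟨h + (1 : ℝ) • h',
    by simpa using IsKillingPotential.add_smul k hh hh' 1⟩
  smul_mem' := fun c H ⟨h, hh⟩ =>
    ⟨0 + c • h, by simpa using IsKillingPotential.add_smul k (isKillingPotential_zero η₀) hh c⟩

/-- The Killing potential with integral zero. -/
def potential (k : IsKahler η₀) : potentialSubmodule G k →ₗ[ℝ] M → ℝ where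
  toFun H := H.2.choose
  -- Linearity of the chosen potentials follows from uniqueness of the normalized potential.
  map_add' H H' := (H + H').2.choose_spec.unique k
    (by simpa using IsKillingPotential.add_smul k H.2.choose_spec H'.2.choose_spec 1)
  map_smul' c H := (c • H).2.choose_spec.unique k
    (by simpa using IsKillingPotential.add_smul k (isKillingPotential_zero η₀) H.2.choose_spec c)

theorem isKillingPotential_potential (k : IsKahler η₀) (H : potentialSubmodule G k) :
    IsKillingPotential η₀ (H : lieAlg G) 0 (potential k H) := H.2.choose_spec

/-- The weighted `L²` product of the Killing potentials with integral zero. -/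
def weightedProduct (k : IsKahler η₀) {w : M → ℝ} (hw : Continuous w) (hw0 : ∀ x, w x ≠ 0) :
    LinearMap.BilinForm ℝ (potentialSubmodule G k) :=
  have := isFiniteMeasure_kahlerVolume k.closed.1
  have hi : ∀ H H' : potentialSubmodule G k, Integrable (fun x => potential k H x * potential k H' x
    / w x) (kahlerVolume η₀) := fun H H' =>
    integrable_of_compactSpace (((isKillingPotential_potential k H).smooth.continuous.mul
      (isKillingPotential_potential k H').smooth.continuous).div hw hw0)
  LinearMap.mk₂ ℝ (fun H H' => ∫ x, potential k H x * potential k H' x / w x ∂(kahlerVolume η₀))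
    (fun H H' L =>
      by simp only [map_add, Pi.add_apply, add_mul, add_div]; exact integral_add (hi _ _) (hi _ _))
    (fun c H L =>
      by simp only [map_smul, Pi.smul_apply, smul_eq_mul, mul_assoc, mul_div_assoc]; exact integral_const_mul _ _)
    (fun H L L' =>
      by simp only [map_add, Pi.add_apply, mul_add, add_div]; exact integral_add (hi _ _) (hi _ _))
    (fun c H L =>
      by simp only [map_smul, Pi.smul_apply, smul_eq_mul, mul_left_comm _ c, mul_div_assoc]; exact integral_const_mul _ _)

end

end KahlerGeometry

end

/-! ### The bilinear form on the Lie algebra. -/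

open KahlerGeometry
theorem mainTheorem5 (m : ℕ) (hm : 2 ≤ m)
    (M : Type*) [TopologicalSpace M] [T2Space M] [CompactSpace M] [ConnectedSpace M]
    [MeasurableSpace M] [BorelSpace M]
    [ChartedSpace (CSpace m) M] [IsManifold 𝓘(ℂ, CSpace m) ω M]
    (Ω : DeRhamH2 m M)
    (G : Subgroup (Aut m M)) (hG : IsCompactGroup G) (hGr : G ≤ reducedAut m M)
    (K : VField m M) (hK : K ∈ lieAlg G) (a : ℝ) (ha : 0 < a)
    (hf : ∀ η ∈ kahlerSpace G Ω, ∃ f : M → ℝ, IsKillingPotential η K a f ∧ ∀ x, 0 < f x) :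
    ∃ B : LinearMap.BilinForm ℝ (lieAlg G),
      ∀ η ∈ kahlerSpace G Ω, ∀ f : M → ℝ, IsKillingPotential η K a f →
        ∀ (H₁ H₂ : lieAlg G) (h₁ h₂ : M → ℝ),
          IsKillingPotential η H₁ 0 h₁ → IsKillingPotential η H₂ 0 h₂ →
            B H₁ H₂ = ∫ x, h₁ x * h₂ x / f x ^ (2 * m + 1) ∂(kahlerVolume η) := by
  have : IsManifold 𝓘(ℝ, CSpace m) ω M := isManifold_real
  have : IsManifold 𝓘(ℝ, CSpace m) ∞ M := IsManifold.of_le (n := ω) le_top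
  rcases (kahlerSpace G Ω).eq_empty_or_nonempty with h | ⟨η₀, hη₀⟩
  · exact ⟨0, by simp [h]⟩
  obtain ⟨f₀, e₀, p₀⟩ := hf η₀ hη₀
  have k₀ : IsKahler η₀ := hη₀.1
  -- A linear projection onto the fields having potentials extends the product to the whole Lie
  -- algebra; its values on other fields play no role in the conclusion.
  obtain ⟨π, hπ⟩ := (potentialSubmodule G k₀).subtype.exists_leftInverse_of_injective
    (Submodule.ker_subtype _)
  have hwc : Continuous fun x => f₀ x ^ (2 * m + 1) := e₀.smooth.continuous.pow _
  have hw0 : ∀ x, f₀ x ^ (2 * m + 1) ≠ 0 := fun x => (pow_pos (p₀ x) _).ne'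
  refine ⟨(weightedProduct k₀ hwc hw0).compl₁₂ π π, fun η hη f hK' H₁ H₂ h₁ h₂ e₁ e₂ => ?_⟩
  have k := hη.1
  -- The given potential of `K` is the positive one, by uniqueness.
  have p : ∀ x, 0 < f x := by
    obtain ⟨f', hf', p'⟩ := hf η hη
    rwa [hK'.unique k hf']
  -- A field with a potential for `η` also has one for `η₀`, so the projection fixes it.
  have hmem : ∀ (H : lieAlg G) (h : M → ℝ), IsKillingPotential η H 0 h → H ∈ potentialSubmodule G k₀
    := fun H h hh => exists_isKillingPotential_of_mem_kahlerSpace hG hη hη₀ H.2 hh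
  have hπ' : ∀ H (hH : H ∈ potentialSubmodule G k₀), π H = ⟨H, hH⟩ := fun H hH =>
    LinearMap.congr_fun hπ ⟨H, hH⟩
  rw [LinearMap.compl₁₂_apply, hπ' _ (hmem _ _ e₁), hπ' _ (hmem _ _ e₂)]
  exact integral_mul_div_pow_eq hG hη₀ hη H₁.2 H₂.2 hK (isKillingPotential_potential k₀
    ⟨H₁, hmem _ _ e₁⟩) e₁ (isKillingPotential_potential k₀ ⟨H₂, hmem _ _ e₂⟩) e₂ e₀ hK' p₀ p _
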